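/- Fix a real number $\xi>0$ with $\xi\neq 1$. Let $V=\bigoplus_{n\in\mathbb Z}V_n$ be a graded complex vector space and $F$ a graded automorphism of $V$. For $\alpha\in\mathbb C^\ast$ let $V_{n,\alpha}\subset V_n$ denote the degree $n$ part of the generalized $\alpha$-eigenspace of $F$. The pair $(V,F)$ is called pure of weight $m\in\mathbb R$ if every element of $V$ lies in a finite dimensional $F$-invariant graded subspace, and $V_{n,\alpha}\neq 0$ implies $|\alpha|=\xi^{n+m}$. A complex with an endomorphism is called pure of weight $m$ if its cohomology with the induced endomorphism is. Let $\mathcal O$ be a (symmetric, unital) DG-operad over $\mathbb C$ that is concentrated in nonpositive cohomological degrees, i.e. $\mathcal O(n)^p=0$ for all $n$ and all $p>0$ (for instance an ordinary $\mathbb C$-linear operad, placed in degree $0$). **Theorem.** (1) Let $B$ be an $\mathcal O$-algebra and let $F:B\to B$ be a quasi-isomorphism of $\mathcal O$-algebras such that $(B,F)$ is pure of weight zero. Then $B$ is formal: $B$ is isomorphic to $(H^\ast(B),d=0)$, with its induced $\mathcal O$-algebra structure, in the homotopy category of $\mathcal O$-algebras, that is, the category of $\mathcal O$-algebras with quasi-isomorphisms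 inverted. (2) Assume moreover that $B$ has zero differential. Let $N$ be a (DG-)module over the $\mathcal O$-algebra $B$, and let $F:N\to N$ be a $\mathbb C$-linear endomorphism of complexes such that $$F(\mu(b_1,\ldots,b_{l-1},n))=\mu(F(b_1),\ldots,F(b_{l-1}),F(n))$$ for all $l\geq 1$, $\mu\in\mathcal O(l)$, $b_1,\ldots,b_{l-1}\in B$, $n\in N$. If $(N,F)$ is pure of some weight $m$, then $N$ is formal: $N$ is isomorphic to $(H^\ast(N),d=0)$, with its induced $B$-module structure, in the derived category $D(B)$, that is, the category of $B$-modules with quasi-isomorphisms inverted. Here the induced structure on $H^\ast(B)$ (respectively $H^\ast(N)$) is the one in which $\mathcal O$ acts through the projection $\mathcal O\to H^0(\mathcal O)$; under the assumptions above it exists, and every cocycle of $\mathcal O$ acts on cohomology classes through representatives. -/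

import Mathlib

open CategoryTheory

universe u

noncomputable section

namespace OperadicFormality

/-! ### Complexes of complex vector spaces -/

/-- A cochain complex of `ℂ`-vector spaces (not necessarily bounded), presented as its total space
with an internal `ℤ`-grading and a differential of degree `+1`. -/
structure DGSpace where
  carrier : Type u
  [addCommGroup : AddCommGroup carrier]
  [module : Module ℂ carrier]
  gr : ℤ → Submodule ℂ carrier
  isInternal : DirectSum.IsInternal gr
  d : carrier →ₗ[ℂ] carrier
  d_mem : ∀ (i : ℤ) (x : carrier), x ∈ gr i → d x ∈ gr (i + 1)
  d_d : ∀ x : carrier, d (d x) = 0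

instance : CoeSort DGSpace.{u} (Type u) := ⟨DGSpace.carrier⟩

attribute [instance] DGSpace.addCommGroup DGSpace.module

namespace DGSpace

/-- Chain maps: linear maps of degree zero that commute with the differentials. -/
@[ext]
structure Hom (V W : DGSpace.{u}) where
  lin : V →ₗ[ℂ] W
  map_mem : ∀ (i : ℤ) (x : V), x ∈ V.gr i → lin x ∈ W.gr i
  map_d : ∀ x : V, lin (V.d x) = W.d (lin x)

/-- The identity chain map. -/
def Hom.id (V : DGSpace.{u}) : Hom V V where
  lin := LinearMap.id
  map_mem _ _ hx := hx
  map_d _ := rfl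

/-- Composition of chain maps (first `f`, then `g`). -/
def Hom.comp {U V W : DGSpace.{u}} (f : Hom U V) (g : Hom V W) : Hom U W where
  lin := g.lin ∘ₗ f.lin
  map_mem i x hx := g.map_mem i _ (f.map_mem i x hx)
  map_d x := by simp [f.map_d, g.map_d]

/-- The cocycles. -/
abbrev cocycles (V : DGSpace.{u}) : Submodule ℂ V := LinearMap.ker V.d

/-- The coboundaries, as a subspace of the cocycles. -/
abbrev coboundaries (V : DGSpace.{u}) : Submodule ℂ V.cocycles :=
  (LinearMap.range V.d).comap V.cocycles.subtype

/-- The total cohomology `H^*(V) = ker d / im d`. -/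
abbrev HH (V : DGSpace.{u}) : Type u := V.cocycles ⧸ V.coboundaries

/-- The class of a cocycle. -/
abbrev cls (V : DGSpace.{u}) : V.cocycles →ₗ[ℂ] V.HH := V.coboundaries.mkQ

/-- The summand `H^i(V)`: the classes of cocycles of degree `i`. -/
def hgr (V : DGSpace.{u}) (i : ℤ) : Submodule ℂ V.HH :=
  ((V.gr i).comap V.cocycles.subtype).map V.cls

/-- The projection of a complex to its component of degree `i`. -/
def proj (V : DGSpace.{u}) (i : ℤ) : V →ₗ[ℂ] V :=
  letI := V.isInternal.chooseDecomposition
  (V.gr i).subtype ∘ₗ DirectSum.component ℂ ℤ (fun i => V.gr i) i ∘ₗ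
    (DirectSum.decomposeLinearEquiv V.gr).toLinearMap

theorem proj_mem (V : DGSpace.{u}) (i : ℤ) (x : V) : V.proj i x ∈ V.gr i := by
  simp [proj]

theorem proj_same (V : DGSpace.{u}) (i : ℤ) (x : V) (hx : x ∈ V.gr i) : V.proj i x = x := by
  let _ := V.isInternal.chooseDecomposition
  exact DirectSum.decompose_of_mem_same V.gr hx

theorem proj_ne (V : DGSpace.{u}) {i j : ℤ} (hij : i ≠ j) (x : V) (hx : x ∈ V.gr i) :
    V.proj j x = 0 := by
  let _ := V.isInternal.chooseDecomposition
  exact DirectSum.decompose_of_mem_ne V.gr hx hij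

theorem proj_induction (V : DGSpace.{u}) {p : V → Prop} (x : V) (h0 : p 0)
    (hadd : ∀ x y, p x → p y → p (x + y)) (hm : ∀ (i : ℤ) (x : V), x ∈ V.gr i → p x) : p x := by
  have hx : x ∈ ⨆ i, V.gr i := by
    rw [V.isInternal.submodule_iSup_eq_top]; trivial
  exact Submodule.iSup_induction V.gr (motive := p) hx hm h0 hadd

theorem proj_d (V : DGSpace.{u}) (i : ℤ) (x : V) : V.proj (i + 1) (V.d x) = V.d (V.proj i x) := by
  induction x using V.proj_induction with
  | h0 => simp
  | hadd x y hx hy => simp [hx, hy]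
  | hm j x hx =>
    by_cases h : j = i
    · subst h
      rw [V.proj_same _ _ hx, V.proj_same _ _ (V.d_mem _ _ hx)]
    · rw [V.proj_ne h _ hx, V.proj_ne (by omega) _ (V.d_mem _ _ hx), map_zero]

/-- The projection on cocycles. -/
def zproj (V : DGSpace.{u}) (i : ℤ) : V.cocycles →ₗ[ℂ] V.cocycles :=
  (V.proj i).restrict fun x hx => by
    rw [LinearMap.mem_ker] at hx ⊢
    rw [← V.proj_d, hx, map_zero]

/-- The projection on cohomology. -/
def hproj (V : DGSpace.{u}) (i : ℤ) : V.HH →ₗ[ℂ] V.HH :=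
  V.coboundaries.mapQ V.coboundaries (V.zproj i) (by
    rintro ⟨x, hx⟩ ⟨y, hy⟩
    refine ⟨V.proj (i - 1) y, ?_⟩
    have h := V.proj_d (i - 1) y
    rw [sub_add_cancel, hy] at h
    exact h.symm)

theorem hgr_isInternal (V : DGSpace.{u}) : DirectSum.IsInternal V.hgr := by
  have hsame : ∀ i, ∀ x ∈ V.hgr i, V.hproj i x = x := by
    rintro i _ ⟨z, hz, rfl⟩
    refine congrArg V.cls (Subtype.ext ?_)
    exact V.proj_same i _ hz
  have hne : ∀ i j, i ≠ j → ∀ x ∈ V.hgr i, V.hproj j x = 0 := by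
    rintro i j hij _ ⟨z, hz, rfl⟩
    have : V.zproj j z = 0 := Subtype.ext (V.proj_ne hij _ hz)
    change V.cls (V.zproj j z) = 0
    rw [this, map_zero]
  rw [DirectSum.isInternal_submodule_iff_iSupIndep_and_iSup_eq_top]
  constructor
  · rw [iSupIndep_def]
    intro i
    rw [Submodule.disjoint_def]
    intro x hx hx'
    have hle : (⨆ j, ⨆ (_ : j ≠ i), V.hgr j) ≤ LinearMap.ker (V.hproj i) :=
      iSup₂_le fun j hj x hx => hne j i hj x hx
    rw [← hsame i x hx]
    exact hle hx'
  · rw [eq_top_iff]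
    rintro x -
    obtain ⟨⟨z, hz⟩, rfl⟩ := V.coboundaries.mkQ_surjective x
    let _ := V.isInternal.chooseDecomposition
    classical
    have hsum : z = ∑ i ∈ (DirectSum.decompose V.gr z).support, V.proj i z := by
      conv_lhs => rw [← DirectSum.sum_support_decompose V.gr z]
      rfl
    have : (⟨z, hz⟩ : V.cocycles)
        = ∑ i ∈ (DirectSum.decompose V.gr z).support, V.zproj i ⟨z, hz⟩ := by
      apply Subtype.ext
      rw [AddSubmonoidClass.coe_finsetSum]
      exact hsum
    rw [this, map_sum]
    refine Submodule.sum_mem _ fun i _ => Submodule.mem_iSup_of_mem i ?_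
    exact ⟨_, V.proj_mem i z, rfl⟩

/-- The cohomology `(H^*(V), d = 0)` as a complex with zero differential. -/
def cohomology (V : DGSpace.{u}) : DGSpace.{u} where
  carrier := V.HH
  gr := V.hgr
  isInternal := V.hgr_isInternal
  d := 0
  d_mem _ _ _ := Submodule.zero_mem _
  d_d _ := rfl

/-- The map induced on cohomology by a chain map. -/
def Hom.onCohomology {V W : DGSpace.{u}} (f : Hom V W) : V.HH →ₗ[ℂ] W.HH :=
  V.coboundaries.mapQ W.coboundaries
    (f.lin.restrict (p := V.cocycles) (q := W.cocycles) fun x hx => by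
      rw [LinearMap.mem_ker] at hx ⊢
      rw [← f.map_d, hx, map_zero])
    (by
      rintro ⟨x, hx⟩ ⟨y, hy⟩
      refine ⟨f.lin y, ?_⟩
      rw [← f.map_d, hy]
      rfl)

/-- Quasi-isomorphisms of complexes. -/
def Hom.IsQuasiIso {V W : DGSpace.{u}} (f : Hom V W) : Prop :=
  Function.Bijective f.onCohomology

end DGSpace

/-! ### Purity -/

/-- `f` acts locally finitely on the graded space `M`: every element lies in a finite dimensional
graded subspace that is invariant under `f`. -/
def LocallyFinite {M : Type u} [AddCommGroup M] [Module ℂ M] (gr : ℤ → Submodule ℂ M)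
    (f : M →ₗ[ℂ] M) : Prop :=
  ∀ v : M, ∃ W : Submodule ℂ M, v ∈ W ∧ FiniteDimensional ℂ W ∧ (W ≤ ⨆ i, W ⊓ gr i) ∧
    ∀ w ∈ W, f w ∈ W

/-- The graded space `M` with the graded automorphism `f` is pure of weight `m` with respect to
`ξ`: `f` acts locally finitely, and whenever the part of degree `n` of the generalized eigenspace
for `α ∈ ℂˣ` is nonzero, then `|α| = ξ ^ (n + m)`. -/
structure GradedPure (ξ m : ℝ) {M : Type u} [AddCommGroup M] [Module ℂ M]
    (gr : ℤ → Submodule ℂ M) (f : M →ₗ[ℂ] M) : Prop where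
  bijective : Function.Bijective f
  map_mem : ∀ (i : ℤ) (x : M), x ∈ gr i → f x ∈ gr i
  locallyFinite : LocallyFinite gr f
  eigenvalue : ∀ (n : ℤ) (α : ℂ), α ≠ 0 →
    gr n ⊓ Module.End.maxGenEigenspace f α ≠ ⊥ → ‖α‖ = ξ ^ ((n : ℝ) + m)

/-- A complex with an endomorphism is pure of weight `m` if its cohomology is. -/
def IsPure (ξ m : ℝ) (V : DGSpace.{u}) (f : DGSpace.Hom V V) : Prop :=
  GradedPure ξ m V.hgr f.onCohomology

/-! ### Bookkeeping for partial compositions -/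

section Bookkeeping

variable {l m n : ℕ}

/-- If an operation of arity `m` is inserted in the `i`-th slot of an operation of arity `l`, its
`x`-th input becomes the input number `i + x` of the composite (counting from zero). -/
def innerPos (h : n + 1 = l + m) (i : Fin l) (x : Fin m) : Fin n :=
  ⟨i.val + x.val, by have := i.isLt; have := x.isLt; omega⟩

/-- The position, among the inputs of the composite, of the slot `j ≠ i` of the operation of
arity `l`. -/
def outerPos (h : n + 1 = l + m) (i : Fin l) (j : Fin l) (hj : j ≠ i) : Fin n :=
  ⟨if j.val < i.val then j.val else j.val + m - 1, by
    have := i.isLt; have := j.isLt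
    have : j.val ≠ i.val := fun e => hj (Fin.ext e)
    split <;> omega⟩

/-- The inputs of a composite are the inputs of the inner operation and the slots `j ≠ i` of the
outer operation. -/
def position (h : n + 1 = l + m) (i : Fin l) : Fin m ⊕ {j : Fin l // j ≠ i} ≃ Fin n :=
  Equiv.ofBijective (Sum.elim (innerPos h i) fun j => outerPos h i j.1 j.2) (by
    rw [Fintype.bijective_iff_injective_and_card]
    constructor
    · rintro (x | ⟨j, hj⟩) (y | ⟨k, hk⟩) e
      · have e := congrArg Fin.val e
        simp only [Sum.elim_inl, innerPos] at e
        exact congrArg Sum.inl (Fin.ext (by omega))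
      · have e := congrArg Fin.val e
        have : k.val ≠ i.val := fun e => hk (Fin.ext e)
        have := x.isLt
        simp only [Sum.elim_inl, Sum.elim_inr, innerPos, outerPos] at e
        split at e <;> omega
      · have e := congrArg Fin.val e
        have : j.val ≠ i.val := fun e => hj (Fin.ext e)
        have := y.isLt
        simp only [Sum.elim_inl, Sum.elim_inr, innerPos, outerPos] at e
        split at e <;> omega
      · have e := congrArg Fin.val e
        have : j.val ≠ i.val := fun e => hj (Fin.ext e)
        have : k.val ≠ i.val := fun e => hk (Fin.ext e)
        simp only [Sum.elim_inr, outerPos] at e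
        refine congrArg Sum.inr (Subtype.ext (Fin.ext ?_))
        change j.val = k.val
        split at e <;> split at e <;> omega
    · have := i.isLt
      simp only [Fintype.card_sum, Fintype.card_fin, Fintype.card_subtype_compl,
        Fintype.card_unique]
      omega)

/-- The permutation `σ ∘ᵢ τ` of the inputs of a composite: the slots of the outer operation are
permuted by `σ` and the inputs of the inner operation by `τ`. -/
def permComp (h : n + 1 = l + m) (i : Fin l) (σ : Equiv.Perm (Fin l)) (τ : Equiv.Perm (Fin m)) :
    Equiv.Perm (Fin n) :=
  (position h i).symm.trans
    ((Equiv.sumCongr τ (σ.subtypeEquiv fun _ => (not_congr σ.injective.eq_iff).symm)).trans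
      (position h (σ i)))

/-- The arguments of the outer operation in a composite: `w` in the slot `i`, and the remaining
inputs in their order. -/
def plug {X : Type u} (h : n + 1 = l + m) (i : Fin l) (v : Fin n → X) (w : X) : Fin l → X :=
  fun j => if hj : j = i then w else v (outerPos h i j hj)

/-- The sum of the degrees of the inputs in front of the position `p`. -/
def degBefore (k : Fin n → ℤ) (p : ℕ) : ℤ := ∑ y : Fin n, if y.val < p then k y else 0

/-- The Koszul sign of the permutation that moves the `i`-th factor to the place `σ i`, where the
`i`-th factor has degree `k i`. -/
def koszul (σ : Equiv.Perm (Fin n)) (k : Fin n → ℤ) : ℤˣ :=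
  (∑ i : Fin n, ∑ j : Fin n, if i < j ∧ σ j < σ i then k i * k j else 0).negOnePow

/-- The extension of a permutation of the first `m` of `m + 1` inputs that fixes the last one. -/
def permLast (σ : Equiv.Perm (Fin m)) : Equiv.Perm (Fin (m + 1)) :=
  finSuccEquivLast.trans ((Equiv.optionCongr σ).trans finSuccEquivLast.symm)

end Bookkeeping

/-! ### DG-operads -/

/-- A (symmetric, unital) DG-operad over `ℂ`, in terms of the partial compositions `a ∘ᵢ b`.
The slots are numbered from zero, and `comp h i a b` is `a ∘ᵢ b`, with `h` recording that its arity
is `l + m - 1`. The symmetric groups act from the right: the `j`-th input of `a σ` is the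
`σ j`-th input of `a`. -/
structure DGOperad where
  space : ℕ → DGSpace.{u}
  one : space 1
  perm : ∀ {n : ℕ}, Equiv.Perm (Fin n) → (space n →ₗ[ℂ] space n)
  comp : ∀ {l m n : ℕ}, n + 1 = l + m → Fin l → (space l →ₗ[ℂ] space m →ₗ[ℂ] space n)
  one_mem : one ∈ (space 1).gr 0
  perm_mem : ∀ {n : ℕ} (σ : Equiv.Perm (Fin n)) (p : ℤ) (a : space n),
    a ∈ (space n).gr p → perm σ a ∈ (space n).gr p
  perm_d : ∀ {n : ℕ} (σ : Equiv.Perm (Fin n)) (a : space n),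
    perm σ ((space n).d a) = (space n).d (perm σ a)
  perm_one : ∀ {n : ℕ} (a : space n), perm 1 a = a
  perm_mul : ∀ {n : ℕ} (σ τ : Equiv.Perm (Fin n)) (a : space n),
    perm (σ * τ) a = perm τ (perm σ a)
  comp_mem : ∀ {l m n : ℕ} (h : n + 1 = l + m) (i : Fin l) (p q : ℤ) (a : space l) (b : space m),
    a ∈ (space l).gr p → b ∈ (space m).gr q → comp h i a b ∈ (space n).gr (p + q)
  comp_d : ∀ {l m n : ℕ} (h : n + 1 = l + m) (i : Fin l) (p : ℤ) (a : space l) (b : space m),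
    a ∈ (space l).gr p →
      (space n).d (comp h i a b) =
        comp h i ((space l).d a) b + p.negOnePow • comp h i a ((space m).d b)
  one_comp : ∀ {n : ℕ} (h : n + 1 = 1 + n) (a : space n), comp h 0 one a = a
  comp_one : ∀ {n : ℕ} (h : n + 1 = n + 1) (i : Fin n) (a : space n), comp h i a one = a
  /-- `(a ∘ᵢ b) ∘ᵢ₊ⱼ c = a ∘ᵢ (b ∘ⱼ c)` -/
  comp_seq : ∀ {l m n ab bc abc : ℕ} (h₁ : ab + 1 = l + m) (h₂ : abc + 1 = ab + n)
    (h₃ : bc + 1 = m + n) (h₄ : abc + 1 = l + bc) (i : Fin l) (j : Fin m)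
    (a : space l) (b : space m) (c : space n),
    comp h₂ (innerPos h₁ i j) (comp h₁ i a b) c = comp h₄ i a (comp h₃ j b c)
  /-- `(a ∘ᵢ b) ∘ c = (-1)^{|b||c|} (a ∘ⱼ c) ∘ b` when `b` and `c` are inserted in the different
  slots `i < j` of `a`. -/
  comp_par : ∀ {l m n ab ac abc : ℕ} (h₁ : ab + 1 = l + m) (h₂ : abc + 1 = ab + n)
    (h₃ : ac + 1 = l + n) (h₄ : abc + 1 = ac + m) (i j : Fin l) (hij : i < j) (q r : ℤ)
    (a : space l) (b : space m) (c : space n), b ∈ (space m).gr q → c ∈ (space n).gr r →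
    comp h₂ (outerPos h₁ i j hij.ne') (comp h₁ i a b) c =
      (q * r).negOnePow • comp h₄ (outerPos h₃ j i hij.ne) (comp h₃ j a c) b
  /-- `(a σ) ∘ᵢ (b τ) = (a ∘_{σ i} b) (σ ∘ᵢ τ)` -/
  comp_perm : ∀ {l m n : ℕ} (h : n + 1 = l + m) (i : Fin l) (σ : Equiv.Perm (Fin l))
    (τ : Equiv.Perm (Fin m)) (a : space l) (b : space m),
    comp h i (perm σ a) (perm τ b) = perm (permComp h i σ τ) (comp h (σ i) a b)

/-! ### Algebras over a DG-operad -/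

/-- An `O`-algebra structure on the complex `V`: operations `act a : V^{⊗ n} → V` for `a ∈ O(n)`,
depending linearly on `a`, that form a morphism from `O` to the endomorphism operad of `V`, with the
Koszul sign rule. -/
structure AlgStr (O : DGOperad.{u}) (V : DGSpace.{u}) where
  act : ∀ {n : ℕ}, O.space n →ₗ[ℂ] MultilinearMap ℂ (fun _ : Fin n => V.carrier) V.carrier
  act_mem : ∀ {n : ℕ} (p : ℤ) (k : Fin n → ℤ) (a : O.space n) (v : Fin n → V),
    a ∈ (O.space n).gr p → (∀ y, v y ∈ V.gr (k y)) → act a v ∈ V.gr (p + ∑ y, k y)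
  act_d : ∀ {n : ℕ} (p : ℤ) (k : Fin n → ℤ) (a : O.space n) (v : Fin n → V),
    a ∈ (O.space n).gr p → (∀ y, v y ∈ V.gr (k y)) →
      V.d (act a v) = act ((O.space n).d a) v +
        ∑ y, (p + degBefore k y.val).negOnePow • act a (Function.update v y (V.d (v y)))
  act_one : ∀ v : Fin 1 → V, act O.one v = v 0
  act_perm : ∀ {n : ℕ} (σ : Equiv.Perm (Fin n)) (k : Fin n → ℤ) (a : O.space n) (v : Fin n → V),
    (∀ y, v y ∈ V.gr (k y)) → act (O.perm σ a) v = koszul σ k • act a (v ∘ σ.symm)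
  act_comp : ∀ {l m n : ℕ} (h : n + 1 = l + m) (i : Fin l) (q : ℤ) (k : Fin n → ℤ)
    (a : O.space l) (b : O.space m) (v : Fin n → V),
    b ∈ (O.space m).gr q → (∀ y, v y ∈ V.gr (k y)) →
      act (O.comp h i a b) v =
        (q * degBefore k i.val).negOnePow • act a (plug h i v (act b (v ∘ innerPos h i)))

/-- An algebra over the DG-operad `O`. -/
structure Alg (O : DGOperad.{u}) where
  space : DGSpace.{u}
  str : AlgStr O space

namespace Alg

variable {O : DGOperad.{u}}

/-- Morphisms of `O`-algebras. -/
@[ext]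
structure Hom (A B : Alg O) extends DGSpace.Hom A.space B.space where
  map_act : ∀ {n : ℕ} (a : O.space n) (v : Fin n → A.space),
    lin (A.str.act a v) = B.str.act a fun y => lin (v y)

instance : Category (Alg O) where
  Hom A B := Hom A B
  id A := { DGSpace.Hom.id A.space with map_act := fun _ _ => rfl }
  comp f g :=
    { DGSpace.Hom.comp f.toHom g.toHom with
      map_act := fun a v =>
        (congrArg g.lin (f.map_act a v)).trans (g.map_act a fun y => f.lin (v y)) }

/-- The class of quasi-isomorphisms of `O`-algebras. -/
def quasiIso (O : DGOperad.{u}) : MorphismProperty (Alg O) := fun _ _ f =>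
  (Hom.toHom f).IsQuasiIso

/-- The homotopy category of `O`-algebras: quasi-isomorphisms are inverted. -/
abbrev HoCat (O : DGOperad.{u}) := (quasiIso O).Localization

/-- The localization functor to the homotopy category. -/
abbrev toHo (O : DGOperad.{u}) : Alg O ⥤ HoCat O := (quasiIso O).Q

/-- The structure `s` of `O`-algebra on `(H^*(B), d = 0)` is the one induced by `B`: a cocycle of
`O(n)` acts on classes through representatives, and operations of negative degree act by zero.
If `O` is concentrated in nonpositive degrees, this says that `O` acts through `O → H^0(O)`, and
there is at most one such structure. -/
structure IsInduced (B : Alg O) (s : AlgStr O B.space.cohomology) : Prop where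
  act_cls : ∀ {n : ℕ} (a : O.space n), a ∈ (O.space n).cocycles →
    ∀ (v : Fin n → B.space.cocycles) (w : B.space.cocycles),
      (w : B.space) = B.str.act a (fun y => (v y : B.space)) →
        s.act a (fun y => B.space.cls (v y)) = B.space.cls w
  act_neg : ∀ {n : ℕ} (p : ℤ) (a : O.space n), p < 0 → a ∈ (O.space n).gr p → s.act a = 0

/-- `B` is formal: it is isomorphic, in the homotopy category of `O`-algebras, to its cohomology
`(H^*(B), d = 0)` with the induced structure of `O`-algebra. -/
def IsFormal (B : Alg O) : Prop :=
  ∃ s : AlgStr O B.space.cohomology, B.IsInduced s ∧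
    Nonempty ((toHo O).obj B ≅ (toHo O).obj ⟨B.space.cohomology, s⟩)

end Alg

/-! ### Modules over an algebra over a DG-operad -/

/-- The structure of a module over the `O`-algebra `B` on the complex `N`: operations
`act a : B^{⊗ m} ⊗ N → N` for `a ∈ O(m + 1)`, with the element of `N` in the last slot. -/
structure ModStr {O : DGOperad.{u}} (B : Alg O) (N : DGSpace.{u}) where
  act : ∀ {m : ℕ}, O.space (m + 1) →ₗ[ℂ]
    MultilinearMap ℂ (fun _ : Fin m => B.space.carrier) (N.carrier →ₗ[ℂ] N.carrier)
  act_mem : ∀ {m : ℕ} (p : ℤ) (k : Fin m → ℤ) (r : ℤ) (a : O.space (m + 1)) (b : Fin m → B.space)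
    (x : N), a ∈ (O.space (m + 1)).gr p → (∀ y, b y ∈ B.space.gr (k y)) → x ∈ N.gr r →
      act a b x ∈ N.gr (p + ∑ y, k y + r)
  act_d : ∀ {m : ℕ} (p : ℤ) (k : Fin m → ℤ) (a : O.space (m + 1)) (b : Fin m → B.space)
    (x : N), a ∈ (O.space (m + 1)).gr p → (∀ y, b y ∈ B.space.gr (k y)) →
      N.d (act a b x) = act ((O.space (m + 1)).d a) b x +
        ∑ y, (p + degBefore k y.val).negOnePow •
          act a (Function.update b y (B.space.d (b y))) x +
        (p + ∑ y, k y).negOnePow • act a b (N.d x)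
  act_one : ∀ (b : Fin 0 → B.space) (x : N), act O.one b x = x
  act_perm : ∀ {m : ℕ} (σ : Equiv.Perm (Fin m)) (k : Fin m → ℤ) (a : O.space (m + 1))
    (b : Fin m → B.space) (x : N), (∀ y, b y ∈ B.space.gr (k y)) →
      act (O.perm (permLast σ) a) b x = koszul σ k • act a (b ∘ σ.symm) x
  /-- Composition in a slot of `B`. -/
  act_comp : ∀ {l m n : ℕ} (h : n + 1 = l + m) (h' : n + 1 + 1 = l + 1 + m) (i : Fin l) (q : ℤ)
    (k : Fin n → ℤ) (a : O.space (l + 1)) (c : O.space m) (b : Fin n → B.space) (x : N),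
    c ∈ (O.space m).gr q → (∀ y, b y ∈ B.space.gr (k y)) →
      act (O.comp h' i.castSucc a c) b x =
        (q * degBefore k i.val).negOnePow •
          act a (plug h i b (B.str.act c (b ∘ innerPos h i))) x
  /-- Composition in the slot of `N`. -/
  act_comp_last : ∀ {l m : ℕ} (h : l + m + 1 + 1 = l + 1 + (m + 1)) (q : ℤ)
    (k : Fin (l + m) → ℤ) (a : O.space (l + 1)) (c : O.space (m + 1)) (b : Fin (l + m) → B.space)
    (x : N), c ∈ (O.space (m + 1)).gr q → (∀ y, b y ∈ B.space.gr (k y)) →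
      act (O.comp h (Fin.last l) a c) b x =
        (q * degBefore k l).negOnePow •
          act a (b ∘ Fin.castAdd m) (act c (b ∘ Fin.natAdd l) x)

/-- A (DG-)module over the `O`-algebra `B`. -/
structure Mod {O : DGOperad.{u}} (B : Alg O) where
  space : DGSpace.{u}
  str : ModStr B space

namespace Mod

variable {O : DGOperad.{u}} {B : Alg O}

/-- Morphisms of modules over `B`. -/
@[ext]
structure Hom (M N : Mod B) extends DGSpace.Hom M.space N.space where
  map_act : ∀ {m : ℕ} (a : O.space (m + 1)) (b : Fin m → B.space) (x : M.space),
    lin (M.str.act a b x) = N.str.act a b (lin x)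

instance : Category (Mod B) where
  Hom M N := Hom M N
  id M := { DGSpace.Hom.id M.space with map_act := fun _ _ _ => rfl }
  comp f g :=
    { DGSpace.Hom.comp f.toHom g.toHom with
      map_act := fun a b x =>
        (congrArg g.lin (f.map_act a b x)).trans (g.map_act a b (f.lin x)) }

/-- The class of quasi-isomorphisms of modules over `B`. -/
def quasiIso (B : Alg O) : MorphismProperty (Mod B) := fun _ _ f => (Hom.toHom f).IsQuasiIso

/-- The derived category `D(B)`: modules over `B` with quasi-isomorphisms inverted. -/
abbrev DCat (B : Alg O) := (quasiIso B).Localization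

/-- The localization functor to the derived category. -/
abbrev toD (B : Alg O) : Mod B ⥤ DCat B := (quasiIso B).Q

/-- The structure `s` of module over `B` on `(H^*(N), d = 0)` is the one induced by `N`, for `B` with
zero differential: a cocycle of `O(m + 1)` acts on classes through representatives, and operations
of negative degree act by zero. -/
structure IsInduced (N : Mod B) (s : ModStr B N.space.cohomology) : Prop where
  act_cls : ∀ {m : ℕ} (a : O.space (m + 1)), a ∈ (O.space (m + 1)).cocycles →
    ∀ (b : Fin m → B.space) (x w : N.space.cocycles), (∀ y, b y ∈ B.space.cocycles) →
      (w : N.space) = N.str.act a b (x : N.space) →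
        s.act a b (N.space.cls x) = N.space.cls w
  act_neg : ∀ {m : ℕ} (p : ℤ) (a : O.space (m + 1)), p < 0 → a ∈ (O.space (m + 1)).gr p →
    s.act a = 0

/-- `N` is formal: it is isomorphic in `D(B)` to its cohomology `(H^*(N), d = 0)` with the induced
structure of module over `B`. -/
def IsFormal (N : Mod B) : Prop :=
  ∃ s : ModStr B N.space.cohomology, N.IsInduced s ∧
    Nonempty ((toD B).obj N ≅ (toD B).obj ⟨N.space.cohomology, s⟩)

end Mod

end OperadicFormality

end

noncomputable section

namespace OperadicFormality

/-! ### Graded linear algebra -/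

/-! The proof is a weight argument. An operation intertwined with an endomorphism multiplies
generalized eigenvalues (`multilinear_mem_maxGenEigenspace`), so the exponents `j` in `‖α‖ = ξ ^ (j
+ m)` behave like a second grading, additive under the operations and preserved by the differential.
Purity says that on cohomology this grading coincides with the degree. In a complex `X` with
endomorphism `S`, let `T` be spanned by the elements of degree `n` and weight `j > n` together with
the cocycles of degree `n` and weight `n`. Operations of nonpositive degree cannot lower the excess
`j - n`, so `T` is stable under them. Sending a pure cocycle to its class and everything of positive
excess to zero gives a map from `T` to the cohomology, and purity makes both `T → X` and `T → H(X)`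
quasi-isomorphisms (`truncIncl_isQuasiIso`, `truncProj_isQuasiIso`).

The obstacle is that only the cohomology, not the complex, is assumed to be a sum of generalized
eigenspaces. The remedy is divisibility: if `S - α` is surjective on `X` for every `α ≠ 0`, then
eigenclasses have representatives, and exact eigenvectors have primitives, inside the same
generalized eigenspace of `X` (`exists_representative`, `exists_primitive`). It remains to replace
the given object by a quasi-isomorphic divisible one on which the endomorphism still acts.

For an algebra `A` the divisible model consists of sequences of polynomial paths `γ n` in `A[t, dt]`
such that `γ (n + 1)` starts where `F` sends the end of `γ n`; the endomorphism is the shift. The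
equation `(S - α) y = x` is solved by the recursion `y (n + 1) = α y n + x n`, once the initial path
is chosen with the right ends (`seqShift_isDivisible`). Sending a point to its orbit of constant
paths is a quasi-isomorphism that intertwines `F` with the shift (`seqConst_isQuasiIso`,
`seqConst_shift`), because `A[t, dt]` contracts onto its starting point. Purity is transported by
`IsPure.of_isQuasiIso`, and the zigzag `A → X ← T → H(X) ← H(A)` proves formality.

For a module the matching of consecutive terms can be imposed up to a chosen homotopy, which gives a
mapping telescope. The algebra acts through `F^n` on the `n`-th term and through `F^(n+1)` on the
`n`-th homotopy, and the rest runs in parallel.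

The induced structure on cohomology lets only the degree zero part of `O` act. Positive degrees are
absent from `O`, so this is well defined; that it agrees with the action of all cocycles is again a
weight argument: a cocycle of degree `p ≠ 0` would shift the degree without changing the weight
(`cohAct_eq_zero`). -/

theorem iSupIndep_of_proj {M : Type u} [AddCommGroup M] [Module ℂ M] (G : ℤ → Submodule ℂ M)
    (pr : ℤ → M →ₗ[ℂ] M) (hsame : ∀ i, ∀ x ∈ G i, pr i x = x)
    (hne : ∀ i j, i ≠ j → ∀ x ∈ G i, pr j x = 0) : iSupIndep G := by
  rw [iSupIndep_def]
  intro i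
  rw [Submodule.disjoint_def]
  intro x hx hx'
  have hle : (⨆ j, ⨆ (_ : j ≠ i), G j) ≤ LinearMap.ker (pr i) :=
    iSup₂_le fun j hj x hx => hne j i hj x hx
  rw [← hsame i x hx]
  exact hle hx'

/-- A multilinear map that sends tuples of generators into a subspace sends tuples from the spans
of the generators into it. -/
theorem multilinear_mem_of_mem_span {ι M N : Type*} [Fintype ι] [AddCommGroup M] [Module ℂ M]
    [AddCommGroup N] [Module ℂ N] (f : MultilinearMap ℂ (fun _ : ι => M) N) (T : ι → Set M)
    (Z : Submodule ℂ N) (h : ∀ v, (∀ y, v y ∈ T y) → f v ∈ Z) (v : ι → M)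
    (hv : ∀ y, v y ∈ Submodule.span ℂ (T y)) : f v ∈ Z := by
  classical
  have key : ∀ (s : Finset ι) (v : ι → M), (∀ y ∈ s, v y ∈ Submodule.span ℂ (T y)) →
      (∀ y ∉ s, v y ∈ T y) → f v ∈ Z := by
    intro s
    induction s using Finset.induction_on with
    | empty => intro v _ hv; exact h v fun y => hv y (Finset.notMem_empty y)
    | insert a s ha ih =>
      intro v h1 h2
      have hle : Submodule.span ℂ (T a) ≤ Z.comap (f.toLinearMap v a) := by
        rw [Submodule.span_le]
        intro x hx
        refine ih (Function.update v a x) ?_ ?_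
        · intro y hy
          have : y ≠ a := fun e => ha (e ▸ hy)
          rw [Function.update_of_ne this]
          exact h1 y (Finset.mem_insert_of_mem hy)
        · intro y hy
          by_cases e : y = a
          · subst e; rwa [Function.update_self]
          · rw [Function.update_of_ne e]
            exact h2 y (by simp [e, hy])
      have := hle (h1 a (Finset.mem_insert_self a s))
      simpa using this
  exact key Finset.univ v (fun y _ => hv y) fun y hy => absurd (Finset.mem_univ y) hy

/-- A multilinear map that vanishes whenever one of its arguments lies in `K` depends on its
arguments only modulo `K`. -/
theorem multilinear_congr_of_sub_mem {ι M N : Type*} [Fintype ι] [AddCommGroup M] [Module ℂ M]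
    [AddCommGroup N] [Module ℂ N] (f : MultilinearMap ℂ (fun _ : ι => M) N) (K : Submodule ℂ M)
    (h : ∀ v y, v y ∈ K → f v = 0) (v w : ι → M) (hvw : ∀ y, v y - w y ∈ K) : f v = f w := by
  classical
  have e : v = w + (v - w) := by abel
  rw [e, f.map_add_univ, Finset.sum_eq_single Finset.univ]
  · simp
  · intro s _ hs
    obtain ⟨y, hy⟩ : ∃ y, y ∉ s := by
      by_contra hcon
      push Not at hcon
      exact hs (Finset.eq_univ_iff_forall.2 hcon)
    refine h _ y ?_
    rw [Finset.piecewise_eq_of_notMem _ _ _ hy]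
    exact hvw y
  · intro hn; exact absurd (Finset.mem_univ _) hn

/-! ### Homogeneous components and criteria for quasi-isomorphisms. -/

namespace DGSpace

variable (V W : DGSpace.{u})

theorem proj_sum (x : V) : ∃ s : Finset ℤ, x = ∑ i ∈ s, V.proj i x := by
  let _ := V.isInternal.chooseDecomposition
  classical
  refine ⟨(DirectSum.decompose V.gr x).support, ?_⟩
  conv_lhs => rw [← DirectSum.sum_support_decompose V.gr x]
  rfl

variable {V W}

theorem eq_zero_of_proj {x : V} (h : ∀ i, V.proj i x = 0) : x = 0 := by
  obtain ⟨s, hs⟩ := V.proj_sum x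
  rw [hs]
  exact Finset.sum_eq_zero fun i _ => h i

theorem Hom.map_proj (f : Hom V W) (i : ℤ) (x : V) : f.lin (V.proj i x) = W.proj i (f.lin x) := by
  induction x using V.proj_induction with
  | h0 => simp
  | hadd x y hx hy => simp [hx, hy]
  | hm j x hx =>
    by_cases h : j = i
    · subst h
      rw [V.proj_same _ _ hx, W.proj_same _ _ (f.map_mem _ _ hx)]
    · rw [V.proj_ne h _ hx, W.proj_ne h _ (f.map_mem _ _ hx), map_zero]

/-- The projections commute with `d` up to a shift of degree, so the component of degree `n - 1` of
an arbitrary primitive is again a primitive. -/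
theorem exists_homogeneous_primitive {n : ℤ} {x y : V} (hx : x ∈ V.gr n) (h : V.d y = x) :
    ∃ z ∈ V.gr (n - 1), V.d z = x := by
  refine ⟨V.proj (n - 1) y, V.proj_mem _ _, ?_⟩
  rw [← V.proj_d, h, sub_add_cancel, V.proj_same _ _ hx]

theorem cls_eq_zero {x : V.cocycles} : V.cls x = 0 ↔ ∃ y, V.d y = x := by
  rw [Submodule.mkQ_apply, Submodule.Quotient.mk_eq_zero]
  rfl

theorem cls_eq_cls {x y : V.cocycles} : V.cls x = V.cls y ↔ ∃ z, V.d z = (x : V) - y := by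
  rw [← sub_eq_zero, ← map_sub, cls_eq_zero]
  rfl

theorem d_cocycle (x : V.cocycles) : V.d x = 0 := x.2

/-- The restriction of a chain map to cocycles. -/
def Hom.onCocycles (f : Hom V W) : V.cocycles →ₗ[ℂ] W.cocycles :=
  f.lin.restrict (p := V.cocycles) (q := W.cocycles) fun x hx => by
    rw [LinearMap.mem_ker] at hx ⊢
    rw [← f.map_d, hx, map_zero]

@[simp]
theorem Hom.onCocycles_coe (f : Hom V W) (x : V.cocycles) :
    (f.onCocycles x : W) = f.lin x := rfl

theorem Hom.onCohomology_cls (f : Hom V W) (x : V.cocycles) :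
    f.onCohomology (V.cls x) = W.cls (f.onCocycles x) := rfl

theorem cls_surjective (h : V.HH) : ∃ x, V.cls x = h := V.coboundaries.mkQ_surjective h

/-- A chain map is a quasi-isomorphism if it is bijective on homogeneous cohomology classes. -/
theorem Hom.isQuasiIso_of_homogeneous (f : Hom V W)
    (hinj : ∀ (n : ℤ) (x : V), x ∈ V.gr n → V.d x = 0 → (∃ w, W.d w = f.lin x) → ∃ v, V.d v = x)
    (hsurj : ∀ (n : ℤ) (y : W), y ∈ W.gr n → W.d y = 0 →
      ∃ x, V.d x = 0 ∧ ∃ w, W.d w = f.lin x - y) : f.IsQuasiIso := by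
  constructor
  · rw [← LinearMap.ker_eq_bot, LinearMap.ker_eq_bot']
    intro h hh
    obtain ⟨x, rfl⟩ := cls_surjective h
    rw [f.onCohomology_cls, cls_eq_zero] at hh
    obtain ⟨w, hw⟩ := hh
    rw [cls_eq_zero]
    have hp : ∀ i, ∃ v, V.d v = V.proj i x := fun i => by
      refine hinj i _ (V.proj_mem i _) ?_ ⟨W.proj (i - 1) w, ?_⟩
      · rw [← V.proj_d, d_cocycle, map_zero]
      · have := W.proj_d (i - 1) w
        rw [sub_add_cancel, hw] at this
        rw [← this, f.map_proj, f.onCocycles_coe]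
    choose v hv using hp
    obtain ⟨s, hs⟩ := V.proj_sum (x : V)
    refine ⟨∑ i ∈ s, v i, ?_⟩
    rw [map_sum]
    exact (Finset.sum_congr rfl fun i _ => hv i).trans hs.symm
  · rw [← LinearMap.range_eq_top, eq_top_iff, ← W.hgr_isInternal.submodule_iSup_eq_top,
      iSup_le_iff]
    rintro i _ ⟨y, hy, rfl⟩
    obtain ⟨x, hx, w, hw⟩ := hsurj i y hy y.2
    exact ⟨V.cls ⟨x, hx⟩, by rw [f.onCohomology_cls, cls_eq_cls]; exact ⟨w, hw⟩⟩

theorem Hom.IsQuasiIso.exact {f : Hom V W} (hf : f.IsQuasiIso) {x : V} (hx : V.d x = 0)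
    (h : ∃ w, W.d w = f.lin x) : ∃ v, V.d v = x := by
  have : V.cls ⟨x, hx⟩ = 0 := hf.1 (by rw [f.onCohomology_cls, map_zero, cls_eq_zero]; exact h)
  rwa [cls_eq_zero] at this

theorem Hom.IsQuasiIso.lift {f : Hom V W} (hf : f.IsQuasiIso) {n : ℤ} {y : W} (hy : y ∈ W.gr n)
    (hd : W.d y = 0) : ∃ x ∈ V.gr n, V.d x = 0 ∧ ∃ w, W.d w = f.lin x - y := by
  obtain ⟨h, hh⟩ := hf.2 (W.cls ⟨y, hd⟩)
  obtain ⟨x, rfl⟩ := cls_surjective h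
  rw [f.onCohomology_cls, cls_eq_cls] at hh
  obtain ⟨z, hz⟩ := hh
  refine ⟨V.proj n x, V.proj_mem _ _, by rw [← V.proj_d, d_cocycle, map_zero],
    W.proj (n - 1) z, ?_⟩
  have := W.proj_d (n - 1) z
  rw [sub_add_cancel, hz] at this
  rw [← this, map_sub, f.onCocycles_coe, f.map_proj, W.proj_same _ _ hy]

theorem Hom.onCohomology_mem (f : Hom V W) (i : ℤ) (h : V.HH) (hh : h ∈ V.hgr i) :
    f.onCohomology h ∈ W.hgr i := by
  obtain ⟨x, hx, rfl⟩ := hh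
  exact ⟨f.onCocycles x, f.map_mem i _ hx, rfl⟩

theorem mem_hgr_cls {i : ℤ} {x : V.cocycles} (hx : (x : V) ∈ V.gr i) : V.cls x ∈ V.hgr i :=
  ⟨x, hx, rfl⟩

/-- The map induced on cohomology, as a chain map. -/
def Hom.cohomologyMap (f : Hom V W) : Hom V.cohomology W.cohomology where
  lin := f.onCohomology
  map_mem := f.onCohomology_mem
  map_d _ := map_zero _

theorem Hom.isQuasiIso_of_bijective (f : Hom V W) (hf : Function.Bijective f.lin)
    (hW : W.d = 0) : f.IsQuasiIso := by
  refine f.isQuasiIso_of_homogeneous ?_ ?_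
  · rintro n x - - ⟨w, hw⟩
    refine ⟨0, ?_⟩
    rw [hW, LinearMap.zero_apply] at hw
    rw [map_zero]
    exact hf.1 (by rw [map_zero, hw])
  · intro n y _ _
    obtain ⟨x, rfl⟩ := hf.2 y
    refine ⟨x, hf.1 ?_, 0, by simp⟩
    rw [f.map_d, hW, map_zero, LinearMap.zero_apply]

/-- The subcomplex spanned by a compatible family of subspaces of a module with differential. -/
def ofFamily {M : Type u} [AddCommGroup M] [Module ℂ M] (d : M →ₗ[ℂ] M) (G : ℤ → Submodule ℂ M)
    (hG : iSupIndep G) (hd : ∀ i, ∀ x ∈ G i, d x ∈ G (i + 1)) (hdd : ∀ x, d (d x) = 0) :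
    DGSpace.{u} where
  carrier := ↥(⨆ i, G i)
  gr i := (G i).comap (⨆ i, G i).subtype
  isInternal := by
    rw [DirectSum.isInternal_submodule_iff_iSupIndep_and_iSup_eq_top]
    have hmap : ∀ i, ((G i).comap (⨆ i, G i).subtype).map (⨆ i, G i).subtype = G i := fun i => by
      rw [Submodule.map_comap_subtype, inf_eq_right]
      exact le_iSup G i
    constructor
    · rw [iSupIndep_def] at hG ⊢
      intro i
      have h := hG i
      rw [Submodule.disjoint_def] at h ⊢
      intro x hx hx'
      refine Subtype.ext (h x hx ?_)
      have hle : (⨆ j, ⨆ (_ : j ≠ i), (G j).comap (⨆ i, G i).subtype) ≤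
          (⨆ j, ⨆ (_ : j ≠ i), G j).comap (⨆ i, G i).subtype :=
        iSup₂_le fun j hj x hx => Submodule.mem_iSup_of_mem j (Submodule.mem_iSup_of_mem hj hx)
      exact hle hx'
    · apply Submodule.map_injective_of_injective (⨆ i, G i).subtype_injective
      rw [Submodule.map_iSup, Submodule.map_top, Submodule.range_subtype]
      simp_rw [hmap]
  d := d.restrict (fun x hx => by
    have : (⨆ i, G i) ≤ (⨆ i, G i).comap d :=
      iSup_le fun i x hx => Submodule.mem_iSup_of_mem (i + 1) (hd i x hx)
    exact this hx)
  d_mem i x hx := hd i _ hx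
  d_d x := Subtype.ext (hdd _)

end DGSpace

/-! ### Purity and generalized eigenspaces -/

namespace GradedPure

variable {ξ m : ℝ} {M : Type u} [AddCommGroup M] [Module ℂ M] {gr : ℤ → Submodule ℂ M}
  {f : M →ₗ[ℂ] M}

/-- The purity condition speaks only of `α ≠ 0`. For `α = 0` the generalized eigenspace is zero
because `f` is injective, so no assumption on `α` beyond its absolute value remains. -/
theorem inf_maxGenEigenspace_eq_bot (hp : GradedPure ξ m gr f) {n : ℤ} {α : ℂ}
    (hα : ‖α‖ ≠ ξ ^ ((n : ℝ) + m)) : gr n ⊓ Module.End.maxGenEigenspace f α = ⊥ := by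
  by_cases h0 : α = 0
  · rw [eq_bot_iff]
    rintro x ⟨-, hx⟩
    obtain ⟨k, hk⟩ := (Module.End.mem_maxGenEigenspace _ _ _).1 hx
    rw [h0, zero_smul, sub_zero] at hk
    rw [Submodule.mem_bot]
    have : Function.Injective (f ^ k) := by
      rw [Module.End.coe_pow]; exact hp.bijective.1.iterate k
    exact this (by rw [hk, map_zero])
  · by_contra h
    exact hα (hp.eigenvalue n α h0 h)

theorem exists_finiteDimensional (hp : GradedPure ξ m gr f) {n : ℤ} {x : M} (hx : x ∈ gr n) :
    ∃ W : Submodule ℂ M, x ∈ W ∧ FiniteDimensional ℂ W ∧ W ≤ gr n ∧ ∀ w ∈ W, f w ∈ W := by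
  obtain ⟨W, hxW, hfin, -, hf⟩ := hp.locallyFinite x
  exact ⟨W ⊓ gr n, ⟨hxW, hx⟩, inferInstance, inf_le_right, fun w hw =>
    ⟨hf w hw.1, hp.map_mem n w hw.2⟩⟩

theorem coe_restrict_pow {W : Submodule ℂ M} (hW : ∀ w ∈ W, f w ∈ W) (α : ℂ) (k : ℕ) (w : W) :
    ((((f.restrict hW - α • (1 : Module.End ℂ W)) ^ k) w : W) : M) =
      ((f - α • (1 : Module.End ℂ M)) ^ k) w := by
  induction k generalizing w with
  | zero => rfl
  | succ k ih =>
    rw [pow_succ, pow_succ, Module.End.mul_apply, ih]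
    rfl

/-- Local finiteness puts `x` into a finite dimensional invariant subspace of `gr n`, which over `ℂ`
is the sum of its generalized eigenspaces; those with the wrong absolute value are zero. -/
theorem mem_iSup (hp : GradedPure ξ m gr f) {n : ℤ} {x : M} (hx : x ∈ gr n) :
    x ∈ ⨆ α ∈ {α : ℂ | ‖α‖ = ξ ^ ((n : ℝ) + m)}, gr n ⊓ Module.End.maxGenEigenspace f α := by
  obtain ⟨W, hxW, hfin, hle, hW⟩ := hp.exists_finiteDimensional hx
  let g : Module.End ℂ W := f.restrict hW
  have htop := Module.End.iSup_maxGenEigenspace_eq_top g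
  have hmap : ∀ α, (Module.End.maxGenEigenspace g α).map W.subtype ≤
      gr n ⊓ Module.End.maxGenEigenspace f α := by
    rintro α _ ⟨w, hw, rfl⟩
    obtain ⟨k, hk⟩ := (Module.End.mem_maxGenEigenspace _ _ _).1 hw
    refine ⟨hle w.2, (Module.End.mem_maxGenEigenspace _ _ _).2 ⟨k, ?_⟩⟩
    rw [Submodule.subtype_apply, ← coe_restrict_pow hW, hk, Submodule.coe_zero]
  have hx' : x ∈ (⨆ α, Module.End.maxGenEigenspace g α).map W.subtype := by
    rw [htop, Submodule.map_top, Submodule.range_subtype]; exact hxW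
  rw [Submodule.map_iSup] at hx'
  suffices h : (⨆ α, (Module.End.maxGenEigenspace g α).map W.subtype) ≤ _ from h hx'
  refine iSup_le fun α => ?_
  by_cases hα : ‖α‖ = ξ ^ ((n : ℝ) + m)
  · exact (hmap α).trans (le_biSup (fun α => gr n ⊓ Module.End.maxGenEigenspace f α) hα)
  · refine (hmap α).trans ?_
    rw [hp.inf_maxGenEigenspace_eq_bot hα]
    exact bot_le

/-- On a finite dimensional invariant subspace through `x` the operator `(f - α)^k` is injective,
since `α` is not an eigenvalue in degree `n`, and is therefore surjective. -/
theorem exists_pow_apply_eq (hp : GradedPure ξ m gr f) {n : ℤ} {α : ℂ}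
    (hα : ‖α‖ ≠ ξ ^ ((n : ℝ) + m)) (k : ℕ) {x : M} (hx : x ∈ gr n) :
    ∃ y ∈ gr n, ((f - α • (1 : Module.End ℂ M)) ^ k) y = x := by
  obtain ⟨W, hxW, hfin, hle, hW⟩ := hp.exists_finiteDimensional hx
  let g : Module.End ℂ W := (f.restrict hW - α • (1 : Module.End ℂ W)) ^ k
  have hinj : Function.Injective g := by
    rw [← LinearMap.ker_eq_bot, LinearMap.ker_eq_bot']
    intro w hw
    have : (w : M) ∈ gr n ⊓ Module.End.maxGenEigenspace f α := by
      refine ⟨hle w.2, (Module.End.mem_maxGenEigenspace _ _ _).2 ⟨k, ?_⟩⟩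
      rw [← coe_restrict_pow hW, hw, Submodule.coe_zero]
    rw [hp.inf_maxGenEigenspace_eq_bot hα] at this
    exact Subtype.ext this
  obtain ⟨w, hw⟩ := LinearMap.injective_iff_surjective.1 hinj ⟨x, hxW⟩
  exact ⟨w, hle w.2, by rw [← coe_restrict_pow hW, hw]⟩

end GradedPure

/-- A multilinear map that intertwines endomorphisms multiplies generalized eigenvalues. -/
theorem multilinear_mem_maxGenEigenspace {ι M N P : Type*} [Fintype ι] [AddCommGroup M] [Module ℂ M]
    [AddCommGroup N] [Module ℂ N] [AddCommGroup P] [Module ℂ P]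
    (g : MultilinearMap ℂ (fun _ : ι => M) (N →ₗ[ℂ] P)) (F : Module.End ℂ M) (f : Module.End ℂ N)
    (h : Module.End ℂ P) (hg : ∀ b x, h (g b x) = g (fun y => F (b y)) (f x)) (β : ι → ℂ) (α : ℂ)
    (b : ι → M) (x : N) (hb : ∀ y, b y ∈ F.maxGenEigenspace (β y)) (hx : x ∈ f.maxGenEigenspace α) :
    g b x ∈ h.maxGenEigenspace ((∏ y, β y) * α) := by
  classical
  -- Induction on a bound `K` for the total nilpotency order of all the arguments.
  have key : ∀ (K : ℕ) (k : ι → ℕ) (k' : ℕ) (b : ι → M) (x : N), (∑ y, k y) + k' ≤ K →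
      (∀ y, ((F - β y • (1 : Module.End ℂ M)) ^ k y) (b y) = 0) →
      ((f - α • (1 : Module.End ℂ N)) ^ k') x = 0 →
      g b x ∈ h.maxGenEigenspace ((∏ y, β y) * α) := by
    intro K
    induction K with
    | zero =>
      intro k k' b x hK _ hx
      have : k' = 0 := by omega
      subst this
      rw [pow_zero, Module.End.one_apply] at hx
      rw [hx, map_zero]
      exact Submodule.zero_mem _
    | succ K ih =>
      intro k k' b x hK hb hx
      by_cases hz : ∃ y, k y = 0
      · obtain ⟨y, hy⟩ := hz
        have := hb y
        rw [hy, pow_zero, Module.End.one_apply] at this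
        rw [g.map_coord_zero y this, LinearMap.zero_apply]
        exact Submodule.zero_mem _
      by_cases hz' : k' = 0
      · subst hz'
        rw [pow_zero, Module.End.one_apply] at hx
        rw [hx, map_zero]
        exact Submodule.zero_mem _
      push Not at hz
      set u : ι → M := fun y => (F - β y • (1 : Module.End ℂ M)) (b y) with hu
      set v : N := (f - α • (1 : Module.End ℂ N)) x with hv
      have hFb : (fun y => F (b y)) = (fun y => β y • b y) + u := by
        funext y; simp [hu]
      have hfx : f x = α • x + v := by simp [hv]
      have hv0 : ((f - α • (1 : Module.End ℂ N)) ^ (k' - 1)) v = 0 := by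
        rw [hv, ← Module.End.mul_apply, ← pow_succ, Nat.sub_add_cancel (Nat.pos_of_ne_zero hz'), hx]
      have hu0 : ∀ y, ((F - β y • (1 : Module.End ℂ M)) ^ (k y - 1)) (u y) = 0 := fun y => by
        rw [hu, ← Module.End.mul_apply, ← pow_succ,
          Nat.sub_add_cancel (Nat.pos_of_ne_zero (hz y)), hb y]
      -- Expanding `g` at `F (b y) = β y • b y + u y` and `f x = α • x + v`, the leading term is the
      -- scalar multiple that is subtracted. In every other term at least one argument has been
      -- replaced by its image under `F - β y` or `f - α`, which lowers the total order.
      have hmem : h (g b x) - ((∏ y, β y) * α) • g b x ∈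
          h.maxGenEigenspace ((∏ y, β y) * α) := by
        have hs : ∀ s : Finset ι, s ≠ Finset.univ → ∀ x', (x' = x ∨ x' = v) →
            g (s.piecewise (fun y => β y • b y) u) x' ∈
              h.maxGenEigenspace ((∏ y, β y) * α) := by
          intro s hs x' hx'
          obtain ⟨y₀, hy₀⟩ : ∃ y, y ∉ s := by
            by_contra hcon
            push Not at hcon
            exact hs (Finset.eq_univ_iff_forall.2 hcon)
          -- The slot `y₀ ∉ s` already provides the decrease, so the order `k'` may be kept for the
          -- last argument even if it is `v`.
          refine ih (fun y => if y ∈ s then k y else k y - 1) k' _ x' ?_ ?_ ?_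
          · have : ∑ y, (if y ∈ s then k y else k y - 1) < ∑ y, k y := by
              refine Finset.sum_lt_sum (fun y _ => by split <;> omega) ⟨y₀, Finset.mem_univ _, ?_⟩
              have := hz y₀
              simp only [hy₀, if_false]
              omega
            omega
          · intro y
            by_cases hy : y ∈ s
            · rw [if_pos hy, Finset.piecewise_eq_of_mem _ _ _ hy, map_smul, hb y, smul_zero]
            · rw [if_neg hy, Finset.piecewise_eq_of_notMem _ _ _ hy, hu0 y]
          · rcases hx' with rfl | rfl
            · exact hx
            · have hk : k' = 1 + (k' - 1) := by omega
              rw [hk, pow_add, Module.End.mul_apply, hv0, map_zero]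
        have huniv : g (fun y => β y • b y) v ∈ h.maxGenEigenspace ((∏ y, β y) * α) :=
          ih k (k' - 1) _ v (by omega) (fun y => by rw [map_smul, hb y, smul_zero]) hv0
        have e : h (g b x) - ((∏ y, β y) * α) • g b x = g (fun y => β y • b y) v +
            ∑ s ∈ Finset.univ.erase Finset.univ,
              (α • g (s.piecewise (fun y => β y • b y) u) x +
                g (s.piecewise (fun y => β y • b y) u) v) := by
          rw [hg, hFb, hfx, g.map_add_univ, LinearMap.sum_apply,
            ← Finset.add_sum_erase _ _ (Finset.mem_univ Finset.univ), Finset.piecewise_univ]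
          simp only [map_add, map_smul]
          rw [g.map_smul_univ, LinearMap.smul_apply, mul_comm, mul_smul]
          abel
        rw [e]
        refine Submodule.add_mem _ huniv (Submodule.sum_mem _ fun s hs' => ?_)
        have hs' := Finset.ne_of_mem_erase hs'
        exact Submodule.add_mem _ (Submodule.smul_mem _ _ (hs s hs' x (Or.inl rfl)))
          (hs s hs' v (Or.inr rfl))
      rw [Module.End.mem_maxGenEigenspace] at hmem ⊢
      obtain ⟨r, hr⟩ := hmem
      refine ⟨r + 1, ?_⟩
      rw [pow_succ, Module.End.mul_apply]
      simpa using hr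
  choose k hk using fun y => (Module.End.mem_maxGenEigenspace _ _ _).1 (hb y)
  obtain ⟨k', hk'⟩ := (Module.End.mem_maxGenEigenspace _ _ _).1 hx
  exact key _ k k' b x le_rfl hk hk'

/-! ### Truncation by weight -/

namespace DGSpace

variable {X : DGSpace.{u}}

/-- The chain map `(S - α)^k`. -/
def Hom.subPow (S : Hom X X) (α : ℂ) (k : ℕ) : Hom X X where
  lin := (S.lin - α • (1 : Module.End ℂ X)) ^ k
  map_mem i x hx := by
    induction k generalizing x with
    | zero => exact hx
    | succ k ih =>
      rw [pow_succ, Module.End.mul_apply]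
      exact ih _ (Submodule.sub_mem _ (S.map_mem i x hx) (Submodule.smul_mem _ _ hx))
  map_d x := by
    induction k generalizing x with
    | zero => rfl
    | succ k ih =>
      rw [pow_succ, Module.End.mul_apply, Module.End.mul_apply, ← ih]
      simp [S.map_d]

theorem Hom.subPow_onCohomology (S : Hom X X) (α : ℂ) (k : ℕ) (h : X.HH) :
    (S.subPow α k).onCohomology h = ((S.onCohomology - α • (1 : Module.End ℂ X.HH)) ^ k) h := by
  induction k generalizing h with
  | zero =>
    obtain ⟨x, rfl⟩ := cls_surjective h
    rfl
  | succ k ih =>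
    rw [pow_succ, Module.End.mul_apply, ← ih]
    obtain ⟨x, rfl⟩ := cls_surjective h
    rw [Hom.onCohomology_cls]
    change _ = (S.subPow α k).onCohomology (X.cls (S.onCocycles x - α • x))
    rw [Hom.onCohomology_cls]
    refine congrArg X.cls (Subtype.ext ?_)
    change ((S.lin - α • (1 : Module.End ℂ X)) ^ (k + 1)) (x : X) = _
    rw [pow_succ]
    rfl

theorem d_mem_maxGenEigenspace (S : Hom X X) {α : ℂ} {x : X}
    (hx : x ∈ Module.End.maxGenEigenspace S.lin α) :
    X.d x ∈ Module.End.maxGenEigenspace S.lin α := by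
  rw [Module.End.mem_maxGenEigenspace] at hx ⊢
  obtain ⟨k, hk⟩ := hx
  refine ⟨k, ?_⟩
  have := (S.subPow α k).map_d x
  change ((S.lin - α • (1 : Module.End ℂ X)) ^ k) _ = X.d (((S.lin - α • 1) ^ k) x) at this
  rw [this, hk, map_zero]

theorem cls_mem_maxGenEigenspace (S : Hom X X) {α : ℂ} {x : X.cocycles}
    (hx : (x : X) ∈ Module.End.maxGenEigenspace S.lin α) :
    X.cls x ∈ Module.End.maxGenEigenspace S.onCohomology α := by
  rw [Module.End.mem_maxGenEigenspace] at hx ⊢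
  obtain ⟨k, hk⟩ := hx
  refine ⟨k, ?_⟩
  rw [← Hom.subPow_onCohomology, Hom.onCohomology_cls, cls_eq_zero]
  exact ⟨0, by rw [map_zero]; exact hk.symm⟩

/-! ### Divisible endomorphisms: lifting generalized eigenspaces from cohomology to cochains. -/

/-- The endomorphism `S` acts divisibly: every `S - α` with `α ≠ 0` is surjective. -/
def Hom.IsDivisible (S : Hom X X) : Prop :=
  ∀ α : ℂ, α ≠ 0 → ∀ (i : ℤ), ∀ x ∈ X.gr i, ∃ y ∈ X.gr i, S.lin y - α • y = x

theorem Hom.IsDivisible.pow {S : Hom X X} (hS : S.IsDivisible) {α : ℂ} (hα : α ≠ 0) (k : ℕ)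
    {i : ℤ} {x : X} (hx : x ∈ X.gr i) :
    ∃ y ∈ X.gr i, ((S.lin - α • (1 : Module.End ℂ X)) ^ k) y = x := by
  induction k with
  | zero => exact ⟨x, hx, rfl⟩
  | succ k ih =>
    obtain ⟨z, hz, hzx⟩ := ih
    obtain ⟨y, hy, hyz⟩ := hS α hα i z hz
    refine ⟨y, hy, ?_⟩
    rw [pow_succ, Module.End.mul_apply, ← hzx]
    exact congrArg _ hyz

section Truncation

variable {ξ m : ℝ} {S : Hom X X}

theorem ne_zero_of_norm_eq (hξ : 0 < ξ) {α : ℂ} {r : ℝ} (h : ‖α‖ = ξ ^ r) : α ≠ 0 := by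
  rintro rfl
  rw [norm_zero] at h
  exact (Real.rpow_pos_of_pos hξ r).ne h

/-- A cohomology class in a generalized eigenspace has a representative in the same generalized
eigenspace. -/
theorem exists_representative (hS : S.IsDivisible) {n : ℤ} {α : ℂ} (hα : α ≠ 0) {h : X.HH}
    (hn : h ∈ X.hgr n) (hh : h ∈ Module.End.maxGenEigenspace S.onCohomology α) :
    ∃ x : X.cocycles, (x : X) ∈ X.gr n ∧ (x : X) ∈ Module.End.maxGenEigenspace S.lin α ∧
      X.cls x = h := by
  obtain ⟨c, hc, rfl⟩ := hn
  obtain ⟨k, hk⟩ := (Module.End.mem_maxGenEigenspace _ _ _).1 hh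
  rw [← Hom.subPow_onCohomology, Hom.onCohomology_cls, cls_eq_zero] at hk
  obtain ⟨w, hw⟩ := hk
  obtain ⟨z, hz, hdz⟩ := exists_homogeneous_primitive ((S.subPow α k).map_mem n _ hc) hw
  obtain ⟨z', hz', hzz⟩ := hS.pow hα k hz
  -- Here `(S - α)^k c = d z` and `z = (S - α)^k z'`, so `c - d z'` is annihilated by `(S - α)^k`
  -- and still represents the class.
  have hdz' : X.d z' ∈ X.gr n := by simpa using X.d_mem _ _ hz'
  refine ⟨⟨c - X.d z', by rw [LinearMap.mem_ker, map_sub, X.d_d, d_cocycle, sub_zero]⟩,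
    Submodule.sub_mem _ hc hdz', ?_, ?_⟩
  · rw [Module.End.mem_maxGenEigenspace]
    refine ⟨k, ?_⟩
    have := (S.subPow α k).map_d z'
    change ((S.lin - α • (1 : Module.End ℂ X)) ^ k) _ = X.d (((S.lin - α • 1) ^ k) z') at this
    rw [map_sub, this, hzz, hdz]
    exact sub_self _
  · rw [cls_eq_cls]
    exact ⟨-z', by simp⟩

/-- An exact element of a generalized eigenspace has a primitive in the same generalized eigenspace,
if the eigenvalue does not occur in the cohomology of the degree of the primitive. -/
theorem exists_primitive (hS : S.IsDivisible) (hp : IsPure ξ m X S) {n : ℤ} {α : ℂ} (hα : α ≠ 0)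
    (hα' : ‖α‖ ≠ ξ ^ (((n - 1 : ℤ) : ℝ) + m)) {x : X} (hn : x ∈ X.gr n)
    (hx : x ∈ Module.End.maxGenEigenspace S.lin α) (he : ∃ y, X.d y = x) :
    ∃ y ∈ X.gr (n - 1), y ∈ Module.End.maxGenEigenspace S.lin α ∧ X.d y = x := by
  obtain ⟨y₀, hy₀⟩ := he
  obtain ⟨y, hy, hyx⟩ := exists_homogeneous_primitive hn hy₀
  obtain ⟨k, hk⟩ := (Module.End.mem_maxGenEigenspace _ _ _).1 hx
  set P := S.subPow α k with hP
  have hPlin : ∀ z, P.lin z = ((S.lin - α • (1 : Module.End ℂ X)) ^ k) z := fun z => rfl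
  -- `P y` measures the failure of `y` to lie in the eigenspace, and is a cocycle of degree `n - 1`.
  -- As `α` does not occur in the cohomology of that degree, its class is the image under `P` of the
  -- class of a cocycle `c`. Replacing `y` by `y - c` leaves an exact defect, which divisibility
  -- removes by adding a coboundary.
  have hc : X.d (P.lin y) = 0 := by rw [← P.map_d, hyx, hPlin, hk]
  obtain ⟨h, hh, hhe⟩ := GradedPure.exists_pow_apply_eq hp hα' k
    (mem_hgr_cls (x := ⟨P.lin y, hc⟩) (P.map_mem _ _ hy))
  obtain ⟨c, hcn, rfl⟩ := hh
  rw [← Hom.subPow_onCohomology, Hom.onCohomology_cls, cls_eq_cls] at hhe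
  obtain ⟨w, hw⟩ := hhe
  have hcn : (c : X) ∈ X.gr (n - 1) := hcn
  obtain ⟨z, hz, hdz⟩ := exists_homogeneous_primitive
    (Submodule.sub_mem _ (P.map_mem _ _ hcn) (P.map_mem _ _ hy)) hw
  obtain ⟨z', hz', hzz⟩ := hS.pow hα k hz
  have hdz' : X.d z' ∈ X.gr (n - 1) := by simpa using X.d_mem _ _ hz'
  refine ⟨y - c + X.d z', Submodule.add_mem _ (Submodule.sub_mem _ hy hcn) hdz', ?_, ?_⟩
  · rw [Module.End.mem_maxGenEigenspace]
    refine ⟨k, ?_⟩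
    rw [← hPlin, map_add, map_sub, P.map_d, hPlin z', hzz, hdz]
    abel
  · rw [map_add, map_sub, X.d_d, d_cocycle, hyx, sub_zero, add_zero]

/-- In a sum of generalized eigenspaces, cocycles are sums of cocycles and exact cocycles are sums
of exact cocycles. -/
theorem exists_decomposition {n : ℤ} {A : Set ℂ} {x : X}
    (hx : x ∈ ⨆ α ∈ A, X.gr n ⊓ Module.End.maxGenEigenspace S.lin α) (hd : X.d x = 0) :
    ∃ (s : Finset ℂ) (g : ℂ → X), (∀ α ∈ s, α ∈ A) ∧
      (∀ α, g α ∈ X.gr n ⊓ Module.End.maxGenEigenspace S.lin α) ∧ (∀ α, X.d (g α) = 0) ∧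
      x = ∑ α ∈ s, g α ∧ ((∃ y, X.d y = x) → ∀ α ∈ s, ∃ y, X.d y = g α) := by
  classical
  have hle : (⨆ α ∈ A, X.gr n ⊓ Module.End.maxGenEigenspace S.lin α) ≤
      ⨆ α, (⨆ (_ : α ∈ A), X.gr n ⊓ Module.End.maxGenEigenspace S.lin α) := le_rfl
  obtain ⟨g, hg, hgx⟩ := (Submodule.mem_iSup_iff_exists_finsupp _ _).1 (hle hx)
  have hg' : ∀ α, g α ∈ X.gr n ⊓ Module.End.maxGenEigenspace S.lin α := fun α => by
    have : (⨆ (_ : α ∈ A), X.gr n ⊓ Module.End.maxGenEigenspace S.lin α) ≤ _ :=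
      iSup_le fun _ => le_rfl
    exact this (hg α)
  have hsupp : ∀ α ∈ g.support, α ∈ A := fun α hα => by
    by_contra hn
    have := hg α
    rw [iSup_neg hn] at this
    exact Finsupp.mem_support_iff.1 hα this
  have hsum : x = ∑ α ∈ g.support, g α := hgx.symm
  -- The differential preserves generalized eigenspaces, so independence separates the equation `∑ d
  -- (g α) = 0`. The same argument in cohomology handles exactness below.
  have hdg : ∀ α, X.d (g α) = 0 := by
    intro α
    by_cases hα : α ∈ g.support
    · refine (iSupIndep_iff_finsetSum_eq_zero_imp_eq_zero _).1
        (Module.End.independent_maxGenEigenspace S.lin) g.support (fun α => X.d (g α))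
        (fun α _ => d_mem_maxGenEigenspace S (hg' α).2) ?_ α hα
      rw [← map_sum, ← hsum, hd]
    · rw [Finsupp.notMem_support_iff.1 hα, map_zero]
  refine ⟨g.support, g, hsupp, hg', hdg, hsum, fun hex α hα => ?_⟩
  have h0 : X.cls ⟨g α, hdg α⟩ = 0 := by
    refine (iSupIndep_iff_finsetSum_eq_zero_imp_eq_zero _).1
      (Module.End.independent_maxGenEigenspace S.onCohomology) g.support
      (fun α => X.cls ⟨g α, hdg α⟩)
      (fun α _ => cls_mem_maxGenEigenspace S (hg' α).2) ?_ α hα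
    rw [← map_sum, cls_eq_zero]
    obtain ⟨y, hy⟩ := hex
    refine ⟨y, ?_⟩
    rw [hy, hsum, AddSubmonoidClass.coe_finsetSum]
  rwa [cls_eq_zero] at h0

/-! ### The weight truncation as a subcomplex. -/

variable (ξ m S)

/-- The cocycles of degree `n` in the generalized eigenspaces of weight `n + m`. -/
def pureGen (n : ℤ) : Set X := {x | x ∈ X.gr n ∧ X.d x = 0 ∧
  ∃ α : ℂ, ‖α‖ = ξ ^ ((n : ℝ) + m) ∧ x ∈ Module.End.maxGenEigenspace S.lin α}

/-- The elements of degree `n` in the generalized eigenspaces of weight `j + m` with `j > n`. -/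
def posGen (n : ℤ) : Set X := {x | x ∈ X.gr n ∧
  ∃ (j : ℤ) (α : ℂ), n < j ∧ ‖α‖ = ξ ^ ((j : ℝ) + m) ∧
    x ∈ Module.End.maxGenEigenspace S.lin α}

/-- The part of degree `n` of the weight truncation. -/
def truncGr (n : ℤ) : Submodule ℂ X := Submodule.span ℂ (pureGen ξ m S n ∪ posGen ξ m S n)

theorem truncGr_le (n : ℤ) : truncGr ξ m S n ≤ X.gr n := by
  rw [truncGr, Submodule.span_le]
  rintro x (hx | hx)
  · exact hx.1
  · exact hx.1

/-- The differential keeps the weight `j` and raises the degree, so the excess `j - n` drops by one.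
If it reaches zero the result must be a cocycle to remain in the truncation, and it is one because
`d ∘ d = 0`. -/
theorem d_mem_pureGen_or_posGen {n : ℤ} {x : X} (hx : x ∈ posGen ξ m S n) :
    X.d x ∈ pureGen ξ m S (n + 1) ∨ X.d x ∈ posGen ξ m S (n + 1) := by
  obtain ⟨hn, j, α, hj, hα, hx⟩ := hx
  rcases (show n + 1 ≤ j by omega).eq_or_lt with rfl | hlt
  · exact Or.inl ⟨X.d_mem _ _ hn, X.d_d x, α, hα, d_mem_maxGenEigenspace S hx⟩
  · exact Or.inr ⟨X.d_mem _ _ hn, j, α, hlt, hα, d_mem_maxGenEigenspace S hx⟩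

theorem d_mem_truncGr (n : ℤ) (x : X) (hx : x ∈ truncGr ξ m S n) :
    X.d x ∈ truncGr ξ m S (n + 1) := by
  have : truncGr ξ m S n ≤ (truncGr ξ m S (n + 1)).comap X.d := by
    rw [truncGr, Submodule.span_le]
    rintro x (hx | hx)
    · change X.d x ∈ truncGr ξ m S (n + 1)
      rw [hx.2.1]
      exact Submodule.zero_mem _
    · exact Submodule.subset_span (d_mem_pureGen_or_posGen ξ m S hx)
  exact this hx

/-- The weight truncation of `X`. -/
def trunc : DGSpace.{u} :=
  ofFamily X.d (truncGr ξ m S) (X.isInternal.submodule_iSupIndep.mono (truncGr_le ξ m S))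
    (d_mem_truncGr ξ m S) X.d_d

/-- The inclusion of the weight truncation. -/
def truncIncl : Hom (trunc ξ m S) X where
  lin := (⨆ n, truncGr ξ m S n).subtype
  map_mem i _ hx := truncGr_le ξ m S i hx
  map_d _ := rfl

theorem truncIncl_injective : Function.Injective (truncIncl ξ m S).lin := Subtype.coe_injective

theorem exists_truncIncl_eq {n : ℤ} {x : X} (hx : x ∈ truncGr ξ m S n) :
    ∃ y ∈ (trunc ξ m S).gr n, (truncIncl ξ m S).lin y = x :=
  ⟨⟨x, Submodule.mem_iSup_of_mem n hx⟩, hx, rfl⟩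

theorem truncGr_le_iSup (n : ℤ) : truncGr ξ m S n ≤
    ⨆ α ∈ {α : ℂ | ∃ j : ℤ, n ≤ j ∧ ‖α‖ = ξ ^ ((j : ℝ) + m)},
      X.gr n ⊓ Module.End.maxGenEigenspace S.lin α := by
  rw [truncGr, Submodule.span_le]
  rintro x (⟨hn, -, α, hα, hx⟩ | ⟨hn, j, α, hj, hα, hx⟩)
  · exact Submodule.mem_iSup_of_mem α (Submodule.mem_iSup_of_mem ⟨n, le_rfl, hα⟩ ⟨hn, hx⟩)
  · exact Submodule.mem_iSup_of_mem α (Submodule.mem_iSup_of_mem ⟨j, hj.le, hα⟩ ⟨hn, hx⟩)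

theorem span_posGen_le_iSup (n : ℤ) : Submodule.span ℂ (posGen ξ m S n) ≤
    ⨆ α ∈ {α : ℂ | ∃ j : ℤ, n < j ∧ ‖α‖ = ξ ^ ((j : ℝ) + m)},
      X.gr n ⊓ Module.End.maxGenEigenspace S.lin α := by
  rw [Submodule.span_le]
  rintro x ⟨hn, j, α, hj, hα, hx⟩
  exact Submodule.mem_iSup_of_mem α (Submodule.mem_iSup_of_mem ⟨j, hj, hα⟩ ⟨hn, hx⟩)

variable {ξ m S}

/-- The weight is determined by the absolute value of the eigenvalue precisely because `ξ ≠ 1`. -/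
theorem weight_injective (hξ : 0 < ξ) (hξ1 : ξ ≠ 1) {i j : ℤ}
    (h : ξ ^ ((i : ℝ) + m) = ξ ^ ((j : ℝ) + m)) : i = j := by
  have := (Real.rpow_right_inj hξ hξ1).1 h
  exact_mod_cast add_right_cancel this

/-- By purity a class of degree `n` is a sum of eigenclasses of weight `n + m`; each of them is
lifted to a cocycle in the same generalized eigenspace. -/
theorem exists_pure_representative (hξ : 0 < ξ) (hS : S.IsDivisible) (hp : IsPure ξ m X S) {n : ℤ}
    {h : X.HH} (hh : h ∈ X.hgr n) : ∃ x : X.cocycles,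
      (x : X) ∈ Submodule.span ℂ (pureGen ξ m S n) ∧ X.cls x = h := by
  have hle : (⨆ α ∈ {α : ℂ | ‖α‖ = ξ ^ ((n : ℝ) + m)},
      X.hgr n ⊓ Module.End.maxGenEigenspace S.onCohomology α) ≤
      ((Submodule.span ℂ (pureGen ξ m S n)).comap X.cocycles.subtype).map X.cls := by
    refine iSup₂_le fun α hα h hh => ?_
    obtain ⟨x, hx, hxα, rfl⟩ := exists_representative hS (ne_zero_of_norm_eq hξ hα) hh.1 hh.2
    exact ⟨x, Submodule.subset_span ⟨hx, d_cocycle x, α, hα, hxα⟩, rfl⟩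
  obtain ⟨x, hx, rfl⟩ := hle (GradedPure.mem_iSup hp hh)
  exact ⟨x, hx, rfl⟩

/-- Each eigencomponent of `x` has weight index `j ≥ n`, which cannot occur in the cohomology of
degree `n - 1`. Hence it has a primitive of the same weight, and this primitive has positive excess
`j - (n - 1)`, so it lies in the truncation. -/
theorem truncGr_exists_primitive (hξ : 0 < ξ) (hξ1 : ξ ≠ 1) (hS : S.IsDivisible)
    (hp : IsPure ξ m X S) {n : ℤ} {x : X} (hx : x ∈ truncGr ξ m S n) (hd : X.d x = 0)
    (he : ∃ y, X.d y = x) : ∃ y ∈ truncGr ξ m S (n - 1), X.d y = x := by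
  obtain ⟨s, g, hs, hg, -, hsum, hex⟩ := exists_decomposition (truncGr_le_iSup ξ m S n hx) hd
  have hex := hex he
  have : ∀ α ∈ s, ∃ y ∈ truncGr ξ m S (n - 1), X.d y = g α := by
    intro α hα
    obtain ⟨j, hj, hαj⟩ := hs α hα
    obtain ⟨y, hy, hyα, hyd⟩ := exists_primitive hS hp (ne_zero_of_norm_eq hξ hαj)
      (fun h => by
        rw [hαj] at h
        have := weight_injective hξ hξ1 h
        omega) (hg α).1 (hg α).2 (hex α hα)
    exact ⟨y, Submodule.subset_span (Or.inr ⟨hy, j, α, by omega, hαj, hyα⟩), hyd⟩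
  choose! y hy hyd using this
  refine ⟨∑ α ∈ s, y α, Submodule.sum_mem _ hy, ?_⟩
  rw [map_sum, hsum]
  exact Finset.sum_congr rfl hyd

/-- Primitives found inside the truncation give injectivity on cohomology, and pure representatives
give surjectivity. -/
theorem truncIncl_isQuasiIso (hξ : 0 < ξ) (hξ1 : ξ ≠ 1) (hS : S.IsDivisible)
    (hp : IsPure ξ m X S) : (truncIncl ξ m S).IsQuasiIso := by
  refine Hom.isQuasiIso_of_homogeneous _ ?_ ?_
  · intro n x hx hd he
    have hd' : X.d ((truncIncl ξ m S).lin x) = 0 := by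
      rw [← Hom.map_d, hd, map_zero]
    obtain ⟨y, hy, hyd⟩ := truncGr_exists_primitive hξ hξ1 hS hp
      (x := (truncIncl ξ m S).lin x) (n := n) hx hd' he
    obtain ⟨z, -, rfl⟩ := exists_truncIncl_eq ξ m S hy
    exact ⟨z, truncIncl_injective ξ m S (by rw [Hom.map_d, hyd])⟩
  · intro n y hy hd
    obtain ⟨x, hx, hxy⟩ := exists_pure_representative hξ hS hp
      (mem_hgr_cls (x := ⟨y, hd⟩) hy)
    obtain ⟨z, hz, hzx⟩ := exists_truncIncl_eq ξ m S
      (Submodule.span_mono Set.subset_union_left hx)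
    refine ⟨z, truncIncl_injective ξ m S ?_, ?_⟩
    · rw [Hom.map_d, hzx, d_cocycle, map_zero]
    · rw [hzx]
      exact cls_eq_cls.1 hxy

/-! ### The projection of the truncation to the cohomology. -/

variable (ξ m S)

/-- The sum of the pure parts of the weight truncation. -/
def purePart : Submodule ℂ X := ⨆ n, Submodule.span ℂ (pureGen ξ m S n)

/-- The sum of the parts of the weight truncation of positive excess weight. -/
def posPart : Submodule ℂ X := ⨆ n, Submodule.span ℂ (posGen ξ m S n)

theorem proj_mem_of_mem_iSup {G : ℤ → Submodule ℂ X} (hG : ∀ n, G n ≤ X.gr n) {x : X}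
    (hx : x ∈ ⨆ n, G n) (i : ℤ) : X.proj i x ∈ G i := by
  have : (⨆ n, G n) ≤ (G i).comap (X.proj i) := by
    refine iSup_le fun n y hy => ?_
    change X.proj i y ∈ G i
    by_cases h : n = i
    · subst h; rwa [X.proj_same _ _ (hG _ hy)]
    · rw [X.proj_ne h _ (hG _ hy)]; exact Submodule.zero_mem _
  exact this hx

theorem purePart_le_cocycles : purePart ξ m S ≤ X.cocycles :=
  iSup_le fun _ => Submodule.span_le.2 fun _ hx => hx.2.1

variable {ξ m S}

/-- The two parts are compared degree by degree: in degree `n` one involves the weight index `n` and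
the other only indices `j > n`, and generalized eigenspaces are independent. -/
theorem disjoint_purePart_posPart (hξ : 0 < ξ) (hξ1 : ξ ≠ 1) :
    Disjoint (purePart ξ m S) (posPart ξ m S) := by
  rw [Submodule.disjoint_def]
  intro x hx hx'
  refine eq_zero_of_proj fun n => ?_
  have h1 := proj_mem_of_mem_iSup (fun n => (Submodule.span_le.2 fun _ hx => hx.1)) hx n
  have h2 := proj_mem_of_mem_iSup (fun n => (Submodule.span_le.2 fun _ hx => hx.1)) hx' n
  have hdis : Disjoint (⨆ α ∈ {α : ℂ | ‖α‖ = ξ ^ ((n : ℝ) + m)},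
      Module.End.maxGenEigenspace S.lin α)
      (⨆ α ∈ {α : ℂ | ∃ j : ℤ, n < j ∧ ‖α‖ = ξ ^ ((j : ℝ) + m)},
        Module.End.maxGenEigenspace S.lin α) := by
    refine (Module.End.independent_maxGenEigenspace S.lin).disjoint_biSup_biSup ?_
    rw [Set.disjoint_left]
    rintro α h ⟨j, hj, hα⟩
    rw [Set.mem_ofPred_eq, hα] at h
    exact hj.ne' (weight_injective hξ hξ1 h)
  refine (Submodule.disjoint_def.1 hdis) _ ?_ ?_
  · refine (Submodule.span_le.2 ?_) h1
    rintro x ⟨-, -, α, hα, hx⟩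
    exact Submodule.mem_iSup_of_mem α (Submodule.mem_iSup_of_mem hα hx)
  · refine (Submodule.span_le.2 ?_) h2
    rintro x ⟨-, j, α, hj, hα, hx⟩
    exact Submodule.mem_iSup_of_mem α (Submodule.mem_iSup_of_mem ⟨j, hj, hα⟩ hx)

theorem iSup_truncGr_le : (⨆ n, truncGr ξ m S n) ≤ purePart ξ m S ⊔ posPart ξ m S := by
  refine iSup_le fun n => ?_
  rw [truncGr, Submodule.span_union]
  exact sup_le_sup (le_iSup (fun n => Submodule.span ℂ (pureGen ξ m S n)) n)
    (le_iSup (fun n => Submodule.span ℂ (posGen ξ m S n)) n)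

variable (m S)

/-- The projection of the weight truncation to the cohomology, as a linear map: a pure cocycle is
sent to its class, and the part of positive excess weight is sent to zero. -/
def truncProjLin (hξ : 0 < ξ) (hξ1 : ξ ≠ 1) : trunc ξ m S →ₗ[ℂ] X.HH :=
  (LinearPMap.sup (⟨purePart ξ m S, X.cls ∘ₗ Submodule.inclusion (purePart_le_cocycles ξ m S)⟩ :
      X.carrier →ₗ.[ℂ] X.HH) ⟨posPart ξ m S, 0⟩ (by
    rintro ⟨x, hx⟩ ⟨y, hy⟩ (rfl : x = y)
    have := (Submodule.disjoint_def.1 (disjoint_purePart_posPart hξ hξ1)) x hx hy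
    subst this
    exact map_zero _)).toFun ∘ₗ Submodule.inclusion iSup_truncGr_le

variable {m S}

theorem truncProjLin_add (hξ : 0 < ξ) (hξ1 : ξ ≠ 1) {x y : X} (hx : x ∈ purePart ξ m S)
    (hy : y ∈ posPart ξ m S) (z : trunc ξ m S) (hz : (truncIncl ξ m S).lin z = x + y) :
    truncProjLin m S hξ hξ1 z = X.cls ⟨x, purePart_le_cocycles ξ m S hx⟩ := by
  refine (LinearPMap.sup_apply _ ⟨x, hx⟩ ⟨y, hy⟩ _ hz.symm).trans ?_
  exact add_zero _

theorem truncProjLin_pure (hξ : 0 < ξ) (hξ1 : ξ ≠ 1) {n : ℤ} {x : trunc ξ m S}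
    (hx : (truncIncl ξ m S).lin x ∈ pureGen ξ m S n) :
    truncProjLin m S hξ hξ1 x = X.cls ⟨(truncIncl ξ m S).lin x, hx.2.1⟩ :=
  truncProjLin_add hξ hξ1 (Submodule.mem_iSup_of_mem n (Submodule.subset_span hx))
    (Submodule.zero_mem _) x (add_zero _).symm

theorem truncProjLin_pos (hξ : 0 < ξ) (hξ1 : ξ ≠ 1) {n : ℤ} {x : trunc ξ m S}
    (hx : (truncIncl ξ m S).lin x ∈ posGen ξ m S n) : truncProjLin m S hξ hξ1 x = 0 :=
  (truncProjLin_add hξ hξ1 (Submodule.zero_mem _)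
    (Submodule.mem_iSup_of_mem n (Submodule.subset_span hx)) x (zero_add _).symm).trans
    (map_zero X.cls)

/-- The generators are homogeneous eigenvectors in `X`; this transfers linear statements about the
truncation to them without leaving the subtype. -/
theorem trunc_gr_induction {n : ℤ} {p : trunc ξ m S → Prop} (h0 : p 0)
    (hadd : ∀ x y, p x → p y → p (x + y)) (hsmul : ∀ (c : ℂ) x, p x → p (c • x))
    (hpure : ∀ x, (truncIncl ξ m S).lin x ∈ pureGen ξ m S n → p x)
    (hpos : ∀ x, (truncIncl ξ m S).lin x ∈ posGen ξ m S n → p x) (x : trunc ξ m S)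
    (hx : x ∈ (trunc ξ m S).gr n) : p x := by
  let Z : Submodule ℂ (trunc ξ m S) :=
    { carrier := {x | p x}, zero_mem' := h0, add_mem' := hadd _ _, smul_mem' := hsmul }
  have : truncGr ξ m S n ≤ Z.map (truncIncl ξ m S).lin := by
    rw [truncGr, Submodule.span_le]
    intro y hy
    obtain ⟨z, -, rfl⟩ := exists_truncIncl_eq ξ m S (n := n) (Submodule.subset_span hy)
    exact ⟨z, hy.elim (hpure z) (hpos z), rfl⟩
  obtain ⟨z, hz, hzx⟩ := this (show (truncIncl ξ m S).lin x ∈ truncGr ξ m S n from hx)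
  rw [← truncIncl_injective ξ m S hzx]
  exact hz

variable (m S)

/-- The projection of the weight truncation to the cohomology. -/
def truncProj (hξ : 0 < ξ) (hξ1 : ξ ≠ 1) : Hom (trunc ξ m S) X.cohomology where
  lin := truncProjLin m S hξ hξ1
  map_mem n x hx := by
    refine trunc_gr_induction (p := fun x => truncProjLin m S hξ hξ1 x ∈ X.hgr n) ?_ ?_ ?_ ?_ ?_ x hx
    · rw [map_zero]; exact Submodule.zero_mem _
    · intro x y hx hy; rw [map_add]; exact Submodule.add_mem _ hx hy
    · intro c x hx; rw [map_smul]; exact Submodule.smul_mem _ _ hx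
    · intro x hx
      rw [truncProjLin_pure hξ hξ1 hx]
      exact mem_hgr_cls hx.1
    · intro x hx
      rw [truncProjLin_pos hξ hξ1 hx]
      exact Submodule.zero_mem _
  map_d x := by
    change truncProjLin m S hξ hξ1 _ = 0
    induction x using DGSpace.proj_induction with
    | h0 => rw [map_zero, map_zero]
    | hadd x y hx hy => rw [map_add, map_add, hx, hy, add_zero]
    | hm n x hx =>
      refine trunc_gr_induction (n := n)
        (p := fun x => truncProjLin m S hξ hξ1 ((trunc ξ m S).d x) = 0) ?_ ?_ ?_ ?_ ?_ x hx
      · rw [map_zero, map_zero]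
      · intro x y hx hy; rw [map_add, map_add, hx, hy, add_zero]
      · intro c x hx; rw [map_smul, map_smul, hx, smul_zero]
      · intro x hx
        have : (trunc ξ m S).d x = 0 := truncIncl_injective ξ m S (by
          rw [Hom.map_d, hx.2.1, map_zero])
        rw [this, map_zero]
      · intro x hx
        rcases d_mem_pureGen_or_posGen ξ m S hx with h | h
        · rw [← Hom.map_d] at h
          rw [truncProjLin_pure hξ hξ1 h, cls_eq_zero]
          exact ⟨_, (Hom.map_d _ _).symm⟩
        · rw [← Hom.map_d] at h
          exact truncProjLin_pos hξ hξ1 h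

variable {m S}

/-- The projection discards the part `z` of positive excess. If the element is a cocycle then so is
`z`, and its eigencomponents have weight indices `j > n` absent from the cohomology of degree `n`;
so `z` is exact and nothing is lost in cohomology. On cohomology the projection thus agrees with the
inclusion. -/
theorem truncProj_cocycle (hξ : 0 < ξ) (hξ1 : ξ ≠ 1) (hp : IsPure ξ m X S) {n : ℤ}
    {x : trunc ξ m S} (hx : x ∈ (trunc ξ m S).gr n) (hd : X.d ((truncIncl ξ m S).lin x) = 0) :
    (truncProj m S hξ hξ1).lin x = X.cls ⟨(truncIncl ξ m S).lin x, hd⟩ := by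
  have hx' : (truncIncl ξ m S).lin x ∈ truncGr ξ m S n := hx
  rw [truncGr, Submodule.span_union] at hx'
  obtain ⟨y, hy, z, hz, hyz⟩ := Submodule.mem_sup.1 hx'
  have hyP : y ∈ purePart ξ m S := Submodule.mem_iSup_of_mem n hy
  have hdy : X.d y = 0 := purePart_le_cocycles ξ m S hyP
  have hdz : X.d z = 0 := by
    rw [← hyz, map_add, hdy, zero_add] at hd
    exact hd
  refine (truncProjLin_add hξ hξ1 hyP (Submodule.mem_iSup_of_mem n hz) x hyz.symm).trans ?_
  have hz0 : X.cls ⟨z, hdz⟩ = 0 := by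
    obtain ⟨s, g, hs, hg, hdg, hsum, -⟩ :=
      exists_decomposition (span_posGen_le_iSup ξ m S n hz) hdz
    have e : (⟨z, hdz⟩ : X.cocycles) = ∑ α ∈ s, ⟨g α, hdg α⟩ :=
      Subtype.ext (by rw [AddSubmonoidClass.coe_finsetSum]; exact hsum)
    rw [e, map_sum]
    refine Finset.sum_eq_zero fun α hα => ?_
    obtain ⟨j, hj, hαj⟩ := hs α hα
    have hbot := GradedPure.inf_maxGenEigenspace_eq_bot hp (n := n) (α := α) fun h => by
      rw [hαj] at h
      exact hj.ne' (weight_injective hξ hξ1 h)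
    have hmem : X.cls ⟨g α, hdg α⟩ ∈ X.hgr n ⊓ Module.End.maxGenEigenspace S.onCohomology α :=
      ⟨mem_hgr_cls (hg α).1, cls_mem_maxGenEigenspace S (hg α).2⟩
    rw [hbot] at hmem
    exact hmem
  rw [cls_eq_zero] at hz0
  obtain ⟨w, hw⟩ := hz0
  have hw : X.d w = z := hw
  refine cls_eq_cls.2 ⟨-w, ?_⟩
  change X.d (-w) = y - (truncIncl ξ m S).lin x
  rw [map_neg, hw, ← hyz]
  abel

theorem truncProj_isQuasiIso (hξ : 0 < ξ) (hξ1 : ξ ≠ 1) (hS : S.IsDivisible)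
    (hp : IsPure ξ m X S) : (truncProj m S hξ hξ1).IsQuasiIso := by
  have hi := truncIncl_isQuasiIso hξ hξ1 hS hp
  refine Hom.isQuasiIso_of_homogeneous _ ?_ ?_
  · rintro n x hx hd ⟨w, hw⟩
    have hd' : X.d ((truncIncl ξ m S).lin x) = 0 := by rw [← Hom.map_d, hd, map_zero]
    rw [truncProj_cocycle hξ hξ1 hp hx hd'] at hw
    exact hi.exact hd (cls_eq_zero.1 hw.symm)
  · rintro n _ ⟨y, hy, rfl⟩ -
    obtain ⟨x, hx, hd, w, hw⟩ := hi.lift hy (d_cocycle y)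
    have hd' : X.d ((truncIncl ξ m S).lin x) = 0 := by rw [← Hom.map_d, hd, map_zero]
    refine ⟨x, hd, 0, ?_⟩
    rw [truncProj_cocycle hξ hξ1 hp hx hd', map_zero]
    exact (sub_eq_zero.2 (cls_eq_cls.2 ⟨w, hw⟩)).symm

end Truncation

/-- Purity is transported along equivariant quasi-isomorphisms. -/
theorem _root_.OperadicFormality.IsPure.of_isQuasiIso {ξ m : ℝ} {V W : DGSpace.{u}} {f : Hom V V}
    {g : Hom W W} (c : Hom V W) (hc : c.IsQuasiIso) (hcf : ∀ x, c.lin (f.lin x) = g.lin (c.lin x))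
    (hp : IsPure ξ m V f) : IsPure ξ m W g := by
  let e : V.HH ≃ₗ[ℂ] W.HH := LinearEquiv.ofBijective c.onCohomology hc
  have hef : ∀ h, e (f.onCohomology h) = g.onCohomology (e h) := fun h => by
    obtain ⟨x, rfl⟩ := cls_surjective h
    refine congrArg W.cls (Subtype.ext ?_)
    exact hcf x
  have hgr : ∀ i h, e h ∈ W.hgr i ↔ h ∈ V.hgr i := by
    intro i h
    constructor
    -- Degrees can be reflected as well as preserved, because a homogeneous class has a homogeneous
    -- lift under a quasi-isomorphism.
    · rintro ⟨y, hy, hyh⟩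
      obtain ⟨x, hx, hd, w, hw⟩ := hc.lift hy (d_cocycle y)
      refine ⟨⟨x, hd⟩, hx, e.injective ?_⟩
      rw [← hyh]
      exact cls_eq_cls.2 ⟨w, hw⟩
    · exact c.onCohomology_mem i h
  have hpow : ∀ (α : ℂ) (k : ℕ) (h : V.HH), e (((f.onCohomology - α • 1) ^ k) h) =
      ((g.onCohomology - α • (1 : Module.End ℂ W.HH)) ^ k) (e h) := by
    intro α k
    induction k with
    | zero => intro h; rfl
    | succ k ih =>
      intro h
      rw [pow_succ, pow_succ, Module.End.mul_apply, Module.End.mul_apply, ih]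
      simp [hef]
  constructor
  · have : ⇑g.onCohomology = e ∘ f.onCohomology ∘ e.symm := by
      funext h
      simp [hef]
    rw [this]
    exact e.bijective.comp (hp.bijective.comp e.symm.bijective)
  · exact g.onCohomology_mem
  · intro v
    obtain ⟨U, hU, hfin, hle, hf⟩ := hp.locallyFinite (e.symm v)
    refine ⟨U.map e.toLinearMap, ⟨_, hU, e.apply_symm_apply v⟩, inferInstance, ?_, ?_⟩
    · refine (Submodule.map_mono hle).trans ?_
      rw [Submodule.map_iSup]
      refine iSup_mono fun i => ?_
      rintro _ ⟨x, hx, rfl⟩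
      exact ⟨⟨x, hx.1, rfl⟩, (hgr i x).2 hx.2⟩
    · rintro _ ⟨x, hx, rfl⟩
      exact ⟨f.onCohomology x, hf x hx, hef x⟩
  · intro n α hα hne
    refine hp.eigenvalue n α hα fun hbot => hne ?_
    rw [eq_bot_iff]
    rintro w ⟨hw1, hw2⟩
    obtain ⟨v, rfl⟩ := e.surjective w
    obtain ⟨k, hk⟩ := (Module.End.mem_maxGenEigenspace _ _ _).1 hw2
    have : v ∈ V.hgr n ⊓ Module.End.maxGenEigenspace f.onCohomology α := by
      refine ⟨(hgr n v).1 hw1, (Module.End.mem_maxGenEigenspace _ _ _).2 ⟨k, e.injective ?_⟩⟩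
      rw [hpow, hk, map_zero]
    rw [hbot] at this
    rw [Submodule.mem_bot] at this ⊢
    rw [this, map_zero]

end DGSpace

/-! ### Algebras: restriction, reflection, induced structures -/

theorem map_sign {M N : Type*} [AddCommGroup M] [AddCommGroup N] [Module ℂ M] [Module ℂ N]
    (f : M →ₗ[ℂ] N) (u : ℤˣ) (x : M) : f (u • x) = u • f x := by
  rw [Units.smul_def, Units.smul_def, map_zsmul]

theorem sign_mem {M : Type*} [AddCommGroup M] [Module ℂ M] (Z : Submodule ℂ M) (u : ℤˣ) {x : M}
    (hx : x ∈ Z) : u • x ∈ Z := by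
  rw [Units.smul_def]
  exact zsmul_mem hx _

theorem map_plug {X Y : Type u} {l m n : ℕ} (h : n + 1 = l + m) (i : Fin l) (f : X → Y)
    (v : Fin n → X) (w : X) : (fun y => f (plug h i v w y)) = plug h i (fun y => f (v y)) (f w) := by
  funext y
  unfold plug
  split <;> rfl

/-- The restriction of a family of multilinear operations to an invariant subspace. -/
def restrictAct {R M : Type u} [AddCommGroup R] [Module ℂ R] [AddCommGroup M] [Module ℂ M] {n : ℕ}
    (act : R →ₗ[ℂ] MultilinearMap ℂ (fun _ : Fin n => M) M) (U : Submodule ℂ M)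
    (hU : ∀ a v, (∀ y, v y ∈ U) → act a v ∈ U) :
    R →ₗ[ℂ] MultilinearMap ℂ (fun _ : Fin n => U) U where
  toFun a := ((act a).compLinearMap fun _ => U.subtype).codRestrict U fun v => hU a _ fun y => (v y).2
  map_add' a b := MultilinearMap.ext fun _ => Subtype.ext (DFunLike.congr_fun (map_add act a b) _)
  map_smul' c a := MultilinearMap.ext fun _ => Subtype.ext (DFunLike.congr_fun (map_smul act c a) _)

variable {O : DGOperad.{u}}

/-- The operad is concentrated in nonpositive degrees. -/
abbrev DGOperad.IsNonpositive (O : DGOperad.{u}) : Prop :=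
  ∀ (n : ℕ) (p : ℤ), 0 < p → (O.space n).gr p = ⊥

theorem act_mem_iSup {M : Type u} [AddCommGroup M] [Module ℂ M] {n : ℕ}
    (act : O.space n →ₗ[ℂ] MultilinearMap ℂ (fun _ : Fin n => M) M) (G : ℤ → Submodule ℂ M)
    (h : ∀ (p : ℤ) (k : Fin n → ℤ) (a : O.space n) (v : Fin n → M), a ∈ (O.space n).gr p →
      (∀ y, v y ∈ G (k y)) → act a v ∈ G (p + ∑ y, k y))
    (a : O.space n) (v : Fin n → M) (hv : ∀ y, v y ∈ ⨆ i, G i) : act a v ∈ ⨆ i, G i := by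
  induction a using DGSpace.proj_induction with
  | h0 => rw [map_zero]; exact Submodule.zero_mem _
  | hadd a b ha hb => rw [map_add]; exact Submodule.add_mem _ ha hb
  | hm p a ha =>
    refine multilinear_mem_of_mem_span (act a) (fun _ => ⋃ i, (G i : Set M)) _ ?_ v ?_
    · intro v hv
      choose k hk using fun y => Set.mem_iUnion.1 (hv y)
      exact Submodule.mem_iSup_of_mem _ (h p k a v ha hk)
    · intro y
      rw [← Submodule.iSup_eq_span]
      exact hv y

namespace AlgStr

/-- Operations on a complex satisfy the axioms of an `O`-algebra if they are intertwined with the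
operations of `O`-algebras by a jointly injective family of chain maps. -/
def ofJointlyInjective {ι : Type*} (V : DGSpace.{u}) (A : ι → Alg O)
    (e : ∀ t, DGSpace.Hom V (A t).space)
    (hinj : ∀ x y : V, (∀ t, (e t).lin x = (e t).lin y) → x = y)
    (act : ∀ {n : ℕ}, O.space n →ₗ[ℂ] MultilinearMap ℂ (fun _ : Fin n => V.carrier) V.carrier)
    (he : ∀ {n : ℕ} (t : ι) (a : O.space n) (v : Fin n → V),
      (e t).lin (act a v) = (A t).str.act a fun y => (e t).lin (v y))
    (hmem : ∀ {n : ℕ} (p : ℤ) (k : Fin n → ℤ) (a : O.space n) (v : Fin n → V),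
      a ∈ (O.space n).gr p → (∀ y, v y ∈ V.gr (k y)) → act a v ∈ V.gr (p + ∑ y, k y)) :
    AlgStr O V where
  act := act
  act_mem := hmem
  act_d p k a v ha hv := by
    refine hinj _ _ fun t => ?_
    rw [(e t).map_d, he, (A t).str.act_d p k a _ ha fun y => (e t).map_mem _ _ (hv y), map_add, he,
      map_sum]
    congr 1
    refine Finset.sum_congr rfl fun y _ => ?_
    rw [map_sign, he]
    congr 2
    funext z
    by_cases hz : z = y
    · subst hz; simp [(e t).map_d]
    · simp [hz]
  act_one v := hinj _ _ fun t => by rw [he, (A t).str.act_one]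
  act_perm σ k a v hv := hinj _ _ fun t => by
    rw [he, map_sign, he, (A t).str.act_perm σ k a _ fun y => (e t).map_mem _ _ (hv y)]
    rfl
  act_comp h i q k a b v hb hv := hinj _ _ fun t => by
    rw [he, map_sign, he, (A t).str.act_comp h i q k a b _ hb fun y => (e t).map_mem _ _ (hv y),
      map_plug, he]
    rfl

/-! ### Operations on cocycles and coboundaries. -/

section Cocycles

variable {V : DGSpace.{u}} (s : AlgStr O V)

/-- The Leibniz rule is available for homogeneous arguments only; this lemma and the next reduce
statements about arbitrary cocycles and exact elements to it by multilinearity. -/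
theorem span_homogeneous_cocycles (x : V) (hx : V.d x = 0) :
    x ∈ Submodule.span ℂ {x : V | (∃ k, x ∈ V.gr k) ∧ V.d x = 0} := by
  obtain ⟨s, hs⟩ := V.proj_sum x
  rw [hs]
  refine Submodule.sum_mem _ fun i _ => Submodule.subset_span ⟨⟨i, V.proj_mem i x⟩, ?_⟩
  rw [← V.proj_d, hx, map_zero]

theorem span_homogeneous_exact (x : V) (hx : ∃ u, V.d u = x) :
    x ∈ Submodule.span ℂ {x : V | ∃ k, ∃ u ∈ V.gr k, V.d u = x} := by
  obtain ⟨u, rfl⟩ := hx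
  obtain ⟨s, hs⟩ := V.proj_sum u
  rw [hs, map_sum]
  exact Submodule.sum_mem _ fun i _ => Submodule.subset_span ⟨i, _, V.proj_mem i u, rfl⟩

theorem act_cocycle {n : ℕ} {p : ℤ} {a : O.space n} (ha : a ∈ (O.space n).gr p)
    (hd : (O.space n).d a = 0) (v : Fin n → V) (hv : ∀ y, V.d (v y) = 0) :
    V.d (s.act a v) = 0 := by
  refine multilinear_mem_of_mem_span (s.act a) (fun _ => {x : V | (∃ k, x ∈ V.gr k) ∧ V.d x = 0})
    (LinearMap.ker V.d) ?_ v fun y => span_homogeneous_cocycles _ (hv y)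
  intro v hv
  choose k hk using fun y => (hv y).1
  rw [LinearMap.mem_ker, s.act_d p k a v ha hk, hd, map_zero, zero_apply, zero_add]
  refine Finset.sum_eq_zero fun y _ => ?_
  rw [(hv y).2, (s.act a).map_update_zero, smul_zero]

/-- With the other arguments closed and `a` closed, the Leibniz rule for the tuple in which the
exact argument is replaced by its primitive has a single surviving term, namely the operation in
question up to sign. -/
theorem act_exact {n : ℕ} {p : ℤ} {a : O.space n} (ha : a ∈ (O.space n).gr p)
    (hd : (O.space n).d a = 0) (v : Fin n → V) (hv : ∀ y, V.d (v y) = 0) (y : Fin n)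
    (hy : ∃ u, V.d u = v y) : ∃ w, V.d w = s.act a v := by
  refine multilinear_mem_of_mem_span (s.act a)
    (fun z => if z = y then {x : V | ∃ k, ∃ u ∈ V.gr k, V.d u = x}
      else {x : V | (∃ k, x ∈ V.gr k) ∧ V.d x = 0})
    (LinearMap.range V.d) ?_ v ?_
  · intro v hv
    have h1 : ∃ k, ∃ u ∈ V.gr k, V.d u = v y := by simpa using hv y
    have h2 : ∀ z, z ≠ y → (∃ k, v z ∈ V.gr k) ∧ V.d (v z) = 0 := fun z hz => by
      simpa [hz] using hv z
    obtain ⟨k₀, u, hu, hdu⟩ := h1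
    have h3 : ∀ z, ∃ k, Function.update v y u z ∈ V.gr k := fun z => by
      by_cases hz : z = y
      · subst hz; exact ⟨k₀, by rwa [Function.update_self]⟩
      · rw [Function.update_of_ne hz]; exact (h2 z hz).1
    choose k hk using h3
    have h4 := s.act_d p k a _ ha hk
    rw [hd, map_zero, zero_apply, zero_add, Finset.sum_eq_single y,
      Function.update_self, hdu, Function.update_idem, Function.update_eq_self] at h4
    · refine ⟨(p + degBefore k y.val).negOnePow • s.act a (Function.update v y u), ?_⟩
      rw [map_sign, h4, smul_smul, Int.units_mul_self, one_smul]
    · intro z _ hz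
      rw [Function.update_of_ne hz, (h2 z hz).2, (s.act a).map_update_zero, smul_zero]
    · intro hn; exact absurd (Finset.mem_univ y) hn
  · intro z
    by_cases hz : z = y
    · subst hz; simpa using span_homogeneous_exact _ hy
    · simpa [hz] using span_homogeneous_cocycles _ (hv z)

theorem act_d_exact {n : ℕ} {p : ℤ} {a : O.space n} (ha : a ∈ (O.space n).gr p)
    (v : Fin n → V) (hv : ∀ y, V.d (v y) = 0) :
    ∃ w, V.d w = s.act ((O.space n).d a) v := by
  refine multilinear_mem_of_mem_span (s.act ((O.space n).d a))
    (fun _ => {x : V | (∃ k, x ∈ V.gr k) ∧ V.d x = 0})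
    (LinearMap.range V.d) ?_ v fun y => span_homogeneous_cocycles _ (hv y)
  intro v hv
  choose k hk using fun y => (hv y).1
  refine ⟨s.act a v, ?_⟩
  rw [s.act_d p k a v ha hk, add_eq_left]
  refine Finset.sum_eq_zero fun y _ => ?_
  rw [(hv y).2, (s.act a).map_update_zero, smul_zero]

end Cocycles

end AlgStr

namespace DGSpace

variable (V : DGSpace.{u})

/-- A linear projection to the cocycles. -/
def retract : V →ₗ[ℂ] V.cocycles :=
  (LinearMap.exists_leftInverse_of_injective V.cocycles.subtype
    (Submodule.ker_subtype _)).choose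

variable {V} in
theorem retract_apply {x : V} (hx : V.d x = 0) : V.retract x = ⟨x, hx⟩ :=
  LinearMap.congr_fun (LinearMap.exists_leftInverse_of_injective V.cocycles.subtype
    (Submodule.ker_subtype _)).choose_spec ⟨x, hx⟩

/-- A linear choice of cocycles that represent cohomology classes. -/
def rep : V.HH →ₗ[ℂ] V.cocycles :=
  (V.cls.exists_rightInverse_of_surjective
    (LinearMap.range_eq_top.2 V.coboundaries.mkQ_surjective)).choose

theorem cls_rep (h : V.HH) : V.cls (V.rep h) = h :=
  LinearMap.congr_fun (V.cls.exists_rightInverse_of_surjective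
    (LinearMap.range_eq_top.2 V.coboundaries.mkQ_surjective)).choose_spec h

end DGSpace

/-- Since `O` vanishes in degree one, every operation of degree zero is a cocycle and therefore acts
on cohomology. -/
theorem gr_zero_d (hO : O.IsNonpositive) {n : ℕ} {a : O.space n}
    (ha : a ∈ (O.space n).gr 0) : (O.space n).d a = 0 := by
  have := (O.space n).d_mem 0 a ha
  rw [hO n (0 + 1) (by norm_num)] at this
  exact this

/-! ### The induced algebra structure on cohomology. -/

namespace AlgStr

variable {V : DGSpace.{u}} (s : AlgStr O V)

/-- The operations on chosen representatives of cohomology classes. -/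
def cohAct {n : ℕ} :
    O.space n →ₗ[ℂ] MultilinearMap ℂ (fun _ : Fin n => V.HH) V.HH :=
  -- `retract` and `rep` are linear choices. The values of `retract` outside the cocycles are
  -- arbitrary, but they make the formula linear in all operations, closed or not.
  LinearMap.compMultilinearMapₗ ℂ (V.cls ∘ₗ V.retract) ∘ₗ
    MultilinearMap.compLinearMapₗ (fun _ => V.cocycles.subtype ∘ₗ V.rep) ∘ₗ s.act

theorem cohAct_cls {n : ℕ} {p : ℤ} {a : O.space n} (ha : a ∈ (O.space n).gr p)
    (hd : (O.space n).d a = 0) (v : Fin n → V.cocycles) (w : V.cocycles)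
    (hw : (w : V) = s.act a fun y => v y) :
    s.cohAct a (fun y => V.cls (v y)) = V.cls w := by
  let f : MultilinearMap ℂ (fun _ : Fin n => V.cocycles) V.HH :=
    (V.cls ∘ₗ V.retract).compMultilinearMap ((s.act a).compLinearMap fun _ => V.cocycles.subtype)
  have hf : ∀ (v : Fin n → V.cocycles) (h : V.d (s.act a fun y => v y) = 0),
      f v = V.cls ⟨s.act a fun y => v y, h⟩ :=
    fun v h => congrArg V.cls (DGSpace.retract_apply h)
  have hc : ∀ v : Fin n → V.cocycles, V.d (s.act a fun y => v y) = 0 := fun v =>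
    s.act_cocycle ha hd _ fun y => DGSpace.d_cocycle (v y)
  have h1 : s.cohAct a (fun y => V.cls (v y)) = f fun y => V.rep (V.cls (v y)) := rfl
  rw [h1, multilinear_congr_of_sub_mem f V.coboundaries ?_ _ v, hf v (hc v)]
  · exact congrArg V.cls (Subtype.ext hw.symm)
  · intro y
    have := V.cls_rep (V.cls (v y))
    rwa [← sub_eq_zero, ← map_sub, Submodule.mkQ_apply, Submodule.Quotient.mk_eq_zero] at this
  · intro v y hy
    rw [hf v (hc v), DGSpace.cls_eq_zero]
    exact s.act_exact ha hd _ (fun y => DGSpace.d_cocycle (v y)) y hy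

/-- The operations on cohomology: `O` acts through its part of degree zero, on representatives. -/
def inducedAct {n : ℕ} :
    O.space n →ₗ[ℂ] MultilinearMap ℂ (fun _ : Fin n => V.HH) V.HH :=
  s.cohAct ∘ₗ (O.space n).proj 0

theorem inducedAct_of_zero {n : ℕ} {a : O.space n} (ha : a ∈ (O.space n).gr 0) :
    s.inducedAct a = s.cohAct a := by
  have h := (O.space n).proj_same 0 a ha
  simp only [inducedAct, LinearMap.comp_apply, h]

theorem inducedAct_of_ne_zero {n : ℕ} {p : ℤ} (hp : p ≠ 0) {a : O.space n}
    (ha : a ∈ (O.space n).gr p) : s.inducedAct a = 0 := by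
  have h := (O.space n).proj_ne hp a ha
  simp only [inducedAct, LinearMap.comp_apply, h, map_zero]

theorem inducedAct_cls (hO : O.IsNonpositive) {n : ℕ}
    {a : O.space n} (ha : a ∈ (O.space n).gr 0) (v : Fin n → V.cocycles) (w : V.cocycles)
    (hw : (w : V) = s.act a fun y => v y) :
    s.inducedAct a (fun y => V.cls (v y)) = V.cls w := by
  rw [s.inducedAct_of_zero ha]
  exact s.cohAct_cls ha (gr_zero_d hO ha) v w hw

theorem exists_cocycle_reps {n : ℕ} {k : Fin n → ℤ} {v : Fin n → V.HH}
    (hv : ∀ y, v y ∈ V.hgr (k y)) :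
    ∃ z : Fin n → V.cocycles, (∀ y, (z y : V) ∈ V.gr (k y)) ∧ v = fun y => V.cls (z y) := by
  choose z hz hzv using hv
  exact ⟨z, hz, funext fun y => (hzv y).symm⟩

theorem inducedAct_mem (hO : O.IsNonpositive) {n : ℕ} (p : ℤ) (k : Fin n → ℤ) (a : O.space n) (v : Fin n → V.HH)
    (ha : a ∈ (O.space n).gr p) (hv : ∀ y, v y ∈ V.hgr (k y)) :
    s.inducedAct a v ∈ V.hgr (p + ∑ y, k y) := by
  obtain ⟨z, hz, rfl⟩ := exists_cocycle_reps hv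
  by_cases hp : p = 0
  · subst hp
    have h0 := s.act_cocycle ha (gr_zero_d hO ha) (fun y => (z y : V))
      fun y => DGSpace.d_cocycle (z y)
    rw [s.inducedAct_cls hO ha z ⟨_, h0⟩ rfl]
    exact DGSpace.mem_hgr_cls (s.act_mem 0 k a _ ha hz)
  · rw [s.inducedAct_of_ne_zero hp ha]
    exact Submodule.zero_mem _

/-- Only degree `-1` matters: there `d a` has degree zero, and on closed arguments it acts by the
coboundary of `act a v`. This is why the degree zero part acts through `H^0(O)`. -/
theorem inducedAct_d (hO : O.IsNonpositive) {n : ℕ} (p : ℤ) (k : Fin n → ℤ) (a : O.space n) (v : Fin n → V.HH)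
    (ha : a ∈ (O.space n).gr p) (hv : ∀ y, v y ∈ V.hgr (k y)) :
    (0 : V.HH) = s.inducedAct ((O.space n).d a) v + ∑ y, (p + degBefore k y.val).negOnePow •
      s.inducedAct a (Function.update v y 0) := by
  rw [Finset.sum_eq_zero, add_zero]
  · by_cases hp : p + 1 = 0
    · obtain ⟨z, hz, rfl⟩ := exists_cocycle_reps hv
      have hda : (O.space n).d a ∈ (O.space n).gr 0 := hp ▸ (O.space n).d_mem p a ha
      obtain ⟨w, hw⟩ := s.act_d_exact ha (fun y => (z y : V)) fun y => DGSpace.d_cocycle (z y)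
      rw [s.inducedAct_cls hO hda z ⟨V.d w, V.d_d w⟩ hw, eq_comm, DGSpace.cls_eq_zero]
      exact ⟨w, rfl⟩
    · rw [s.inducedAct_of_ne_zero hp ((O.space n).d_mem p a ha), zero_apply]
  · intro y _
    rw [(s.inducedAct a).map_update_zero, smul_zero]

theorem inducedAct_one (hO : O.IsNonpositive) (v : Fin 1 → V.HH) : s.inducedAct O.one v = v 0 := by
  obtain ⟨z, rfl⟩ : ∃ z : Fin 1 → V.cocycles, v = fun y => V.cls (z y) :=
    ⟨fun y => V.rep (v y), funext fun y => (V.cls_rep _).symm⟩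
  exact s.inducedAct_cls hO O.one_mem z (z 0) (s.act_one fun y => (z y : V)).symm

theorem inducedAct_perm (hO : O.IsNonpositive) {n : ℕ} (σ : Equiv.Perm (Fin n)) (k : Fin n → ℤ) (a : O.space n)
    (v : Fin n → V.HH) (hv : ∀ y, v y ∈ V.hgr (k y)) :
    s.inducedAct (O.perm σ a) v = koszul σ k • s.inducedAct a (v ∘ σ.symm) := by
  obtain ⟨z, hz, rfl⟩ := exists_cocycle_reps hv
  induction a using DGSpace.proj_induction with
  | h0 => simp only [map_zero, zero_apply, smul_zero]
  | hadd a b ha hb => simp only [map_add, add_apply, smul_add, ha, hb]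
  | hm p a ha =>
    by_cases hp : p = 0
    · subst hp
      have h0 := fun z : Fin n → V.cocycles => s.act_cocycle ha (gr_zero_d hO ha)
        (fun y => (z y : V)) fun y => DGSpace.d_cocycle (z y)
      rw [s.inducedAct_cls hO (O.perm_mem σ 0 a ha) z (koszul σ k • ⟨_, h0 (z ∘ σ.symm)⟩), map_sign]
      · congr 1
        exact (s.inducedAct_cls hO ha (z ∘ σ.symm) ⟨_, h0 (z ∘ σ.symm)⟩ rfl).symm
      · rw [s.act_perm σ k a _ hz]
        exact map_sign V.cocycles.subtype _ _
    · rw [s.inducedAct_of_ne_zero hp ha, s.inducedAct_of_ne_zero hp (O.perm_mem σ p a ha),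
        zero_apply, zero_apply, smul_zero]

/-- In total degree zero with `p` and `q` not both zero, one of the two is positive, so the
corresponding factor is zero. Hence discarding all nonzero degrees is compatible with composition.
-/
theorem inducedAct_comp (hO : O.IsNonpositive) {l m n : ℕ} (h : n + 1 = l + m) (i : Fin l) (q : ℤ) (k : Fin n → ℤ)
    (a : O.space l) (b : O.space m) (v : Fin n → V.HH) (hb : b ∈ (O.space m).gr q)
    (hv : ∀ y, v y ∈ V.hgr (k y)) :
    s.inducedAct (O.comp h i a b) v = (q * degBefore k i.val).negOnePow •
      s.inducedAct a (plug h i v (s.inducedAct b (v ∘ innerPos h i))) := by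
  obtain ⟨z, hz, rfl⟩ := exists_cocycle_reps hv
  induction a using DGSpace.proj_induction with
  | h0 => simp only [map_zero, LinearMap.zero_apply, zero_apply, smul_zero]
  | hadd a b ha hb => simp only [map_add, LinearMap.add_apply, add_apply, smul_add, ha, hb]
  | hm p a ha =>
    by_cases hpq : p = 0 ∧ q = 0
    · obtain ⟨rfl, rfl⟩ := hpq
      have hab : O.comp h i a b ∈ (O.space n).gr 0 := by simpa using O.comp_mem h i 0 0 a b ha hb
      have h0 := s.act_cocycle hb (gr_zero_d hO hb) (fun y => (z (innerPos h i y) : V))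
        fun y => DGSpace.d_cocycle _
      let z' : Fin l → V.cocycles := plug h i z ⟨_, h0⟩
      have h1 := s.act_cocycle ha (gr_zero_d hO ha) (fun y => (z' y : V))
        fun y => DGSpace.d_cocycle _
      rw [s.inducedAct_cls hO hab z ((0 * degBefore k i.val).negOnePow • ⟨_, h1⟩), map_sign]
      · congr 1
        rw [← s.inducedAct_cls hO ha _ ⟨_, h1⟩ rfl, map_plug]
        congr 2
        exact (s.inducedAct_cls hO hb (z ∘ innerPos h i) ⟨_, h0⟩ rfl).symm
      · rw [s.act_comp h i 0 k a b _ hb hz]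
        refine (map_sign V.cocycles.subtype _ _).trans ?_
        congr 1
        exact congrArg (s.act a) (map_plug h i (Subtype.val : V.cocycles → V) z ⟨_, h0⟩)
    · have hr : s.inducedAct a (plug h i (fun y => V.cls (z y))
          (s.inducedAct b ((fun y => V.cls (z y)) ∘ innerPos h i))) = 0 := by
        by_cases hp : p = 0
        · have hq : q ≠ 0 := fun hq => hpq ⟨hp, hq⟩
          refine (s.inducedAct a).map_coord_zero i ?_
          rw [s.inducedAct_of_ne_zero hq hb]
          simp [plug]
        · rw [s.inducedAct_of_ne_zero hp ha, zero_apply]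
      rw [hr, smul_zero]
      by_cases hs : p + q = 0
      · have : O.comp h i a b = 0 := by
          rcases lt_trichotomy p 0 with hp | hp | hp
          · rw [hO m q (by omega)] at hb
            rw [(Submodule.mem_bot ℂ).1 hb, map_zero]
          · exact absurd ⟨hp, by omega⟩ hpq
          · rw [hO l p hp] at ha
            rw [(Submodule.mem_bot ℂ).1 ha, map_zero, LinearMap.zero_apply]
        rw [this, map_zero, zero_apply]
      · rw [s.inducedAct_of_ne_zero hs (O.comp_mem h i p q a b ha hb), zero_apply]

/-- The structure of `O`-algebra on the cohomology in which `O` acts through `H^0(O)`. -/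
def induced (hO : O.IsNonpositive) : AlgStr O V.cohomology where
  act := s.inducedAct
  act_mem := s.inducedAct_mem hO
  act_d := s.inducedAct_d hO
  act_one := s.inducedAct_one hO
  act_perm := s.inducedAct_perm hO
  act_comp := s.inducedAct_comp hO

end AlgStr

/-! ### Formality of algebras with a divisible pure endomorphism -/

/-- The version without a distinguished linear argument follows by adding the argument `1` in `ℂ`,
on which the identity acts with eigenvalue `1`. -/
theorem multilinear_mem_maxGenEigenspace' {ι M P : Type*} [Fintype ι] [AddCommGroup M] [Module ℂ M]
    [AddCommGroup P] [Module ℂ P] (g : MultilinearMap ℂ (fun _ : ι => M) P) (F : Module.End ℂ M)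
    (h : Module.End ℂ P) (hg : ∀ b, h (g b) = g fun y => F (b y)) (β : ι → ℂ) (b : ι → M)
    (hb : ∀ y, b y ∈ F.maxGenEigenspace (β y)) : g b ∈ h.maxGenEigenspace (∏ y, β y) := by
  have := multilinear_mem_maxGenEigenspace
    ((LinearMap.ringLmapEquivSelf ℂ ℂ P).symm.toLinearMap.compMultilinearMap g) F
    (LinearMap.id : ℂ →ₗ[ℂ] ℂ) h (fun b x => by simp [hg]) β 1 b 1 hb
    ((Module.End.mem_maxGenEigenspace _ _ _).2 ⟨1, by simp⟩)
  simpa using this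

theorem norm_prod_eq_rpow {ι : Type*} [Fintype ι] {ξ : ℝ} (hξ : 0 < ξ) {α : ι → ℂ} {j : ι → ℤ}
    (h : ∀ y, ‖α y‖ = ξ ^ ((j y : ℝ) + 0)) : ‖∏ y, α y‖ = ξ ^ (((∑ y, j y : ℤ) : ℝ) + 0) := by
  rw [norm_prod, add_zero, Int.cast_sum, Real.rpow_sum_of_pos hξ]
  exact Finset.prod_congr rfl fun y _ => by rw [h, add_zero]

namespace DGSpace

variable {X : DGSpace.{u}} {ξ m : ℝ} {S : Hom X X}

theorem exists_weight {n : ℤ} {x : X} (hx : x ∈ pureGen ξ m S n ∪ posGen ξ m S n) :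
    x ∈ X.gr n ∧ ∃ (j : ℤ) (α : ℂ), n ≤ j ∧ ‖α‖ = ξ ^ ((j : ℝ) + m) ∧
      x ∈ Module.End.maxGenEigenspace S.lin α ∧ (x ∈ posGen ξ m S n → n < j) ∧
        (j = n → X.d x = 0) := by
  classical
  by_cases h : x ∈ posGen ξ m S n
  · obtain ⟨hn, j, α, hj, hα, hx⟩ := h
    exact ⟨hn, j, α, hj.le, hα, hx, fun _ => hj, fun e => absurd e hj.ne'⟩
  · obtain ⟨hn, hd, α, hα, hx⟩ := hx.resolve_right h
    exact ⟨hn, n, α, le_rfl, hα, hx, fun h' => absurd h' h, fun _ => hd⟩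

theorem span_gen : Submodule.span ℂ {x : trunc ξ m S | ∃ n,
    (truncIncl ξ m S).lin x ∈ pureGen ξ m S n ∪ posGen ξ m S n} = ⊤ := by
  rw [eq_top_iff]
  rintro x -
  induction x using DGSpace.proj_induction with
  | h0 => exact Submodule.zero_mem _
  | hadd x y hx hy => exact Submodule.add_mem _ hx hy
  | hm n x hx =>
    refine trunc_gr_induction (n := n) (p := fun x => x ∈ Submodule.span ℂ _)
      (Submodule.zero_mem _) (fun x y hx hy => Submodule.add_mem _ hx hy)
      (fun c x hx => Submodule.smul_mem _ c hx) ?_ ?_ x hx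
    · exact fun x hx => Submodule.subset_span ⟨n, Or.inl hx⟩
    · exact fun x hx => Submodule.subset_span ⟨n, Or.inr hx⟩

end DGSpace

namespace Alg

variable {O : DGOperad.{u}} {ξ : ℝ}

open DGSpace

section Truncation

variable {X : Alg O} {S : Alg.Hom X X} {n : ℕ} {p : ℤ} {k : Fin n → ℤ} {a : O.space n}
  {v : Fin n → X.space}

theorem act_mem_maxGenEigenspace (S : Alg.Hom X X) (a : O.space n) {α : Fin n → ℂ}
    (hv : ∀ y, v y ∈ Module.End.maxGenEigenspace S.lin (α y)) :
    X.str.act a v ∈ Module.End.maxGenEigenspace S.lin (∏ y, α y) :=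
  multilinear_mem_maxGenEigenspace' (X.str.act a) S.lin S.lin (S.map_act a) α v hv

/-- The weight indices add up to `∑ j`, while the degree of the result is `p + ∑ k`. The excess of
the result is the sum of the excesses minus `p`, which is positive as soon as `p < 0` or one input
has positive excess. -/
theorem act_mem_posGen (hξ : 0 < ξ) (ha : a ∈ (O.space n).gr p) (hp : p ≤ 0)
    (hv : ∀ y, v y ∈ pureGen ξ 0 S.toHom (k y) ∪ posGen ξ 0 S.toHom (k y))
    (h : p < 0 ∨ ∃ y, v y ∈ posGen ξ 0 S.toHom (k y)) :
    X.str.act a v ∈ posGen ξ 0 S.toHom (p + ∑ y, k y) := by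
  choose hn j α hj hα hvα hpos hd using fun y => exists_weight (hv y)
  refine ⟨X.str.act_mem p k a v ha hn, ∑ y, j y, ∏ y, α y, ?_, norm_prod_eq_rpow hξ hα,
    act_mem_maxGenEigenspace S a hvα⟩
  rcases h with h | ⟨y, hy⟩
  · have := Finset.sum_le_sum fun y (_ : y ∈ Finset.univ) => hj y
    omega
  · have := Finset.sum_lt_sum (fun y (_ : y ∈ Finset.univ) => hj y)
      ⟨y, Finset.mem_univ y, hpos y hy⟩
    omega

theorem act_mem_pureGen (hO : O.IsNonpositive) (hξ : 0 < ξ) (ha : a ∈ (O.space n).gr 0)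
    (hv : ∀ y, v y ∈ pureGen ξ 0 S.toHom (k y)) :
    X.str.act a v ∈ pureGen ξ 0 S.toHom (0 + ∑ y, k y) := by
  choose hn hd α hα hvα using hv
  refine ⟨X.str.act_mem 0 k a v ha hn, X.str.act_cocycle ha (gr_zero_d hO ha) v hd, ∏ y, α y, ?_,
    act_mem_maxGenEigenspace S a hvα⟩
  rw [zero_add]
  exact norm_prod_eq_rpow hξ hα

/-- The only product without positive excess is an operation of degree zero applied to pure
cocycles, and this is again a pure cocycle. Nonpositivity of `O` excludes the remaining case `p >
0`. -/
theorem act_mem_truncGr (hO : O.IsNonpositive) (hξ : 0 < ξ) (ha : a ∈ (O.space n).gr p)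
    (hv : ∀ y, v y ∈ truncGr ξ 0 S.toHom (k y)) :
    X.str.act a v ∈ truncGr ξ 0 S.toHom (p + ∑ y, k y) := by
  refine multilinear_mem_of_mem_span (X.str.act a) _ _ ?_ v hv
  intro v hv
  rcases lt_trichotomy p 0 with hp | rfl | hp
  · exact Submodule.subset_span (Or.inr (act_mem_posGen hξ ha hp.le hv (Or.inl hp)))
  · by_cases h : ∃ y, v y ∈ posGen ξ 0 S.toHom (k y)
    · exact Submodule.subset_span (Or.inr (act_mem_posGen hξ ha le_rfl hv (Or.inr h)))
    · push Not at h
      exact Submodule.subset_span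
        (Or.inl (act_mem_pureGen hO hξ ha fun y => (hv y).resolve_right (h y)))
  · rw [hO n p hp] at ha
    rw [(Submodule.mem_bot ℂ).1 ha, map_zero, zero_apply]
    exact Submodule.zero_mem _

variable (X S)

/-- The operations on the weight truncation. -/
def truncAct (hO : O.IsNonpositive) (hξ : 0 < ξ) (n : ℕ) : O.space n →ₗ[ℂ] MultilinearMap ℂ
    (fun _ : Fin n => (DGSpace.trunc ξ 0 S.toHom).carrier) (DGSpace.trunc ξ 0 S.toHom).carrier :=
  restrictAct X.str.act (⨆ n, truncGr ξ 0 S.toHom n) (act_mem_iSup X.str.act _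
    fun _ _ _ _ ha hv => act_mem_truncGr hO hξ ha hv)

/-- The weight truncation as an `O`-algebra. -/
def trunc (hO : O.IsNonpositive) (hξ : 0 < ξ) : Alg O where
  space := DGSpace.trunc ξ 0 S.toHom
  str := AlgStr.ofJointlyInjective _ (fun _ : Unit => X) (fun _ => truncIncl ξ 0 S.toHom)
    (fun _ _ h => truncIncl_injective ξ 0 S.toHom (h ())) (truncAct X S hO hξ _)
    (fun _ _ _ => rfl) (fun _ _ _ _ ha hv => act_mem_truncGr hO hξ ha hv)

/-- The inclusion of the weight truncation. -/
def truncIncl (hO : O.IsNonpositive) (hξ : 0 < ξ) : Alg.Hom (trunc X S hO hξ) X where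
  toHom := DGSpace.truncIncl ξ 0 S.toHom
  map_act _ _ := rfl

/-- The cohomology of an `O`-algebra, with `O` acting through `H^0(O)`. -/
def cohomology (hO : O.IsNonpositive) : Alg O where
  space := X.space.cohomology
  str := X.str.induced hO

variable {X S}

/-- Both sides vanish if the operation has nonzero degree or some argument has positive excess;
otherwise all arguments are pure cocycles and serve as representatives for the induced action. -/
theorem truncProjLin_act_of_gen (hO : O.IsNonpositive) (hξ : 0 < ξ) (hξ1 : ξ ≠ 1)
    (ha : a ∈ (O.space n).gr p) (x : Fin n → DGSpace.trunc ξ 0 S.toHom)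
    (hx : ∀ y, (DGSpace.truncIncl ξ 0 S.toHom).lin (x y) ∈
      pureGen ξ 0 S.toHom (k y) ∪ posGen ξ 0 S.toHom (k y)) :
    truncProjLin 0 S.toHom hξ hξ1 (truncAct X S hO hξ n a x) =
      X.str.inducedAct a fun y => truncProjLin 0 S.toHom hξ hξ1 (x y) := by
  rcases lt_or_ge 0 p with hp | hp
  · rw [hO n p hp] at ha
    rw [(Submodule.mem_bot ℂ).1 ha, map_zero, map_zero, zero_apply, zero_apply, map_zero]
  by_cases h : p < 0 ∨ ∃ y, (DGSpace.truncIncl ξ 0 S.toHom).lin (x y) ∈ posGen ξ 0 S.toHom (k y)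
  · rw [truncProjLin_pos hξ hξ1 (act_mem_posGen hξ ha hp hx h)]
    rcases h with h | ⟨y, hy⟩
    · rw [X.str.inducedAct_of_ne_zero h.ne ha, zero_apply]
    · exact ((X.str.inducedAct a).map_coord_zero y (truncProjLin_pos hξ hξ1 hy)).symm
  · push Not at h
    obtain rfl : p = 0 := le_antisymm hp h.1
    have hx' := fun y => (hx y).resolve_right (h.2 y)
    rw [truncProjLin_pure hξ hξ1 (act_mem_pureGen hO hξ ha hx')]
    simp only [fun y => truncProjLin_pure hξ hξ1 (hx' y)]
    exact (X.str.inducedAct_cls hO ha _ _ rfl).symm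

theorem truncProjLin_act (hO : O.IsNonpositive) (hξ : 0 < ξ) (hξ1 : ξ ≠ 1) (a : O.space n)
    (x : Fin n → DGSpace.trunc ξ 0 S.toHom) :
    truncProjLin 0 S.toHom hξ hξ1 (truncAct X S hO hξ n a x) =
      X.str.inducedAct a fun y => truncProjLin 0 S.toHom hξ hξ1 (x y) := by
  induction a using DGSpace.proj_induction with
  | h0 => simp only [map_zero, zero_apply]
  | hadd a b ha hb => simp only [map_add, add_apply, ha, hb]
  | hm p a ha =>
    let f : MultilinearMap ℂ (fun _ : Fin n => (DGSpace.trunc ξ 0 S.toHom).carrier) X.space.HH :=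
      (truncProjLin 0 S.toHom hξ hξ1).compMultilinearMap (truncAct X S hO hξ n a) -
        (X.str.inducedAct a).compLinearMap fun _ => truncProjLin 0 S.toHom hξ hξ1
    refine sub_eq_zero.1 (multilinear_mem_of_mem_span f (fun _ => _) ⊥ ?_ x
      fun y => by rw [span_gen]; trivial)
    intro x hx
    choose k hk using hx
    exact sub_eq_zero.2 (truncProjLin_act_of_gen hO hξ hξ1 ha x hk)

variable (X S)

/-- The projection of the weight truncation to the cohomology. -/
def truncProj (hO : O.IsNonpositive) (hξ : 0 < ξ) (hξ1 : ξ ≠ 1) :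
    Alg.Hom (trunc X S hO hξ) (cohomology X hO) where
  toHom := DGSpace.truncProj 0 S.toHom hξ hξ1
  map_act := truncProjLin_act hO hξ hξ1

end Truncation

/-- The map induced on cohomology by a morphism of `O`-algebras. -/
def Hom.cohomologyMap {A B : Alg O} (f : Alg.Hom A B) (hO : O.IsNonpositive) :
    Alg.Hom (A.cohomology hO) (B.cohomology hO) where
  toHom := f.toHom.cohomologyMap
  map_act {n} a v := by
    change f.onCohomology (A.str.inducedAct a v) =
      B.str.inducedAct a fun y => f.onCohomology (v y)
    obtain ⟨z, rfl⟩ : ∃ z : Fin n → A.space.cocycles, v = fun y => A.space.cls (z y) :=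
      ⟨fun y => A.space.rep (v y), funext fun y => (A.space.cls_rep _).symm⟩
    induction a using DGSpace.proj_induction with
    | h0 => simp only [map_zero, zero_apply]
    | hadd a b ha hb => simp only [map_add, add_apply, ha, hb]
    | hm p a ha =>
      by_cases hp : p = 0
      · subst hp
        have h0 := A.str.act_cocycle ha (gr_zero_d hO ha) (fun y => (z y : A.space))
          fun y => d_cocycle (z y)
        rw [A.str.inducedAct_cls hO ha z ⟨_, h0⟩ rfl, Hom.onCohomology_cls]
        exact (B.str.inducedAct_cls hO ha (fun y => f.onCocycles (z y)) _ (f.map_act a _)).symm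
      · rw [A.str.inducedAct_of_ne_zero hp ha, B.str.inducedAct_of_ne_zero hp ha, zero_apply,
          zero_apply, map_zero]

theorem Hom.cohomologyMap_isQuasiIso {A B : Alg O} (f : Alg.Hom A B) (hO : O.IsNonpositive)
    (hf : f.toHom.IsQuasiIso) : (f.cohomologyMap hO).toHom.IsQuasiIso :=
  DGSpace.Hom.isQuasiIso_of_bijective _ hf rfl

/-- A quasi-isomorphism becomes an isomorphism in the homotopy category. -/
def isoOfQuasiIso {A B : Alg O} (f : Alg.Hom A B) (hf : f.toHom.IsQuasiIso) :
    (toHo O).obj A ≅ (toHo O).obj B :=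
  Localization.isoOfHom (toHo O) (quasiIso O) (show A ⟶ B from f) hf

/-- The zigzag is `B → X ← T → H(X) ← H(B)`, with `T` the weight truncation of the divisible model
`X`. -/
theorem nonempty_iso_cohomology (hO : O.IsNonpositive) (hξ : 0 < ξ) (hξ1 : ξ ≠ 1) {B X : Alg O}
    (c : Alg.Hom B X) (hc : c.toHom.IsQuasiIso) (S : Alg.Hom X X) (hS : S.toHom.IsDivisible)
    (hp : IsPure ξ 0 X.space S.toHom) :
    Nonempty ((toHo O).obj B ≅ (toHo O).obj (B.cohomology hO)) :=
  ⟨isoOfQuasiIso c hc ≪≫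
    (isoOfQuasiIso (truncIncl X S hO hξ) (truncIncl_isQuasiIso hξ hξ1 hS hp)).symm ≪≫
    isoOfQuasiIso (truncProj X S hO hξ hξ1) (truncProj_isQuasiIso hξ hξ1 hS hp) ≪≫
    (isoOfQuasiIso (c.cohomologyMap hO) (c.cohomologyMap_isQuasiIso hO hc)).symm⟩

/-! ### Purity and the action of cocycles of nonzero degree. -/

section Induced

variable {B : Alg O} {F : Alg.Hom B B}

theorem span_eigenclasses {V : DGSpace.{u}} {f : DGSpace.Hom V V} {m : ℝ} (hp : IsPure ξ m V f) :
    Submodule.span ℂ {h : V.HH | ∃ (k : ℤ) (α : ℂ), h ∈ V.hgr k ∧ ‖α‖ = ξ ^ ((k : ℝ) + m) ∧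
      h ∈ Module.End.maxGenEigenspace f.onCohomology α} = ⊤ := by
  rw [eq_top_iff, ← V.hgr_isInternal.submodule_iSup_eq_top]
  refine iSup_le fun k h hh => ?_
  refine (iSup₂_le fun α hα x hx => ?_ : (⨆ α ∈ {α : ℂ | ‖α‖ = ξ ^ ((k : ℝ) + m)},
    V.hgr k ⊓ Module.End.maxGenEigenspace f.onCohomology α) ≤ _) (GradedPure.mem_iSup hp hh)
  exact Submodule.subset_span ⟨k, α, hx.1, hα, hx.2⟩

theorem cohAct_onCohomology {n : ℕ} {p : ℤ} {a : O.space n} (F : Alg.Hom B B)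
    (ha : a ∈ (O.space n).gr p) (hd : (O.space n).d a = 0) (h : Fin n → B.space.HH) :
    F.onCohomology (B.str.cohAct a h) = B.str.cohAct a fun y => F.onCohomology (h y) := by
  obtain ⟨z, rfl⟩ : ∃ z : Fin n → B.space.cocycles, h = fun y => B.space.cls (z y) :=
    ⟨fun y => B.space.rep (h y), funext fun y => (B.space.cls_rep _).symm⟩
  have h0 := B.str.act_cocycle ha hd (fun y => (z y : B.space)) fun y => d_cocycle (z y)
  rw [B.str.cohAct_cls ha hd z ⟨_, h0⟩ rfl, Hom.onCohomology_cls]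
  exact (B.str.cohAct_cls ha hd (fun y => F.onCocycles (z y)) _ (F.map_act a _)).symm

/-- Cocycles of nonzero degree act trivially on pure cohomology. -/
theorem cohAct_eq_zero (hξ : 0 < ξ) (hξ1 : ξ ≠ 1) (hp : IsPure ξ 0 B.space F.toHom) {n : ℕ} {p : ℤ}
    (hp0 : p ≠ 0) {a : O.space n} (ha : a ∈ (O.space n).gr p) (hd : (O.space n).d a = 0) :
    B.str.cohAct a = 0 := by
  ext h
  refine multilinear_mem_of_mem_span (B.str.cohAct a) (fun _ => _) ⊥ ?_ h
    fun y => by rw [span_eigenclasses hp]; trivial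
  intro h hh
  choose k α hk hα hhα using hh
  obtain ⟨z, hz, hzh⟩ := AlgStr.exists_cocycle_reps hk
  have h0 := B.str.act_cocycle ha hd (fun y => (z y : B.space)) fun y => d_cocycle (z y)
  have h1 : B.str.cohAct a h ∈ B.space.hgr (p + ∑ y, k y) := by
    rw [hzh, B.str.cohAct_cls ha hd z ⟨_, h0⟩ rfl]
    exact mem_hgr_cls (B.str.act_mem p k a _ ha hz)
  have h2 := multilinear_mem_maxGenEigenspace' (B.str.cohAct a) F.onCohomology F.onCohomology
    (cohAct_onCohomology F ha hd) α h hhα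
  -- The result has degree `p + ∑ k` but eigenvalue of absolute value `ξ ^ (∑ k)`, which purity
  -- forbids for `p ≠ 0`.
  rw [← GradedPure.inf_maxGenEigenspace_eq_bot hp (n := p + ∑ y, k y) (α := ∏ y, α y)]
  · exact ⟨h1, h2⟩
  · rw [norm_prod_eq_rpow hξ hα]
    intro h
    have := weight_injective hξ hξ1 h
    omega

/-- A cocycle of `O` need not be homogeneous. Its components are cocycles, and those of nonzero
degree act by zero on pure cohomology, so the full action on representatives equals the action of
the component of degree zero. -/
theorem isInduced_of_isPure (hO : O.IsNonpositive) (hξ : 0 < ξ) (hξ1 : ξ ≠ 1)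
    (hp : IsPure ξ 0 B.space F.toHom) : B.IsInduced (B.str.induced hO) where
  act_cls {n} a had v w hw := by
    have had : (O.space n).d a = 0 := had
    change B.str.inducedAct a (fun y => B.space.cls (v y)) = B.space.cls w
    obtain ⟨s, hs⟩ := (O.space n).proj_sum a
    have hpd : ∀ i, (O.space n).d ((O.space n).proj i a) = 0 := fun i => by
      rw [← (O.space n).proj_d, had, map_zero]
    have hc : ∀ i, B.space.d (B.str.act ((O.space n).proj i a) fun y => (v y : B.space)) = 0 :=
      fun i => B.str.act_cocycle ((O.space n).proj_mem i a) (hpd i) _ fun y => d_cocycle (v y)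
    have hwz : w = ∑ i ∈ s, ⟨_, hc i⟩ := by
      refine Subtype.ext ?_
      rw [hw, AddSubmonoidClass.coe_finsetSum]
      conv_lhs => rw [hs, map_sum, sum_apply]
    rw [hwz, map_sum]
    conv_lhs => rw [hs, map_sum, sum_apply]
    refine Finset.sum_congr rfl fun i _ => ?_
    rw [← B.str.cohAct_cls ((O.space n).proj_mem i a) (hpd i) v ⟨_, hc i⟩ rfl]
    by_cases hi : i = 0
    · subst hi
      rw [B.str.inducedAct_of_zero ((O.space n).proj_mem 0 a)]
    · rw [B.str.inducedAct_of_ne_zero hi ((O.space n).proj_mem i a),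
        cohAct_eq_zero hξ hξ1 hp hi ((O.space n).proj_mem i a) (hpd i)]
  act_neg {n} p a hp ha := B.str.inducedAct_of_ne_zero hp.ne ha

end Induced

end Alg

/-! ### Polynomial families -/

namespace DGSpace

variable (V : DGSpace.{u})

/-- The complex `V[t]` of polynomials with coefficients in `V`. -/
def poly : DGSpace.{u} where
  -- Finitely supported functions with a constant fibre: in this form multilinear maps are
  -- determined by arbitrary data on tuples of monomials through `MultilinearMap.fromDFinsuppEquiv`.
  carrier := Π₀ _ : ℕ, V.carrier
  gr i :=
    { carrier := {f | ∀ j, f j ∈ V.gr i}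
      zero_mem' := fun _ => Submodule.zero_mem _
      add_mem' := fun hf hg j => Submodule.add_mem _ (hf j) (hg j)
      smul_mem' := fun c _ hf j => Submodule.smul_mem _ c (hf j) }
  isInternal := by
    rw [DirectSum.isInternal_submodule_iff_iSupIndep_and_iSup_eq_top]
    constructor
    · refine iSupIndep_of_proj _ (fun i => DFinsupp.mapRange.linearMap fun _ => V.proj i) ?_ ?_
      · intro i f hf
        ext j
        exact V.proj_same i _ (hf j)
      · intro i i' h f hf
        ext j
        exact V.proj_ne h _ (hf j)
    · rw [eq_top_iff]
      rintro f -
      induction f using DFinsupp.induction with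
      | h0 => exact Submodule.zero_mem _
      | ha j v f _ hv hf =>
        clear hv
        refine Submodule.add_mem _ ?_ hf
        induction v using V.proj_induction with
        | h0 => rw [DFinsupp.single_zero]; exact Submodule.zero_mem _
        | hadd x y hx hy => rw [DFinsupp.single_add]; exact Submodule.add_mem _ hx hy
        | hm i x hx =>
          refine Submodule.mem_iSup_of_mem i fun j' => ?_
          by_cases h : j = j'
          · subst h; rwa [DFinsupp.single_eq_same]
          · rw [DFinsupp.single_eq_of_ne (Ne.symm h)]; exact Submodule.zero_mem _
  d := DFinsupp.mapRange.linearMap fun _ => V.d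
  d_mem i f hf j := V.d_mem i _ (hf j)
  d_d f := by
    ext j
    exact V.d_d _

/-- The monomial `v t^j`. -/
def monomial (j : ℕ) : V →ₗ[ℂ] V.poly :=
  DFinsupp.lsingle (M := fun _ : ℕ => V.carrier) j

variable {V}

theorem poly_hom_ext {M : Type*} [AddCommGroup M] [Module ℂ M] {f g : V.poly →ₗ[ℂ] M}
    (h : ∀ j v, f (V.monomial j v) = g (V.monomial j v)) : f = g :=
  DFinsupp.lhom_ext h

theorem monomial_mem (j : ℕ) {i : ℤ} {v : V} (hv : v ∈ V.gr i) : V.monomial j v ∈ V.poly.gr i := by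
  intro j'
  change (DFinsupp.single j v : Π₀ _ : ℕ, V.carrier) j' ∈ V.gr i
  by_cases h : j = j'
  · subst h; rwa [DFinsupp.single_eq_same]
  · rw [DFinsupp.single_eq_of_ne (Ne.symm h)]; exact Submodule.zero_mem _

theorem poly_d_monomial (j : ℕ) (v : V) : V.poly.d (V.monomial j v) = V.monomial j (V.d v) :=
  DFinsupp.mapRange_single (hf := fun _ => map_zero V.d)

/-- A linear map on `V[t]`, given on monomials. -/
def polyLift {M : Type u} [AddCommGroup M] [Module ℂ M] (f : ℕ → V →ₗ[ℂ] M) : V.poly →ₗ[ℂ] M :=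
  DFinsupp.lsum ℂ f

theorem polyLift_monomial {M : Type u} [AddCommGroup M] [Module ℂ M] (f : ℕ → V →ₗ[ℂ] M) (j : ℕ)
    (v : V) : polyLift f (V.monomial j v) = f j v :=
  DFinsupp.lsum_single ..

theorem polyLift_mem {M : Type u} [AddCommGroup M] [Module ℂ M] (f : ℕ → V →ₗ[ℂ] M)
    (Z : Submodule ℂ M) {i : ℤ} (h : ∀ j, ∀ v ∈ V.gr i, f j v ∈ Z) {x : V.poly}
    (hx : x ∈ V.poly.gr i) : polyLift f x ∈ Z := by
  classical
  let x' : Π₀ _ : ℕ, V.carrier := x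
  change DFinsupp.lsum ℂ f x' ∈ Z
  rw [DFinsupp.lsum_apply_apply, DFinsupp.sumAddHom_apply]
  exact Submodule.sum_mem _ fun j _ => h j _ (hx j)

theorem mem_span_monomial {i : ℤ} {x : V.poly} (hx : x ∈ V.poly.gr i) :
    x ∈ Submodule.span ℂ {x | ∃ j, ∃ v ∈ V.gr i, x = V.monomial j v} := by
  have e : polyLift V.monomial = LinearMap.id := poly_hom_ext fun j v => polyLift_monomial ..
  have := polyLift_mem V.monomial (Submodule.span ℂ {x | ∃ j, ∃ v ∈ V.gr i, x = V.monomial j v})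
    (fun j v hv => Submodule.subset_span ⟨j, v, hv, rfl⟩) hx
  rwa [e] at this

variable (V)

/-- The evaluation at `t`. -/
def ev (t : ℂ) : Hom V.poly V where
  lin := polyLift fun j => t ^ j • LinearMap.id
  map_mem i x hx := polyLift_mem _ _ (fun j v hv => Submodule.smul_mem _ _ hv) hx
  map_d x := by
    refine LinearMap.congr_fun (f := polyLift (fun j => t ^ j • LinearMap.id) ∘ₗ V.poly.d)
      (g := V.d ∘ₗ polyLift fun j => t ^ j • LinearMap.id) (poly_hom_ext fun j v => ?_) x
    simp only [LinearMap.comp_apply, poly_d_monomial, polyLift_monomial, LinearMap.smul_apply,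
      LinearMap.id_apply, map_smul]

/-- The derivative with respect to `t`. -/
def deriv : Hom V.poly V.poly where
  -- For `j = 0` the truncated exponent `j - 1` is harmless, as the coefficient is zero.
  lin := polyLift fun j => (j : ℂ) • V.monomial (j - 1)
  map_mem i x hx := polyLift_mem _ _
    (fun j v hv => Submodule.smul_mem _ _ (monomial_mem _ hv)) hx
  map_d x := by
    refine LinearMap.congr_fun (f := polyLift (fun j => (j : ℂ) • V.monomial (j - 1)) ∘ₗ V.poly.d)
      (g := V.poly.d ∘ₗ polyLift fun j => (j : ℂ) • V.monomial (j - 1))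
      (poly_hom_ext fun j v => ?_) x
    simp only [LinearMap.comp_apply, poly_d_monomial, polyLift_monomial, LinearMap.smul_apply,
      map_smul]

/-- The integral from `0` to `t`. -/
def integral : V.poly →ₗ[ℂ] V.poly := polyLift fun j => ((j : ℂ) + 1)⁻¹ • V.monomial (j + 1)

variable {V}

theorem ev_monomial (t : ℂ) (j : ℕ) (v : V) : (V.ev t).lin (V.monomial j v) = t ^ j • v :=
  polyLift_monomial ..

theorem deriv_monomial (j : ℕ) (v : V) :
    V.deriv.lin (V.monomial j v) = (j : ℂ) • V.monomial (j - 1) v :=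
  polyLift_monomial ..

theorem integral_monomial (j : ℕ) (v : V) :
    V.integral (V.monomial j v) = ((j : ℂ) + 1)⁻¹ • V.monomial (j + 1) v :=
  polyLift_monomial ..

theorem integral_mem {i : ℤ} {x : V.poly} (hx : x ∈ V.poly.gr i) : V.integral x ∈ V.poly.gr i :=
  polyLift_mem _ _ (fun _ _ hv => Submodule.smul_mem _ _ (monomial_mem _ hv)) hx

theorem deriv_integral (x : V.poly) : V.deriv.lin (V.integral x) = x := by
  refine LinearMap.congr_fun (f := V.deriv.lin ∘ₗ V.integral) (g := LinearMap.id)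
    (poly_hom_ext fun j v => ?_) x
  have : (j : ℂ) + 1 ≠ 0 := Nat.cast_add_one_ne_zero j
  simp only [LinearMap.comp_apply, integral_monomial, map_smul, deriv_monomial, smul_smul,
    Nat.add_sub_cancel, LinearMap.id_apply, Nat.cast_add, Nat.cast_one]
  rw [inv_mul_cancel₀ this, one_smul]

theorem ev_zero_integral (x : V.poly) : (V.ev 0).lin (V.integral x) = 0 := by
  refine LinearMap.congr_fun (f := (V.ev 0).lin ∘ₗ V.integral) (g := 0)
    (poly_hom_ext fun j v => ?_) x
  simp [integral_monomial, ev_monomial]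

theorem integral_deriv (x : V.poly) :
    V.integral (V.deriv.lin x) = x - V.monomial 0 ((V.ev 0).lin x) := by
  refine LinearMap.congr_fun (f := V.integral ∘ₗ V.deriv.lin)
    (g := LinearMap.id - V.monomial 0 ∘ₗ (V.ev 0).lin) (poly_hom_ext fun j v => ?_) x
  simp only [LinearMap.comp_apply, LinearMap.sub_apply, deriv_monomial, ev_monomial, map_smul,
    integral_monomial, LinearMap.id_apply]
  cases j with
  | zero => simp
  | succ j =>
    have : (j : ℂ) + 1 ≠ 0 := Nat.cast_add_one_ne_zero j
    simp [smul_smul, this]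

theorem eq_of_deriv_eq_zero {x : V.poly} (h : V.deriv.lin x = 0) :
    x = V.monomial 0 ((V.ev 0).lin x) := by
  have := integral_deriv x
  rw [h, map_zero, eq_comm, sub_eq_zero] at this
  exact this

theorem ev_const (t : ℂ) (v : V) : (V.ev t).lin (V.monomial 0 v) = v := by
  rw [ev_monomial, pow_zero, one_smul]

theorem deriv_const (v : V) : V.deriv.lin (V.monomial 0 v) = 0 := by
  rw [deriv_monomial, Nat.cast_zero, zero_smul]

/-- Applying a linear functional to the coefficients reduces to polynomials over the infinite field
`ℂ`, and functionals separate points. This lets the algebra axioms for `A[t]` be checked after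
evaluation at every `t`. -/
theorem ev_injective {x y : V.poly} (h : ∀ t, (V.ev t).lin x = (V.ev t).lin y) : x = y := by
  classical
  rw [← sub_eq_zero]
  set z := x - y with hz
  have hz0 : ∀ t, (V.ev t).lin z = 0 := fun t => by rw [hz, map_sub, h, sub_self]
  let z' : Π₀ _ : ℕ, V.carrier := z
  have hsum : ∀ t, (V.ev t).lin z = ∑ j ∈ z'.support, t ^ j • z' j := fun t => by
    change DFinsupp.lsum ℂ (fun j => t ^ j • LinearMap.id) z' = _
    rw [DFinsupp.lsum_apply_apply, DFinsupp.sumAddHom_apply]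
    rfl
  refine DFinsupp.ext (β := fun _ : ℕ => V.carrier) (f := z') (g := 0) fun j => ?_
  rw [DFinsupp.zero_apply, ← Module.forall_dual_apply_eq_zero_iff ℂ]
  intro φ
  let P : Polynomial ℂ := ∑ j ∈ z'.support, Polynomial.monomial j (φ (z' j))
  have hP : P = 0 := by
    refine Polynomial.funext fun t => ?_
    have := congrArg φ ((hsum t).symm.trans (hz0 t))
    rw [map_sum, map_zero] at this
    rw [Polynomial.eval_zero, Polynomial.eval_finsetSum, ← this]
    refine Finset.sum_congr rfl fun j _ => ?_
    rw [Polynomial.eval_monomial, map_smul, smul_eq_mul, mul_comm]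
  have hc := congrArg (fun P => Polynomial.coeff P j) hP
  simp only [P, Polynomial.finsetSum_coeff, Polynomial.coeff_monomial, Polynomial.coeff_zero,
    Finset.sum_ite_eq'] at hc
  by_cases hj : j ∈ z'.support
  · rwa [if_pos hj] at hc
  · rw [DFinsupp.notMem_support_iff.1 hj, map_zero]

end DGSpace

namespace AlgStr

open DGSpace

variable {O : DGOperad.{u}} {V : DGSpace.{u}} (s : AlgStr O V)

/-- The operations on polynomials. -/
def polyAct (n : ℕ) : O.space n →ₗ[ℂ] MultilinearMap ℂ (fun _ : Fin n => V.poly.carrier)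
    V.poly.carrier :=
  (MultilinearMap.fromDFinsuppEquiv (fun _ : Fin n => ℕ) ℂ (M := fun _ _ => V.carrier)
    (N := V.poly.carrier)).toLinearMap ∘ₗ
    LinearMap.pi fun r => LinearMap.compMultilinearMapₗ ℂ (V.monomial (∑ y, r y)) ∘ₗ s.act

theorem polyAct_monomial {n : ℕ} (a : O.space n) (r : Fin n → ℕ) (v : Fin n → V) :
    s.polyAct n a (fun y => V.monomial (r y) (v y)) = V.monomial (∑ y, r y) (s.act a v) :=
  MultilinearMap.fromDFinsuppEquiv_single ..

theorem poly_multilinear_ext {n : ℕ} {M : Type*} [AddCommGroup M] [Module ℂ M]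
    {f g : MultilinearMap ℂ (fun _ : Fin n => V.poly.carrier) M}
    (h : ∀ (r : Fin n → ℕ) (v : Fin n → V), f (fun y => V.monomial (r y) (v y)) =
      g fun y => V.monomial (r y) (v y)) : f = g :=
  MultilinearMap.dfinsupp_ext (κ := fun _ : Fin n => ℕ) (M := fun _ _ => V.carrier) fun r =>
    MultilinearMap.ext fun v => h r v

theorem ev_polyAct {n : ℕ} (t : ℂ) (a : O.space n) (x : Fin n → V.poly) :
    (V.ev t).lin (s.polyAct n a x) = s.act a fun y => (V.ev t).lin (x y) := by
  have : (V.ev t).lin.compMultilinearMap (s.polyAct n a) =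
      (s.act a).compLinearMap fun _ => (V.ev t).lin := by
    refine poly_multilinear_ext fun r v => ?_
    simp only [LinearMap.compMultilinearMap_apply, MultilinearMap.compLinearMap_apply,
      polyAct_monomial, ev_monomial]
    rw [MultilinearMap.map_smul_univ, Finset.prod_pow_eq_pow_sum]
  exact congrArg (fun f => f x) this

/-- On monomials this is the identity that the total exponent is the sum of the exponents. No signs
occur, since differentiation with respect to `t` has degree zero. -/
theorem deriv_polyAct {n : ℕ} (a : O.space n) (x : Fin n → V.poly) :
    V.deriv.lin (s.polyAct n a x) =
      ∑ y, s.polyAct n a (Function.update x y (V.deriv.lin (x y))) := by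
  have : V.deriv.lin.compMultilinearMap (s.polyAct n a) =
      ∑ y, (s.polyAct n a).compLinearMap
        (Function.update (fun _ => LinearMap.id) y V.deriv.lin) := by
    refine poly_multilinear_ext fun r v => ?_
    simp only [LinearMap.compMultilinearMap_apply, sum_apply, MultilinearMap.compLinearMap_apply,
      polyAct_monomial, deriv_monomial]
    rw [Nat.cast_sum, Finset.sum_smul]
    refine Finset.sum_congr rfl fun y _ => ?_
    have e : (fun z => (Function.update (fun _ => LinearMap.id) y V.deriv.lin :
        Fin n → V.poly →ₗ[ℂ] V.poly) z (V.monomial (r z) (v z))) =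
        Function.update (fun z => V.monomial (Function.update r y (r y - 1) z) (v z)) y
          ((r y : ℂ) • V.monomial (Function.update r y (r y - 1) y) (v y)) := by
      funext z
      by_cases hz : z = y
      · subst hz; simp [deriv_monomial]
      · simp [hz]
    rw [e, MultilinearMap.map_update_smul, Function.update_eq_self, polyAct_monomial]
    by_cases hr : r y = 0
    · rw [hr, Nat.cast_zero, zero_smul, zero_smul]
    · congr 3
      rw [Finset.sum_update_of_mem (Finset.mem_univ y),
        ← Finset.add_sum_erase _ _ (Finset.mem_univ y), Finset.sdiff_singleton_eq_erase]
      omega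
  refine (congrArg (fun f => f x) this).trans ?_
  simp only [sum_apply, MultilinearMap.compLinearMap_apply]
  refine Finset.sum_congr rfl fun y _ => congrArg _ (funext fun z => ?_)
  by_cases hz : z = y
  · subst hz; simp
  · simp [hz]

end AlgStr

namespace Alg

open DGSpace AlgStr

variable {O : DGOperad.{u}}

/-- The `O`-algebra `A[t]`. -/
def poly (A : Alg O) : Alg O where
  space := A.space.poly
  str := AlgStr.ofJointlyInjective _ (fun _ : ℂ => A) A.space.ev (fun _ _ => ev_injective)
    (A.str.polyAct _) (fun t a v => A.str.ev_polyAct t a v) fun p k a x ha hx => by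
      refine multilinear_mem_of_mem_span (A.str.polyAct _ a)
        (fun y => {x | ∃ j, ∃ v ∈ A.space.gr (k y), x = A.space.monomial j v})
        (A.space.poly.gr _) ?_ x fun y => mem_span_monomial (hx y)
      intro x hx
      choose r v hv hxv using hx
      rw [funext hxv, polyAct_monomial]
      exact monomial_mem _ (A.str.act_mem p k a v ha hv)

end Alg

/-! ### Adjoining an odd element of square zero -/

section Signs

variable {l m n : ℕ}

/-- The sum of the degrees of the inputs behind the position `y`. -/
def degAfter (k : Fin n → ℤ) (y : Fin n) : ℤ := ∑ z : Fin n, if y < z then k z else 0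

theorem sum_update_sub (k : Fin n → ℤ) (z : Fin n) (c : ℤ) (P : Fin n → Prop) [DecidablePred P] :
    (∑ y, if P y then Function.update k z c y else 0) =
      (∑ y, if P y then k y else 0) + if P z then c - k z else 0 := by
  rw [← Finset.add_sum_erase _ _ (Finset.mem_univ z),
    ← Finset.add_sum_erase _ (fun y => if P y then k y else 0) (Finset.mem_univ z),
    Function.update_self, Finset.sum_congr (g := fun y => if P y then k y else 0) rfl]
  · split <;> ring
  · intro y hy
    rw [Function.update_of_ne (Finset.ne_of_mem_erase hy)]

theorem degBefore_update (k : Fin n → ℤ) (z : Fin n) (c : ℤ) (p : ℕ) :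
    degBefore (Function.update k z c) p = degBefore k p + if z.val < p then c - k z else 0 :=
  sum_update_sub k z c fun y => y.val < p

theorem degAfter_update (k : Fin n → ℤ) (z : Fin n) (c : ℤ) (y : Fin n) :
    degAfter (Function.update k z c) y = degAfter k y + if y < z then c - k z else 0 :=
  sum_update_sub k z c fun x => y < x

theorem sum_update (k : Fin n → ℤ) (z : Fin n) (c : ℤ) :
    ∑ y, Function.update k z c y = (∑ y, k y) + (c - k z) := by
  simpa using sum_update_sub k z c fun _ => True

theorem degBefore_add_degAfter (k : Fin n → ℤ) (y : Fin n) :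
    degBefore k y.val + k y + degAfter k y = ∑ z, k z := by
  have e : k y = ∑ z, if z = y then k z else 0 := by simp
  rw [degBefore, degAfter, e, ← Finset.sum_add_distrib, ← Finset.sum_add_distrib]
  refine Finset.sum_congr rfl fun z _ => ?_
  rcases lt_trichotomy z y with h | h | h
  · have h' : z.val < y.val := h
    simp [h', h.ne, h.not_gt]
  · subst h; simp
  · have h' : ¬ z.val < y.val := not_lt.2 h.le
    simp [h', h.ne', h]

theorem negOnePow_sum {ι : Type*} (s : Finset ι) (f : ι → ℤ) :
    (∑ i ∈ s, f i).negOnePow = ∏ i ∈ s, (f i).negOnePow := by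
  classical
  induction s using Finset.induction_on with
  | empty => simp
  | insert a s ha ih => rw [Finset.sum_insert ha, Finset.prod_insert ha, Int.negOnePow_add, ih]

theorem multilinear_map_sign_univ {ι M N : Type*} [Fintype ι] [AddCommGroup M] [Module ℂ M]
    [AddCommGroup N] [Module ℂ N] (f : MultilinearMap ℂ (fun _ : ι => M) N) (c : ι → ℤˣ)
    (v : ι → M) : (f fun i => c i • v i) = (∏ i, c i) • f v := by
  have h : ∀ (u : ℤˣ) (x : M), u • x = ((u : ℤ) : ℂ) • x := fun u x => by
    rw [Units.smul_def, Int.cast_smul_eq_zsmul]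
  have h' : ∀ (u : ℤˣ) (x : N), u • x = ((u : ℤ) : ℂ) • x := fun u x => by
    rw [Units.smul_def, Int.cast_smul_eq_zsmul]
  simp only [h]
  rw [f.map_smul_univ, h' (∏ i, c i), Units.coe_prod, Int.cast_prod]

/-- Write the `y`-th argument, of degree `k y`, as an element of degree `k y - 1` times `ε`.
Carrying `ε` to the right end before or after permuting gives the same sign: the exponents differ by
twice the sum over the inversions `i < y`, `σ y < σ i`. -/
theorem koszul_update (σ : Equiv.Perm (Fin n)) (k : Fin n → ℤ) (y : Fin n) :
    (degAfter k y).negOnePow * koszul σ (Function.update k y (k y - 1)) =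
      koszul σ k * (degAfter (k ∘ σ.symm) (σ y)).negOnePow := by
  have h1 : ∀ i j : Fin n, (if i < j ∧ σ j < σ i then
      Function.update k y (k y - 1) i * Function.update k y (k y - 1) j else 0) =
      (if i < j ∧ σ j < σ i then k i * k j else 0) -
        (if i = y then (if y < j ∧ σ j < σ y then k j else 0) else 0) -
        (if j = y then (if i < y ∧ σ y < σ i then k i else 0) else 0) := by
    intro i j
    by_cases hi : i = y
    · subst hi
      by_cases hj : j = i
      · subst hj; simp
      · simp only [Function.update_self, Function.update_of_ne hj, if_true, hj, if_false]
        split <;> ring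
    · by_cases hj : j = y
      · subst hj
        simp only [Function.update_self, Function.update_of_ne hi, if_true, hi, if_false]
        split <;> ring
      · simp [hi, hj]
  have h2 : (∑ i : Fin n, ∑ j : Fin n, if i < j ∧ σ j < σ i then
      Function.update k y (k y - 1) i * Function.update k y (k y - 1) j else 0) =
      (∑ i : Fin n, ∑ j : Fin n, if i < j ∧ σ j < σ i then k i * k j else 0) -
        (∑ j, if y < j ∧ σ j < σ y then k j else 0) -
        ∑ i, if i < y ∧ σ y < σ i then k i else 0 := by
    simp only [h1, Finset.sum_sub_distrib]
    congr 1
    · congr 1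
      rw [Finset.sum_comm]
      simp
    · simp
  have h3 : degAfter (k ∘ σ.symm) (σ y) = ∑ j, if σ y < σ j then k j else 0 := by
    rw [degAfter, ← Equiv.sum_comp σ]
    simp
  have h4 : degAfter k y = (∑ j, if y < j ∧ σ j < σ y then k j else 0) +
      (∑ j, if σ y < σ j then k j else 0) - ∑ i, if i < y ∧ σ y < σ i then k i else 0 := by
    rw [degAfter, ← Finset.sum_add_distrib, ← Finset.sum_sub_distrib]
    refine Finset.sum_congr rfl fun j _ => ?_
    rcases lt_trichotomy y j with h | h | h
    · rcases lt_trichotomy (σ y) (σ j) with h' | h' | h'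
      · simp [h, h', h.not_gt, h'.not_gt]
      · exact absurd (σ.injective h') h.ne
      · simp [h, h', h.not_gt, h'.not_gt]
    · subst h; simp
    · by_cases h' : σ y < σ j
      · simp [h, h', h.not_gt]
      · simp [h', h.not_gt]
  rw [koszul, koszul, ← Int.negOnePow_add, ← Int.negOnePow_add, Int.negOnePow_eq_iff, h2, h3, h4]
  exact ⟨-∑ i, if i < y ∧ σ y < σ i then k i else 0, by ring⟩

theorem sum_position (h : n + 1 = l + m) (i : Fin l) {M : Type*} [AddCommMonoid M]
    (f : Fin n → M) : ∑ y, f y =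
      (∑ x, f (innerPos h i x)) + ∑ j : {j : Fin l // j ≠ i}, f (outerPos h i j.1 j.2) := by
  rw [← (position h i).sum_comp, Fintype.sum_sum_type]
  rfl

theorem outerPos_lt_innerPos (h : n + 1 = l + m) (i j : Fin l) (hj : j ≠ i) (x : Fin m) :
    outerPos h i j hj < innerPos h i x ↔ j < i := by
  have hji : j.val ≠ i.val := fun e => hj (Fin.ext e)
  have := x.isLt
  rw [Fin.lt_def, Fin.lt_def]
  simp only [outerPos, innerPos]
  split <;> omega

theorem innerPos_lt_outerPos (h : n + 1 = l + m) (i j : Fin l) (hj : j ≠ i) (x : Fin m) :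
    innerPos h i x < outerPos h i j hj ↔ i < j := by
  have hji : j.val ≠ i.val := fun e => hj (Fin.ext e)
  have := x.isLt
  rw [Fin.lt_def, Fin.lt_def]
  simp only [outerPos, innerPos]
  split <;> omega

theorem outerPos_lt_outerPos (h : n + 1 = l + m) (i j j' : Fin l) (hj : j ≠ i) (hj' : j' ≠ i) :
    outerPos h i j hj < outerPos h i j' hj' ↔ j < j' := by
  have hji : j.val ≠ i.val := fun e => hj (Fin.ext e)
  have hji' : j'.val ≠ i.val := fun e => hj' (Fin.ext e)
  rw [Fin.lt_def, Fin.lt_def]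
  simp only [outerPos]
  split <;> split <;> omega

theorem innerPos_lt_innerPos (h : n + 1 = l + m) (i : Fin l) (x x' : Fin m) :
    innerPos h i x < innerPos h i x' ↔ x < x' := by
  rw [Fin.lt_def, Fin.lt_def]
  simp only [innerPos]
  omega

theorem innerPos_ne_outerPos (h : n + 1 = l + m) (i j : Fin l) (hj : j ≠ i) (x : Fin m) :
    innerPos h i x ≠ outerPos h i j hj := fun e => by
  have := (position h i).injective.ne (Sum.inl_ne_inr (a := x) (b := ⟨j, hj⟩))
  exact this e

theorem innerPos_injective (h : n + 1 = l + m) (i : Fin l) : Function.Injective (innerPos h i) :=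
  fun x x' e => Sum.inl_injective ((position h i).injective (a₁ := Sum.inl x) (a₂ := Sum.inl x') e)

theorem outerPos_inj (h : n + 1 = l + m) (i j j' : Fin l) (hj : j ≠ i) (hj' : j' ≠ i) :
    outerPos h i j hj = outerPos h i j' hj' ↔ j = j' := by
  constructor
  · intro e
    have := Sum.inr_injective ((position h i).injective (a₁ := Sum.inr ⟨j, hj⟩)
      (a₂ := Sum.inr ⟨j', hj'⟩) e)
    exact congrArg Subtype.val this
  · rintro rfl; rfl

/-- The degrees of the arguments of the outer operation in a composite. -/
def plugDeg (h : n + 1 = l + m) (i : Fin l) (k : Fin n → ℤ) (q : ℤ) : Fin l → ℤ :=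
  fun j => if hj : j = i then q + ∑ x, k (innerPos h i x) else k (outerPos h i j hj)

theorem plugDeg_self (h : n + 1 = l + m) (i : Fin l) (k : Fin n → ℤ) (q : ℤ) :
    plugDeg h i k q i = q + ∑ x, k (innerPos h i x) := dif_pos rfl

theorem plugDeg_of_ne (h : n + 1 = l + m) (i : Fin l) (k : Fin n → ℤ) (q : ℤ) {j : Fin l}
    (hj : j ≠ i) : plugDeg h i k q j = k (outerPos h i j hj) := dif_neg hj

/-- When `ε` moves right from an outer slot `j < i`, it also passes the inner operation, of degree
`q`; this is the extra sign compared with the flat list of inputs. -/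
theorem degAfter_plugDeg_of_ne (h : n + 1 = l + m) (i : Fin l) (k : Fin n → ℤ) (q : ℤ) {j : Fin l}
    (hj : j ≠ i) : degAfter (plugDeg h i k q) j =
      degAfter k (outerPos h i j hj) + if j < i then q else 0 := by
  rw [degAfter, degAfter, Fintype.sum_eq_add_sum_subtype_ne _ i, sum_position h i, plugDeg_self]
  have e1 : ∀ x, (if outerPos h i j hj < innerPos h i x then k (innerPos h i x) else 0) =
      if j < i then k (innerPos h i x) else 0 := fun x => by
    simp only [outerPos_lt_innerPos]
  have e2 : ∀ j' : {j' : Fin l // j' ≠ i}, (if j < j'.1 then plugDeg h i k q j'.1 else 0) =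
      if outerPos h i j hj < outerPos h i j'.1 j'.2 then k (outerPos h i j'.1 j'.2) else 0 :=
    fun j' => by simp only [outerPos_lt_outerPos, plugDeg_of_ne h i k q j'.2]
  simp only [e1, e2]
  split
  · ring
  · simp

theorem degAfter_innerPos (h : n + 1 = l + m) (i : Fin l) (k : Fin n → ℤ) (q : ℤ) (x : Fin m) :
    degAfter k (innerPos h i x) =
      degAfter (k ∘ innerPos h i) x + degAfter (plugDeg h i k q) i := by
  rw [degAfter, degAfter, degAfter, Fintype.sum_eq_add_sum_subtype_ne _ i, sum_position h i]
  have e1 : ∀ x', (if innerPos h i x < innerPos h i x' then k (innerPos h i x') else 0) =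
      if x < x' then (k ∘ innerPos h i) x' else 0 := fun x' => by
    simp only [innerPos_lt_innerPos, Function.comp_apply]
  have e2 : ∀ j' : {j' : Fin l // j' ≠ i}, (if i < j'.1 then plugDeg h i k q j'.1 else 0) =
      if innerPos h i x < outerPos h i j'.1 j'.2 then k (outerPos h i j'.1 j'.2) else 0 :=
    fun j' => by simp only [innerPos_lt_outerPos, plugDeg_of_ne h i k q j'.2]
  simp only [e1, e2, lt_self_iff_false, if_false, zero_add]

theorem plug_update_outerPos {X : Type u} (h : n + 1 = l + m) (i : Fin l) (v : Fin n → X) (w c : X)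
    {j : Fin l} (hj : j ≠ i) : plug h i (Function.update v (outerPos h i j hj) c) w =
      Function.update (plug h i v w) j c := by
  funext j'
  by_cases e : j' = i
  · subst e
    rw [Function.update_of_ne (Ne.symm hj)]
    simp [plug]
  · by_cases e' : j' = j
    · subst e'
      simp [plug, e]
    · rw [Function.update_of_ne e']
      simp only [plug, e, dif_neg, not_false_eq_true]
      rw [Function.update_of_ne]
      rwa [Ne, outerPos_inj]

theorem plug_update_innerPos {X : Type u} (h : n + 1 = l + m) (i : Fin l) (v : Fin n → X)
    (w w' c : X) (x : Fin m) : plug h i (Function.update v (innerPos h i x) c) w =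
      Function.update (plug h i v w') i w := by
  funext j'
  by_cases e : j' = i
  · subst e
    simp [plug]
  · rw [Function.update_of_ne e]
    simp only [plug, e, dif_neg, not_false_eq_true]
    rw [Function.update_of_ne]
    exact (innerPos_ne_outerPos h i j' e x).symm

theorem update_outerPos_comp_innerPos {X : Type u} (h : n + 1 = l + m) (i : Fin l) (v : Fin n → X)
    (c : X) {j : Fin l} (hj : j ≠ i) :
    Function.update v (outerPos h i j hj) c ∘ innerPos h i = v ∘ innerPos h i := by
  funext x
  exact Function.update_of_ne (innerPos_ne_outerPos h i j hj x) _ _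

theorem update_innerPos_comp_innerPos {X : Type u} (h : n + 1 = l + m) (i : Fin l) (v : Fin n → X)
    (c : X) (x : Fin m) : Function.update v (innerPos h i x) c ∘ innerPos h i =
      Function.update (v ∘ innerPos h i) x c :=
  Function.update_comp_eq_of_injective _ (innerPos_injective h i) _ _

end Signs

/-! ### The complex `V ⊕ V ε`, whose differential sends `x` to `d x` plus, up to the parity sign of
`x`, `θ x` times `ε`. -/

namespace DGSpace

variable (V : DGSpace.{u})

/-- The parity involution. -/
def parity : V →ₗ[ℂ] V :=
  letI := V.isInternal.chooseDecomposition
  DirectSum.toModule ℂ ℤ V (fun i => i.negOnePow • (V.gr i).subtype) ∘ₗ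
    (DirectSum.decomposeLinearEquiv V.gr).toLinearMap

variable {V}

theorem parity_apply {i : ℤ} {x : V} (hx : x ∈ V.gr i) : V.parity x = i.negOnePow • x := by
  let _ := V.isInternal.chooseDecomposition
  change DirectSum.toModule ℂ ℤ V (fun i => i.negOnePow • (V.gr i).subtype)
    (DirectSum.decompose V.gr x) = _
  rw [DirectSum.decompose_of_mem V.gr hx]
  exact DirectSum.toModule_lof ℂ i _

theorem parity_mem {i : ℤ} {x : V} (hx : x ∈ V.gr i) : V.parity x ∈ V.gr i := by
  rw [parity_apply hx]
  exact sign_mem _ _ hx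

/-- The differential is odd, so it anticommutes with the parity involution. This makes the twisted
differential square to zero. -/
theorem d_parity (x : V) : V.d (V.parity x) = -V.parity (V.d x) := by
  induction x using V.proj_induction with
  | h0 => simp
  | hadd x y hx hy => simp only [map_add, hx, hy, neg_add]
  | hm i x hx =>
    rw [parity_apply hx, parity_apply (V.d_mem i x hx), map_sign, Int.negOnePow_succ, Units.smul_def,
      Units.smul_def, Units.val_neg, neg_smul, neg_neg]

variable (V) in
/-- The differential of `V ⊕ V ε`. -/
def epsD (θ : Hom V V) : V.carrier × V.carrier →ₗ[ℂ] V.carrier × V.carrier :=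
  (V.d ∘ₗ LinearMap.fst ℂ _ _).prod
    (V.d ∘ₗ LinearMap.snd ℂ _ _ + V.parity ∘ₗ θ.lin ∘ₗ LinearMap.fst ℂ _ _)

variable (V) in
/-- The complex `V ⊕ V ε` with `ε` of degree one, and the differential twisted by `θ`. -/
def eps (θ : Hom V V) : DGSpace.{u} where
  carrier := V.carrier × V.carrier
  gr i := (V.gr i).prod (V.gr (i - 1))
  isInternal := by
    rw [DirectSum.isInternal_submodule_iff_iSupIndep_and_iSup_eq_top]
    constructor
    · refine iSupIndep_of_proj _ (fun i => (V.proj i).prodMap (V.proj (i - 1))) ?_ ?_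
      · rintro i ⟨x, y⟩ ⟨hx, hy⟩
        exact Prod.ext (V.proj_same i _ hx) (V.proj_same _ _ hy)
      · rintro i j h ⟨x, y⟩ ⟨hx, hy⟩
        exact Prod.ext (V.proj_ne h _ hx) (V.proj_ne (by omega) _ hy)
    · rw [eq_top_iff]
      rintro ⟨x, y⟩ -
      have e : ((x, y) : V.carrier × V.carrier) = LinearMap.inl ℂ V.carrier V.carrier x +
          LinearMap.inr ℂ V.carrier V.carrier y := by simp
      rw [e]
      refine Submodule.add_mem _ ?_ ?_
      · clear e
        induction x using V.proj_induction with
        | h0 => rw [map_zero]; exact Submodule.zero_mem _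
        | hadd x y hx hy =>
          rw [map_add]
          exact Submodule.add_mem _ hx hy
        | hm i x hx => exact Submodule.mem_iSup_of_mem i ⟨hx, Submodule.zero_mem _⟩
      · clear e
        induction y using V.proj_induction with
        | h0 => rw [map_zero]; exact Submodule.zero_mem _
        | hadd x y hx hy => rw [map_add]; exact Submodule.add_mem _ hx hy
        | hm i x hx =>
          refine Submodule.mem_iSup_of_mem (i + 1) ⟨Submodule.zero_mem _, ?_⟩
          rwa [add_sub_cancel_right]
  d := V.epsD θ
  d_mem := by
    rintro i ⟨x, y⟩ ⟨hx, hy⟩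
    refine ⟨V.d_mem i x hx, Submodule.add_mem _ ?_ ?_⟩
    · have := V.d_mem _ _ hy
      rwa [show i - 1 + 1 = i + 1 - 1 by ring] at this
    · rw [add_sub_cancel_right]
      exact parity_mem (θ.map_mem i x hx)
  d_d := by
    rintro ⟨x, y⟩
    refine Prod.ext (V.d_d x) ?_
    change V.d (V.d y + V.parity (θ.lin x)) + V.parity (θ.lin (V.d x)) = 0
    rw [map_add, V.d_d, d_parity, θ.map_d, zero_add, neg_add_cancel]

end DGSpace

/-! ### The operations on `V ⊕ V ε`: at most one argument carries `ε`. -/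

namespace AlgStr

open DGSpace

variable {O : DGOperad.{u}} {V : DGSpace.{u}} (s : AlgStr O V)

/-- The operations on `V ⊕ V ε`. -/
def epsAct (n : ℕ) : O.space n →ₗ[ℂ] MultilinearMap ℂ (fun _ : Fin n => V.carrier × V.carrier)
    (V.carrier × V.carrier) :=
  LinearMap.compMultilinearMapₗ ℂ (LinearMap.inl ℂ V.carrier V.carrier) ∘ₗ
      MultilinearMap.compLinearMapₗ (fun _ => LinearMap.fst ℂ V.carrier V.carrier) ∘ₗ s.act +
    LinearMap.compMultilinearMapₗ ℂ (LinearMap.inr ℂ V.carrier V.carrier) ∘ₗ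
      ∑ y : Fin n, MultilinearMap.compLinearMapₗ (fun z =>
        if z = y then LinearMap.snd ℂ V.carrier V.carrier
        else if y < z then V.parity ∘ₗ LinearMap.fst ℂ V.carrier V.carrier
        else LinearMap.fst ℂ V.carrier V.carrier) ∘ₗ s.act

theorem epsAct_fst {n : ℕ} (a : O.space n) (v : Fin n → V.carrier × V.carrier) :
    (s.epsAct n a v).1 = s.act a fun y => (v y).1 := by
  simp [epsAct, Prod.fst_sum]

theorem epsAct_snd_eq {n : ℕ} (a : O.space n) (v : Fin n → V.carrier × V.carrier) :
    (s.epsAct n a v).2 = ∑ y : Fin n, s.act a (fun z =>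
      (if z = y then LinearMap.snd ℂ V.carrier V.carrier
      else if y < z then V.parity ∘ₗ LinearMap.fst ℂ V.carrier V.carrier
      else LinearMap.fst ℂ V.carrier V.carrier) (v z)) := by
  simp [epsAct, Prod.snd_sum]

/-- The sign is that of moving `ε` past all arguments behind the position `y`. Using the parity map
in the definition keeps the operation linear, and the explicit sign appears on homogeneous
arguments. -/
theorem epsAct_snd {n : ℕ} (a : O.space n) {k : Fin n → ℤ} {v : Fin n → V.carrier × V.carrier}
    (hv : ∀ y, (v y).1 ∈ V.gr (k y)) : (s.epsAct n a v).2 =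
      ∑ y, (degAfter k y).negOnePow • s.act a (Function.update (fun z => (v z).1) y (v y).2) := by
  rw [epsAct_snd_eq]
  refine Finset.sum_congr rfl fun y _ => ?_
  rw [degAfter, negOnePow_sum, ← multilinear_map_sign_univ]
  congr 1
  funext z
  by_cases hz : z = y
  · subst hz; simp
  · rw [if_neg hz, Function.update_of_ne hz]
    split
    · exact parity_apply (hv z)
    · rw [Int.negOnePow_zero, one_smul]; rfl

theorem update_mem {n : ℕ} {k : Fin n → ℤ} {v : Fin n → V} (hv : ∀ y, v y ∈ V.gr (k y)) (y : Fin n)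
    {c : ℤ} {x : V} (hx : x ∈ V.gr c) (z : Fin n) :
    Function.update v y x z ∈ V.gr (Function.update k y c z) := by
  by_cases hz : z = y
  · subst hz; simpa using hx
  · simpa [hz] using hv z

variable {n : ℕ} {p : ℤ} {k : Fin n → ℤ} {v : Fin n → V.carrier × V.carrier}

theorem epsAct_mem (θ : Hom V V) (p : ℤ) (k : Fin n → ℤ) (a : O.space n)
    (v : Fin n → V.carrier × V.carrier) (ha : a ∈ (O.space n).gr p)
    (hv : ∀ y, v y ∈ (V.eps θ).gr (k y)) : s.epsAct n a v ∈ (V.eps θ).gr (p + ∑ y, k y) := by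
  constructor
  · change (s.epsAct n a v).1 ∈ V.gr (p + ∑ y, k y)
    rw [epsAct_fst]
    exact s.act_mem p k a _ ha fun y => (hv y).1
  · change (s.epsAct n a v).2 ∈ V.gr (p + ∑ y, k y - 1)
    rw [s.epsAct_snd a fun y => (hv y).1]
    refine Submodule.sum_mem _ fun y _ => sign_mem _ _ ?_
    have := s.act_mem p _ a _ ha (update_mem (fun y => (hv y).1) y (hv y).2)
    rwa [sum_update, show p + (∑ z, k z + (k y - 1 - k y)) = p + ∑ z, k z - 1 by ring] at this

theorem epsAct_one (v : Fin 1 → V.carrier × V.carrier) : s.epsAct 1 O.one v = v 0 := by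
  refine Prod.ext ?_ ?_
  · rw [epsAct_fst, s.act_one]
  · rw [epsAct_snd_eq, Fin.sum_univ_one, s.act_one]
    rfl

theorem epsAct_perm (θ : Hom V V) (σ : Equiv.Perm (Fin n)) (k : Fin n → ℤ) (a : O.space n)
    (v : Fin n → V.carrier × V.carrier) (hv : ∀ y, v y ∈ (V.eps θ).gr (k y)) :
    s.epsAct n (O.perm σ a) v = koszul σ k • s.epsAct n a (v ∘ σ.symm) := by
  refine Prod.ext ?_ ?_
  · change _ = koszul σ k • (s.epsAct n a (v ∘ σ.symm)).1
    rw [epsAct_fst, epsAct_fst, s.act_perm σ k a _ fun y => (hv y).1]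
    rfl
  · change _ = koszul σ k • (s.epsAct n a (v ∘ σ.symm)).2
    rw [s.epsAct_snd _ fun y => (hv y).1,
      s.epsAct_snd (k := k ∘ σ.symm) (v := v ∘ σ.symm) _ fun y => (hv (σ.symm y)).1, Finset.smul_sum]
    refine Fintype.sum_equiv σ _ _ fun y => ?_
    rw [s.act_perm σ _ a _ (update_mem (fun y => (hv y).1) y (hv y).2), smul_smul, smul_smul,
      koszul_update]
    congr 2
    funext z
    by_cases hz : z = σ y
    · subst hz; simp
    · have : σ.symm z ≠ y := fun e => hz (by rw [← e, σ.apply_symm_apply])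
      simp [hz, this]

theorem epsAct_comp (θ : Hom V V) {l m n : ℕ} (h : n + 1 = l + m) (i : Fin l) (q : ℤ)
    (k : Fin n → ℤ) (a : O.space l) (b : O.space m) (v : Fin n → V.carrier × V.carrier)
    (hb : b ∈ (O.space m).gr q) (hv : ∀ y, v y ∈ (V.eps θ).gr (k y)) :
    s.epsAct n (O.comp h i a b) v = (q * degBefore k i.val).negOnePow •
      s.epsAct l a (plug h i v (s.epsAct m b (v ∘ innerPos h i))) := by
  have hfst : (fun y => (plug h i v (s.epsAct m b (v ∘ innerPos h i)) y).1) =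
      plug h i (fun y => (v y).1) (s.act b fun x => (v (innerPos h i x)).1) := by
    rw [map_plug h i Prod.fst, epsAct_fst]
    rfl
  refine Prod.ext ?_ ?_
  · change _ = (q * degBefore k i.val).negOnePow • Prod.fst (s.epsAct l a _)
    rw [epsAct_fst, epsAct_fst, s.act_comp h i q k a b _ hb fun y => (hv y).1, hfst]
    rfl
  · change _ = (q * degBefore k i.val).negOnePow • Prod.snd (s.epsAct l a _)
    have hdeg : ∀ j, (plug h i v (s.epsAct m b (v ∘ innerPos h i)) j).1 ∈
        V.gr (plugDeg h i k q j) := by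
      intro j
      by_cases hj : j = i
      · subst hj
        rw [plugDeg_self]
        simp only [plug, dif_pos]
        exact (s.epsAct_mem θ q _ b _ hb fun x => hv (innerPos h j x)).1
      · rw [plugDeg_of_ne h i k q hj]
        simp only [plug, hj, dif_neg, not_false_eq_true]
        exact (hv _).1
    rw [s.epsAct_snd _ fun y => (hv y).1, s.epsAct_snd _ hdeg, hfst, sum_position h i,
      Fintype.sum_eq_add_sum_subtype_ne _ i, smul_add]
    congr 1
    · have hw : (plug h i v (s.epsAct m b (v ∘ innerPos h i)) i).2 =
          (s.epsAct m b (v ∘ innerPos h i)).2 := by simp [plug]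
      rw [hw, s.epsAct_snd (k := k ∘ innerPos h i) (v := v ∘ innerPos h i) _ fun x => (hv (innerPos h i x)).1,
        MultilinearMap.map_update_sum, Finset.smul_sum, Finset.smul_sum]
      refine Finset.sum_congr rfl fun x _ => ?_
      rw [s.act_comp h i q _ a b _ hb (update_mem (fun y => (hv y).1) _ (hv _).2),
        update_innerPos_comp_innerPos,
        plug_update_innerPos h i _ _ (s.act b fun x => (v (innerPos h i x)).1),
        degBefore_update, if_neg (by simp [innerPos]), add_zero,
        degAfter_innerPos h i k q x]
      have hs : ∀ (u : ℤˣ) (x : V), s.act a (Function.update (plug h i (fun y => (v y).1)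
          (s.act b fun x => (v (innerPos h i x)).1)) i (u • x)) =
          u • s.act a (Function.update (plug h i (fun y => (v y).1)
          (s.act b fun x => (v (innerPos h i x)).1)) i x) := fun u x =>
        map_sign ((s.act a).toLinearMap _ i) u x
      rw [hs, smul_smul, smul_smul, smul_smul, Int.negOnePow_add]
      congr 1
      ac_rfl
    · rw [Finset.smul_sum]
      refine Finset.sum_congr rfl fun j _ => ?_
      obtain ⟨j, hj⟩ := j
      have hji : j.val ≠ i.val := fun e => hj (Fin.ext e)
      have hw : (plug h i v (s.epsAct m b (v ∘ innerPos h i)) j).2 =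
          (v (outerPos h i j hj)).2 := by simp [plug, hj]
      rw [hw, s.act_comp h i q _ a b _ hb (update_mem (fun y => (hv y).1) _ (hv _).2),
        update_outerPos_comp_innerPos, plug_update_outerPos, smul_smul, smul_smul,
        ← Int.negOnePow_add, ← Int.negOnePow_add, degAfter_plugDeg_of_ne h i k q hj, degBefore_update]
      congr 1
      rw [Int.negOnePow_eq_iff]
      have hiff : (outerPos h i j hj).val < i.val ↔ j < i := by
        rw [Fin.lt_def]
        simp only [outerPos]
        split <;> omega
      by_cases hlt : j < i
      · rw [if_pos hlt, if_pos (hiff.2 hlt)]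
        exact ⟨-q, by ring⟩
      · rw [if_neg hlt, if_neg (fun e => hlt (hiff.1 e))]
        exact ⟨0, by ring⟩

/-- These are the terms in which the differential meets the argument that carries `ε`: it either
differentiates the coefficient of `ε`, or creates `ε` there by `θ`. The parity of the whole
expression splits into the degrees before, at and after the slot `y`. -/
theorem epsAct_d_diag (θ : Hom V V) (a : O.space n) (ha : a ∈ (O.space n).gr p) {f : Fin n → V}
    (hf : ∀ y, f y ∈ V.gr (k y)) (y : Fin n) (q : V) :
    (degAfter k y).negOnePow •
        (p + degBefore (Function.update k y (k y - 1)) y.val).negOnePow •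
          s.act a (Function.update (Function.update f y q) y
            (V.d (Function.update f y q y))) +
        V.parity (s.act a (Function.update f y (θ.lin (f y)))) =
      ((p + degBefore k y.val).negOnePow *
          (degAfter (Function.update k y (k y + 1)) y).negOnePow) •
        s.act a (Function.update (Function.update f y (V.d (f y))) y
          (V.d q + V.parity (θ.lin (f y)))) := by
  have hθ := θ.map_mem _ _ (hf y)
  have h := s.act_mem p _ a _ ha (update_mem hf y hθ)
  have hs : s.act a (Function.update f y (V.parity (θ.lin (f y)))) =
      (k y).negOnePow • s.act a (Function.update f y (θ.lin (f y))) := by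
    rw [parity_apply hθ]
    exact map_sign ((s.act a).toLinearMap f y) _ _
  rw [Function.update_eq_self] at h
  rw [Function.update_self, Function.update_idem, Function.update_idem, degBefore_update,
    degAfter_update, if_neg (lt_irrefl _), if_neg (lt_irrefl _), add_zero, add_zero,
    MultilinearMap.map_update_add, smul_add, smul_smul, parity_apply h, hs, smul_smul]
  congr 2
  · exact mul_comm _ _
  · rw [← Int.negOnePow_add, ← Int.negOnePow_add, ← degBefore_add_degAfter k y]
    congr 1
    ring

/-- The second component is a double sum over the slot of `ε` and the slot hit by the differential.
The derivation property turns `θ` of a product into diagonal terms, treated in `epsAct_d_diag`; off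
the diagonal only the signs have to be compared. -/
theorem epsAct_d (θ : Hom V V) (hθ : ∀ {n : ℕ} (a : O.space n) (v : Fin n → V),
      θ.lin (s.act a v) = ∑ y, s.act a (Function.update v y (θ.lin (v y))))
    (p : ℤ) (k : Fin n → ℤ) (a : O.space n) (v : Fin n → V.carrier × V.carrier)
    (ha : a ∈ (O.space n).gr p) (hv : ∀ y, v y ∈ (V.eps θ).gr (k y)) :
    V.epsD θ (s.epsAct n a v) = s.epsAct n ((O.space n).d a) v +
      ∑ y, (p + degBefore k y.val).negOnePow •
        s.epsAct n a (Function.update v y (V.epsD θ (v y))) := by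
  have hv1 : ∀ y, (v y).1 ∈ V.gr (k y) := fun y => (hv y).1
  have hfst : ∀ y w, (fun z => (Function.update v y w z).1) =
      Function.update (fun z => (v z).1) y w.1 := fun y w => by
    funext z
    by_cases hz : z = y
    · subst hz; simp
    · simp [hz]
  refine Prod.ext ?_ ?_
  · rw [Prod.fst_add, Prod.fst_sum]
    change V.d (s.epsAct n a v).1 = _
    rw [epsAct_fst, epsAct_fst, s.act_d p k a _ ha hv1]
    congr 1
    refine Finset.sum_congr rfl fun y _ => ?_
    change _ = (p + degBefore k y.val).negOnePow • Prod.fst (s.epsAct n a _)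
    rw [epsAct_fst, hfst]
    rfl
  · rw [Prod.snd_add, Prod.snd_sum]
    change V.d (s.epsAct n a v).2 + V.parity (θ.lin (s.epsAct n a v).1) = _
    have hR : ∀ z, Prod.snd ((p + degBefore k z.val).negOnePow •
        s.epsAct n a (Function.update v z (V.epsD θ (v z)))) =
        ∑ y, ((p + degBefore k z.val).negOnePow *
          (degAfter (Function.update k z (k z + 1)) y).negOnePow) • s.act a
            (Function.update (Function.update (fun z => (v z).1) z (V.d (v z).1)) y
              (Function.update v z (V.epsD θ (v z)) y).2) := fun z => by
      change (p + degBefore k z.val).negOnePow • Prod.snd (s.epsAct n a _) = _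
      rw [s.epsAct_snd (k := Function.update k z (k z + 1)), Finset.smul_sum]
      · refine Finset.sum_congr rfl fun y _ => ?_
        rw [hfst, smul_smul]
        rfl
      · intro y
        have := congrFun (hfst z (V.epsD θ (v z))) y
        rw [this]
        exact update_mem hv1 z (V.d_mem _ _ (hv1 z)) y
    rw [Finset.sum_congr rfl fun z _ => hR z, Finset.sum_comm,
      s.epsAct_snd a hv1, s.epsAct_snd _ hv1, epsAct_fst, hθ, map_sum, map_sum,
      ← Finset.sum_add_distrib, ← Finset.sum_add_distrib]
    refine Finset.sum_congr rfl fun y _ => ?_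
    rw [map_sign, s.act_d p _ a _ ha (update_mem hv1 y (hv y).2), smul_add, add_assoc]
    congr 1
    rw [Finset.smul_sum, ← Finset.add_sum_erase _ _ (Finset.mem_univ y),
      ← Finset.add_sum_erase _ (fun z => ((p + degBefore k z.val).negOnePow *
          (degAfter (Function.update k z (k z + 1)) y).negOnePow) • s.act a
            (Function.update (Function.update (fun z => (v z).1) z (V.d (v z).1)) y
              (Function.update v z (V.epsD θ (v z)) y).2)) (Finset.mem_univ y),
      add_right_comm]
    congr 1
    · rw [show Function.update v y (V.epsD θ (v y)) y = V.epsD θ (v y) from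
        Function.update_self ..]
      exact s.epsAct_d_diag θ a ha hv1 y (v y).2
    · refine Finset.sum_congr rfl fun z hz => ?_
      have hz := Finset.ne_of_mem_erase hz
      rw [Function.update_of_ne hz, Function.update_of_ne hz.symm, Function.update_comm hz,
        smul_smul, ← Int.negOnePow_add, ← Int.negOnePow_add, degAfter_update, degBefore_update]
      congr 1
      rw [Int.negOnePow_eq_iff]
      -- For `y < z`, removing `ε` lowers the degree before `z`, while applying `d` raises the
      -- degree after `y`; the exponents differ by two. For `z < y` neither count changes.
      rcases lt_or_gt_of_ne hz with h | h
      · have h' : ¬ y.val < z.val := not_lt.2 (Fin.le_def.1 h.le)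
        rw [if_neg h', if_neg h.not_gt]
        exact ⟨0, by ring⟩
      · have h' : y.val < z.val := h
        rw [if_pos h', if_pos h]
        exact ⟨-1, by ring⟩

/-- The `O`-algebra structure on `V ⊕ V ε` given by a derivation of degree zero. -/
def eps (θ : Hom V V) (hθ : ∀ {n : ℕ} (a : O.space n) (v : Fin n → V),
    θ.lin (s.act a v) = ∑ y, s.act a (Function.update v y (θ.lin (v y)))) :
    AlgStr O (V.eps θ) where
  act {n} := s.epsAct n
  act_mem := s.epsAct_mem θ
  act_d := s.epsAct_d θ hθ
  act_one := s.epsAct_one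
  act_perm := s.epsAct_perm θ
  act_comp := s.epsAct_comp θ

end AlgStr

namespace Alg

open DGSpace AlgStr

variable {O : DGOperad.{u}}

/-- The `O`-algebra `A[t, dt]`. -/
def path (A : Alg O) : Alg O where
  space := A.space.poly.eps A.space.deriv
  str := A.poly.str.eps A.space.deriv A.str.deriv_polyAct

/-- The evaluation of `A[t, dt]` at a point. -/
def pathEv (A : Alg O) (t : ℂ) : Hom A.path A where
  lin := (A.space.ev t).lin ∘ₗ LinearMap.fst ℂ A.space.poly.carrier A.space.poly.carrier
  map_mem i x hx := (A.space.ev t).map_mem i x.1 hx.1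
  map_d x := (A.space.ev t).map_d x.1
  map_act a v := (congrArg (A.space.ev t).lin (A.poly.str.epsAct_fst a v)).trans
    (A.str.ev_polyAct t a _)

end Alg

/-! ### Sequences of paths -/

namespace DGSpace

variable {W A : DGSpace.{u}} (e₀ e₁ : Hom W A) (F : Hom A A)

/-- The sequences `γ` of elements of degree `i` such that `γ (n + 1)` starts at the image under `F`
of the end of `γ n`. -/
def seqGr (i : ℤ) : Submodule ℂ (ℕ → W.carrier) where
  carrier := {γ | ∀ n, γ n ∈ W.gr i ∧ e₀.lin (γ (n + 1)) = F.lin (e₁.lin (γ n))}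
  add_mem' hx hy n := ⟨Submodule.add_mem _ (hx n).1 (hy n).1, by
    simp only [Pi.add_apply, map_add, (hx n).2, (hy n).2]⟩
  zero_mem' n := ⟨Submodule.zero_mem _, by simp only [Pi.zero_apply, map_zero]⟩
  smul_mem' c x hx n := ⟨Submodule.smul_mem _ c (hx n).1, by
    simp only [Pi.smul_apply, map_smul, (hx n).2]⟩

variable (W) in
/-- The termwise differential of sequences. -/
def seqD : (ℕ → W.carrier) →ₗ[ℂ] (ℕ → W.carrier) := W.d.compLeft ℕ

theorem seqGr_iSupIndep : iSupIndep (seqGr e₀ e₁ F) := by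
  refine iSupIndep_of_proj _ (fun i => (W.proj i).compLeft ℕ) ?_ ?_
  · intro i x hx
    exact funext fun n => W.proj_same i _ (hx n).1
  · intro i j h x hx
    exact funext fun n => W.proj_ne h _ (hx n).1

/-- The complex of sequences of paths that match up to `F`. -/
def seq : DGSpace.{u} :=
  ofFamily W.seqD (seqGr e₀ e₁ F) (seqGr_iSupIndep e₀ e₁ F)
    (fun i x hx n => ⟨W.d_mem _ _ (hx n).1, by
      change e₀.lin (W.d (x (n + 1))) = F.lin (e₁.lin (W.d (x n)))
      rw [e₀.map_d, e₁.map_d, F.map_d, (hx n).2]⟩)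
    (fun x => funext fun n => W.d_d (x n))

/-- The `n`-th term of a sequence. -/
def seqEv (n : ℕ) : Hom (seq e₀ e₁ F) W where
  lin := LinearMap.proj n ∘ₗ (⨆ i, seqGr e₀ e₁ F i).subtype
  map_mem _ _ hx := (hx n).1
  map_d _ := rfl

variable {e₀ e₁ F}

theorem seqEv_injective {x y : seq e₀ e₁ F}
    (h : ∀ n, (seqEv e₀ e₁ F n).lin x = (seqEv e₀ e₁ F n).lin y) : x = y :=
  Subtype.ext (funext h)

theorem seqEv_succ (n : ℕ) (x : seq e₀ e₁ F) : e₀.lin ((seqEv e₀ e₁ F (n + 1)).lin x) =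
    F.lin (e₁.lin ((seqEv e₀ e₁ F n).lin x)) := by
  induction x using proj_induction with
  | h0 => simp only [map_zero]
  | hadd x y hx hy => simp only [map_add, hx, hy]
  | hm i x hx => exact (hx n).2

/-- A homogeneous sequence from its terms. -/
theorem exists_seqEv_eq {i : ℤ} {γ : ℕ → W} (h : ∀ n, γ n ∈ W.gr i)
    (h' : ∀ n, e₀.lin (γ (n + 1)) = F.lin (e₁.lin (γ n))) :
    ∃ x ∈ (seq e₀ e₁ F).gr i, ∀ n, (seqEv e₀ e₁ F n).lin x = γ n :=
  ⟨⟨γ, Submodule.mem_iSup_of_mem i fun n => ⟨h n, h' n⟩⟩, fun n => ⟨h n, h' n⟩, fun _ => rfl⟩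

/-- The chain map to the complex of sequences given by a compatible family of chain maps. -/
def seqLift {V : DGSpace.{u}} (c : ℕ → Hom V W)
    (hc : ∀ n x, e₀.lin ((c (n + 1)).lin x) = F.lin (e₁.lin ((c n).lin x))) :
    Hom V (seq e₀ e₁ F) where
  lin := (LinearMap.pi fun n => (c n).lin).codRestrict (⨆ i, seqGr e₀ e₁ F i) fun x => by
    induction x using proj_induction with
    | h0 => rw [map_zero]; exact Submodule.zero_mem _
    | hadd x y hx hy => rw [map_add]; exact Submodule.add_mem _ hx hy
    | hm i x hx => exact Submodule.mem_iSup_of_mem i fun n => ⟨(c n).map_mem i x hx, hc n x⟩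
  map_mem i x hx n := ⟨(c n).map_mem i x hx, hc n x⟩
  map_d x := Subtype.ext (funext fun n => (c n).map_d x)

variable (e₀ e₁ F) in
/-- The shift of sequences. -/
def seqShift : Hom (seq e₀ e₁ F) (seq e₀ e₁ F) :=
  seqLift (fun n => seqEv e₀ e₁ F (n + 1)) fun n x => seqEv_succ (n + 1) x

theorem seqEv_seqShift (n : ℕ) (x : seq e₀ e₁ F) :
    (seqEv e₀ e₁ F n).lin ((seqShift e₀ e₁ F).lin x) = (seqEv e₀ e₁ F (n + 1)).lin x := rfl

/-- The equation `y (n + 1) - α y n = x n` is a recursion. Its solution inherits the matching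
condition at all later steps from `x`, so only the first step restricts the choice of the initial
path. -/
theorem seqShift_isDivisible (h : ∀ i, ∀ a ∈ A.gr i, ∃ w ∈ W.gr i, e₀.lin w = a ∧ e₁.lin w = 0) :
    (seqShift e₀ e₁ F).IsDivisible := by
  intro α hα i x hx
  let ε := fun n => (seqEv e₀ e₁ F n).lin x
  have hε : ∀ n, ε n ∈ W.gr i := fun n => (seqEv e₀ e₁ F n).map_mem i x hx
  -- The first matching condition reads `α e₀ w + e₀ (ε 0) = F (e₁ w)`. A path that ends at zero and
  -- starts at `-α⁻¹ e₀ (ε 0)` satisfies it; this is where `α ≠ 0` is needed.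
  obtain ⟨w, hw, hw0, hw1⟩ := h i (-α⁻¹ • e₀.lin (ε 0))
    (Submodule.smul_mem _ _ (e₀.map_mem i _ (hε 0)))
  let γ : ℕ → W := fun n => Nat.rec w (fun n y => α • y + ε n) n
  have hγ : ∀ n, γ (n + 1) = α • γ n + ε n := fun n => rfl
  obtain ⟨y, hy, hyγ⟩ := exists_seqEv_eq (e₀ := e₀) (e₁ := e₁) (F := F) (i := i) (γ := γ)
    (fun n => by
      induction n with
      | zero => exact hw
      | succ n ih => exact Submodule.add_mem _ (Submodule.smul_mem _ _ ih) (hε n))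
    (fun n => by
      induction n with
      | zero =>
        rw [hγ, map_add, map_smul]
        change α • e₀.lin w + _ = F.lin (e₁.lin w)
        rw [hw0, hw1, map_zero, smul_smul, mul_neg, mul_inv_cancel₀ hα, neg_one_smul,
          neg_add_cancel]
      | succ n ih =>
        rw [hγ (n + 1), map_add, map_smul, ih, hγ n, map_add, map_smul, map_add, map_smul]
        congr 1
        exact seqEv_succ n x)
  refine ⟨y, hy, seqEv_injective fun n => ?_⟩
  rw [map_sub, map_smul, seqEv_seqShift, hyγ, hyγ, hγ]
  exact add_sub_cancel_left _ _

variable (F) in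
/-- The powers of an endomorphism of a complex. -/
def Hom.iter (n : ℕ) : Hom A A := Nat.rec (Hom.id A) (fun _ g => g.comp F) n

theorem Hom.iter_succ (n : ℕ) (x : A) : (F.iter (n + 1)).lin x = F.lin ((F.iter n).lin x) := rfl

theorem Hom.iter_succ' (n : ℕ) (x : A) : (F.iter (n + 1)).lin x = (F.iter n).lin (F.lin x) := by
  induction n with
  | zero => rfl
  | succ n ih => rw [Hom.iter_succ, ih, Hom.iter_succ]

section Constants

variable (F) (σ : Hom A W) (h₀ : ∀ x, e₀.lin (σ.lin x) = x) (h₁ : ∀ x, e₁.lin (σ.lin x) = x)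

/-- The sequence of constant paths at the points of an orbit. -/
def seqConst : Hom A (seq e₀ e₁ F) :=
  seqLift (fun n => (F.iter n).comp σ) fun _ _ => (h₀ _).trans (congrArg F.lin (h₁ _).symm)

theorem seqEv_seqConst (n : ℕ) (x : A) :
    (seqEv e₀ e₁ F n).lin ((seqConst F σ h₀ h₁).lin x) = σ.lin ((F.iter n).lin x) := rfl

theorem seqConst_shift (x : A) : (seqConst F σ h₀ h₁).lin (F.lin x) =
    (seqShift e₀ e₁ F).lin ((seqConst F σ h₀ h₁).lin x) :=
  seqEv_injective fun n => by
    rw [seqEv_seqShift, seqEv_seqConst, seqEv_seqConst, Hom.iter_succ']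

/-- A closed sequence should be cohomologous to the orbit of its initial point `e₀ (γ 0)`. Each `γ
n` contracts to the constant path at its start, but these contractions must be corrected so that the
primitives match along `F`. -/
theorem seqConst_isQuasiIso (h : ∀ i, ∀ w ∈ W.gr i, W.d w = 0 →
      ∃ r ∈ W.gr (i - 1), W.d r = w - σ.lin (e₀.lin w) ∧ e₀.lin r = 0) :
    (seqConst F σ h₀ h₁).IsQuasiIso := by
  refine Hom.isQuasiIso_of_homogeneous _ ?_ ?_
  · rintro n x - - ⟨η, hη⟩
    refine ⟨e₀.lin ((seqEv e₀ e₁ F 0).lin η), ?_⟩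
    rw [← e₀.map_d, ← Hom.map_d, hη, seqEv_seqConst, h₀]
    rfl
  · intro i x hx hd
    let γ := fun n => (seqEv e₀ e₁ F n).lin x
    have hγ : ∀ n, γ n ∈ W.gr i := fun n => (seqEv e₀ e₁ F n).map_mem i x hx
    have hγd : ∀ n, W.d (γ n) = 0 := fun n => by
      change W.d ((seqEv e₀ e₁ F n).lin x) = 0
      rw [← Hom.map_d, hd, map_zero]
    choose r hr hrd hr0 using fun n => h i (γ n) (hγ n) (hγd n)
    -- The summand `σ (F (e₁ (η n)))` carries the end of the previous primitive over to the next
    -- start; as `e₀` kills `r (n + 1)`, the matching condition holds exactly.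
    let η : ℕ → W := fun n => Nat.rec (r 0) (fun n y => r (n + 1) + σ.lin (F.lin (e₁.lin y))) n
    have hη : ∀ n, η (n + 1) = r (n + 1) + σ.lin (F.lin (e₁.lin (η n))) := fun n => rfl
    have hηd : ∀ n, W.d (η n) = γ n - σ.lin ((F.iter n).lin (e₀.lin (γ 0))) := fun n => by
      induction n with
      | zero => exact hrd 0
      | succ n ih =>
        rw [hη, map_add, hrd, ← σ.map_d, ← F.map_d, ← e₁.map_d, ih, map_sub e₁.lin, h₁, map_sub,
          map_sub, Hom.iter_succ, show F.lin (e₁.lin (γ n)) = e₀.lin (γ (n + 1)) from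
          (seqEv_succ n x).symm]
        abel
    obtain ⟨y, hy, hyη⟩ := exists_seqEv_eq (e₀ := e₀) (e₁ := e₁) (F := F) (i := i - 1) (γ := η)
      (fun n => by
        induction n with
        | zero => exact hr 0
        | succ n ih =>
          exact Submodule.add_mem _ (hr _) (σ.map_mem _ _ (F.map_mem _ _ (e₁.map_mem _ _ ih))))
      (fun n => by rw [hη, map_add, hr0, h₀, zero_add])
    refine ⟨e₀.lin (γ 0), by rw [← e₀.map_d, hγd, map_zero], -y, seqEv_injective fun n => ?_⟩
    rw [map_neg, map_neg, map_sub, seqEv_seqConst, Hom.map_d, hyη, hηd, neg_sub]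

end Constants

end DGSpace

/-! ### The algebra of sequences of paths, and the contraction of `A[t, dt]`. -/

namespace Alg

open DGSpace AlgStr

variable {O : DGOperad.{u}} {W A : Alg O} (e₀ e₁ : Alg.Hom W A) (F : Alg.Hom A A)

/-- The termwise operations on sequences. -/
def piAct (W : Alg O) (n : ℕ) : O.space n →ₗ[ℂ]
    MultilinearMap ℂ (fun _ : Fin n => ℕ → W.space.carrier) (ℕ → W.space.carrier) where
  toFun a := MultilinearMap.pi fun j => (W.str.act a).compLinearMap fun _ => LinearMap.proj j
  map_add' a b := MultilinearMap.ext fun _ => funext fun _ =>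
    DFunLike.congr_fun (map_add W.str.act a b) _
  map_smul' c a := MultilinearMap.ext fun _ => funext fun _ =>
    DFunLike.congr_fun (map_smul W.str.act c a) _

theorem piAct_mem {n : ℕ} (p : ℤ) (k : Fin n → ℤ) (a : O.space n)
    (v : Fin n → ℕ → W.space.carrier) (ha : a ∈ (O.space n).gr p)
    (hv : ∀ y, v y ∈ seqGr e₀.toHom e₁.toHom F.toHom (k y)) :
    W.piAct n a v ∈ seqGr e₀.toHom e₁.toHom F.toHom (p + ∑ y, k y) := by
  refine fun j => ⟨W.str.act_mem p k a _ ha fun y => (hv y j).1, ?_⟩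
  refine (e₀.map_act a _).trans (Eq.trans ?_ ((congrArg F.lin (e₁.map_act a _)).trans
    (F.map_act a _)).symm)
  exact congrArg _ (funext fun y => (hv y j).2)

/-- The algebra of sequences of paths that match up to `F`. -/
def seq : Alg O where
  space := DGSpace.seq e₀.toHom e₁.toHom F.toHom
  str := AlgStr.ofJointlyInjective _ (fun _ : ℕ => W) (seqEv _ _ _)
    (fun _ _ => seqEv_injective)
    (restrictAct (W.piAct _) (⨆ i, seqGr e₀.toHom e₁.toHom F.toHom i)
      (act_mem_iSup (W.piAct _) _ (piAct_mem e₀ e₁ F)))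
    (fun _ _ _ => rfl) fun p k a _ ha hv => piAct_mem e₀ e₁ F p k a _ ha hv

/-- The shift of sequences as a morphism of algebras. -/
def seqShift : Alg.Hom (seq e₀ e₁ F) (seq e₀ e₁ F) where
  toHom := DGSpace.seqShift e₀.toHom e₁.toHom F.toHom
  map_act _ _ := rfl

theorem Hom.iter_act (n : ℕ) {l : ℕ} (a : O.space l) (v : Fin l → A.space) :
    (F.toHom.iter n).lin (A.str.act a v) = A.str.act a fun y => (F.toHom.iter n).lin (v y) := by
  induction n with
  | zero => rfl
  | succ n ih => exact (congrArg F.lin ih).trans (F.map_act a _)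

variable {e₀ e₁} in
/-- The orbit of a point, as a morphism of algebras. -/
def seqConst (σ : Alg.Hom A W) (h₀ : ∀ x, e₀.lin (σ.lin x) = x) (h₁ : ∀ x, e₁.lin (σ.lin x) = x) :
    Alg.Hom A (seq e₀ e₁ F) where
  toHom := DGSpace.seqConst F.toHom σ.toHom h₀ h₁
  map_act a v := seqEv_injective fun n =>
    (congrArg σ.lin (F.iter_act n a v)).trans (σ.map_act a _)

/-- The constants in `A[t, dt]`. -/
def pathConst (A : Alg O) : Alg.Hom A A.path where
  lin := LinearMap.inl ℂ A.space.poly.carrier A.space.poly.carrier ∘ₗ A.space.monomial 0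
  map_mem i x hx := ⟨monomial_mem 0 hx, Submodule.zero_mem _⟩
  map_d x := by
    refine Prod.ext (poly_d_monomial 0 x).symm ?_
    change 0 = A.space.poly.d 0 + A.space.poly.parity (A.space.deriv.lin (A.space.monomial 0 x))
    rw [deriv_const, map_zero, map_zero, add_zero]
  map_act {n} a v := by
    refine Prod.ext ?_ ?_
    · refine Eq.trans ?_ (A.poly.str.epsAct_fst a _).symm
      refine Eq.trans ?_ (A.str.polyAct_monomial a (fun _ => 0) v).symm
      rw [Finset.sum_const_zero]
      rfl
    · refine Eq.trans ?_ (A.poly.str.epsAct_snd_eq a _).symm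
      refine (Finset.sum_eq_zero fun y _ => (A.poly.str.act a).map_coord_zero y ?_).symm
      rw [if_pos rfl]
      rfl

theorem pathEv_const (t : ℂ) (x : A.space) : (A.pathEv t).lin (A.pathConst.lin x) = x :=
  ev_const t x

/-- The path is `a (1 - t)`. -/
theorem path_exists_start (i : ℤ) (a : A.space) (ha : a ∈ A.space.gr i) :
    ∃ w ∈ A.path.space.gr i, (A.pathEv 0).lin w = a ∧ (A.pathEv 1).lin w = 0 := by
  refine ⟨(A.space.monomial 0 a - A.space.monomial 1 a, 0),
    ⟨Submodule.sub_mem _ (monomial_mem 0 ha) (monomial_mem 1 ha), Submodule.zero_mem _⟩, ?_, ?_⟩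
  · change (A.space.ev 0).lin (A.space.monomial 0 a - A.space.monomial 1 a) = a
    rw [map_sub, ev_monomial, ev_monomial, pow_zero, one_smul, pow_one, zero_smul, sub_zero]
  · change (A.space.ev 1).lin (A.space.monomial 0 a - A.space.monomial 1 a) = 0
    rw [map_sub, ev_monomial, ev_monomial, pow_zero, one_smul, pow_one, one_smul, sub_self]

/-- This is the Poincaré lemma: for a closed `p + q dt` the primitive is the integral of `q` from
`0` to `t`, up to sign, and it vanishes at the starting point. -/
theorem path_exists_primitive (i : ℤ) (w : A.path.space) (hw : w ∈ A.path.space.gr i)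
    (hd : A.path.space.d w = 0) : ∃ r ∈ A.path.space.gr (i - 1),
      A.path.space.d r = w - A.pathConst.lin ((A.pathEv 0).lin w) ∧ (A.pathEv 0).lin r = 0 := by
  obtain ⟨p, q⟩ := w
  have hp : p ∈ A.space.poly.gr i := hw.1
  have hq : q ∈ A.space.poly.gr (i - 1) := hw.2
  have hdp : A.space.poly.d p = 0 := congrArg Prod.fst hd
  have hdq : A.space.poly.d q + A.space.poly.parity (A.space.deriv.lin p) = 0 :=
    congrArg Prod.snd hd
  have hi : (i - 1).negOnePow • i.negOnePow • A.space.deriv.lin p = -A.space.deriv.lin p := by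
    rw [smul_smul, ← Int.negOnePow_add, show i - 1 + i = 2 * i - 1 by ring,
      Int.negOnePow_odd _ ⟨i - 1, by ring⟩, Units.smul_def, Units.val_neg, Units.val_one,
      neg_smul, one_smul]
  have hr := sign_mem _ (i - 1).negOnePow (integral_mem hq)
  have hdr : A.space.deriv.lin ((i - 1).negOnePow • A.space.integral q) =
      (i - 1).negOnePow • q := by
    rw [map_sign, deriv_integral]
  -- Closedness says that `d r` and `p` have the same derivative in `t`. Their difference is thus
  -- constant, and evaluation at `0`, where `r` vanishes, identifies it.
  have hd0 : A.space.deriv.lin (A.space.poly.d ((i - 1).negOnePow • A.space.integral q) - p) =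
      0 := by
    rw [map_sub, A.space.deriv.map_d, hdr, map_sign, eq_neg_of_add_eq_zero_left hdq,
      parity_apply (A.space.deriv.map_mem i p hp), smul_neg, hi, neg_neg, sub_self]
  have he : (A.space.ev 0).lin ((i - 1).negOnePow • A.space.integral q) = 0 := by
    rw [map_sign, ev_zero_integral, smul_zero]
  refine ⟨((i - 1).negOnePow • A.space.integral q, 0), ⟨hr, Submodule.zero_mem _⟩,
    Prod.ext ?_ ?_, he⟩
  · change A.space.poly.d ((i - 1).negOnePow • A.space.integral q) =
      p - A.space.monomial 0 ((A.space.ev 0).lin p)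
    have := eq_of_deriv_eq_zero hd0
    rw [map_sub, (A.space.ev 0).map_d, he, map_zero, zero_sub, map_neg, sub_eq_iff_eq_add] at this
    rw [this]
    abel
  · change A.space.poly.d 0 + A.space.poly.parity
      (A.space.deriv.lin ((i - 1).negOnePow • A.space.integral q)) = q - 0
    rw [hdr, map_sign, parity_apply hq, smul_smul, Int.units_mul_self, one_smul, map_zero,
      zero_add, sub_zero]

/-- The homotopy category sees an algebra with a pure endomorphism as its cohomology. -/
theorem isFormal_of_isPure (hO : O.IsNonpositive) {ξ : ℝ} (hξ : 0 < ξ) (hξ1 : ξ ≠ 1)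
    (hp : IsPure ξ 0 A.space F.toHom) : A.IsFormal := by
  have hc := DGSpace.seqConst_isQuasiIso F.toHom A.pathConst.toHom (pathEv_const 0) (pathEv_const 1)
    path_exists_primitive
  exact ⟨_, isInduced_of_isPure hO hξ hξ1 hp,
    nonempty_iso_cohomology hO hξ hξ1 (seqConst F A.pathConst (pathEv_const 0) (pathEv_const 1)) hc
      (seqShift _ _ F) (DGSpace.seqShift_isDivisible path_exists_start)
      (IsPure.of_isQuasiIso _ hc (DGSpace.seqConst_shift F.toHom A.pathConst.toHom _ _) hp)⟩

end Alg

/-! ### Modules over an algebra with zero differential -/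

theorem multilinear_apply_mem_of_mem_span {ι M N P : Type*} [Finite ι] [AddCommGroup M] [Module ℂ M]
    [AddCommGroup N] [Module ℂ N] [AddCommGroup P] [Module ℂ P]
    (g : MultilinearMap ℂ (fun _ : ι => M) (N →ₗ[ℂ] P)) (T : ι → Set M) (U : Set N)
    (Z : Submodule ℂ P) (h : ∀ b, (∀ y, b y ∈ T y) → ∀ x ∈ U, g b x ∈ Z) (b : ι → M)
    (hb : ∀ y, b y ∈ Submodule.span ℂ (T y)) (x : N) (hx : x ∈ Submodule.span ℂ U) :
    g b x ∈ Z := by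
  have := Fintype.ofFinite ι
  have := multilinear_mem_of_mem_span g T (⨅ x ∈ U, Z.comap (LinearMap.applyₗ x))
    (fun b hb => by
      simp only [Submodule.mem_iInf]
      exact fun x hx => h b hb x hx) b hb
  simp only [Submodule.mem_iInf] at this
  have hle : Submodule.span ℂ U ≤ Z.comap (g b) := Submodule.span_le.2 fun x hx => this x hx
  exact hle hx

theorem span_homogeneous (V : DGSpace.{u}) (x : V) :
    x ∈ Submodule.span ℂ {x : V | ∃ k, x ∈ V.gr k} := by
  induction x using DGSpace.proj_induction with
  | h0 => exact Submodule.zero_mem _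
  | hadd x y hx hy => exact Submodule.add_mem _ hx hy
  | hm k x hx => exact Submodule.subset_span ⟨k, hx⟩

namespace ModStr

open DGSpace

variable {O : DGOperad.{u}} {B : Alg O}

/-- Operations on a complex satisfy the axioms of a module if they are intertwined with the
operations of modules by a jointly injective family of linear maps and satisfy the Leibniz rule. -/
def ofJointlyInjective {ι : Type*} (hB : B.space.d = 0) (V : DGSpace.{u}) (A : ι → Mod B)
    (e : ∀ t, V.carrier →ₗ[ℂ] (A t).space.carrier)
    (hinj : ∀ x y : V, (∀ t, e t x = e t y) → x = y)
    (act : ∀ {m : ℕ}, O.space (m + 1) →ₗ[ℂ]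
      MultilinearMap ℂ (fun _ : Fin m => B.space.carrier) (V.carrier →ₗ[ℂ] V.carrier))
    (he : ∀ {m : ℕ} (t : ι) (a : O.space (m + 1)) (b : Fin m → B.space) (x : V),
      e t (act a b x) = (A t).str.act a b (e t x))
    (hmem : ∀ {m : ℕ} (p : ℤ) (k : Fin m → ℤ) (r : ℤ) (a : O.space (m + 1)) (b : Fin m → B.space)
      (x : V), a ∈ (O.space (m + 1)).gr p → (∀ y, b y ∈ B.space.gr (k y)) → x ∈ V.gr r →
        act a b x ∈ V.gr (p + ∑ y, k y + r))
    (hd : ∀ {m : ℕ} (p : ℤ) (k : Fin m → ℤ) (a : O.space (m + 1)) (b : Fin m → B.space) (x : V),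
      a ∈ (O.space (m + 1)).gr p → (∀ y, b y ∈ B.space.gr (k y)) →
        V.d (act a b x) = act ((O.space (m + 1)).d a) b x +
          (p + ∑ y, k y).negOnePow • act a b (V.d x)) :
    ModStr B V where
  act := act
  act_mem := hmem
  act_d p k a b x ha hb := by
    have h0 : ∑ y, (p + degBefore k y.val).negOnePow •
        act a (Function.update b y (B.space.d (b y))) x = 0 := Finset.sum_eq_zero fun y _ => by
      rw [hB, LinearMap.zero_apply, (act a).map_update_zero, LinearMap.zero_apply, smul_zero]
    rw [hd p k a b x ha hb, h0, add_zero]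
  act_one b x := hinj _ _ fun t => by rw [he, (A t).str.act_one]
  act_perm σ k a b x hb := hinj _ _ fun t => by
    rw [he, map_sign, he, (A t).str.act_perm σ k a b _ hb]
  act_comp h h' i q k a c b x hc hb := hinj _ _ fun t => by
    rw [he, map_sign, he, (A t).str.act_comp h h' i q k a c b _ hc hb]
  act_comp_last h q k a c b x hc hb := hinj _ _ fun t => by
    rw [he, map_sign, he, he, (A t).str.act_comp_last h q k a c b _ hc hb]

/-- The restriction of a family of operations to an invariant subspace. -/
def restrictAct {R L M : Type u} [AddCommGroup R] [Module ℂ R] [AddCommGroup L] [Module ℂ L]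
    [AddCommGroup M] [Module ℂ M] {n : ℕ}
    (act : R →ₗ[ℂ] MultilinearMap ℂ (fun _ : Fin n => L) (M →ₗ[ℂ] M)) (U : Submodule ℂ M)
    (hU : ∀ a b, ∀ x ∈ U, act a b x ∈ U) :
    R →ₗ[ℂ] MultilinearMap ℂ (fun _ : Fin n => L) (U →ₗ[ℂ] U) where
  toFun a :=
    { toFun := fun b => (act a b).restrict (hU a b)
      map_update_add' := fun b i x y => LinearMap.ext fun z => Subtype.ext
        (LinearMap.congr_fun ((act a).map_update_add b i x y) z)
      map_update_smul' := fun b i c x => LinearMap.ext fun z => Subtype.ext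
        (LinearMap.congr_fun ((act a).map_update_smul b i c x) z) }
  map_add' a b := MultilinearMap.ext fun v => LinearMap.ext fun z => Subtype.ext
    (LinearMap.congr_fun (DFunLike.congr_fun (map_add act a b) v) z)
  map_smul' c a := MultilinearMap.ext fun v => LinearMap.ext fun z => Subtype.ext
    (LinearMap.congr_fun (DFunLike.congr_fun (map_smul act c a) v) z)

theorem act_mem_iSup {M : Type u} [AddCommGroup M] [Module ℂ M] {n : ℕ}
    (act : O.space (n + 1) →ₗ[ℂ] MultilinearMap ℂ (fun _ : Fin n => B.space.carrier) (M →ₗ[ℂ] M))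
    (G : ℤ → Submodule ℂ M)
    (h : ∀ (p : ℤ) (k : Fin n → ℤ) (r : ℤ) (a : O.space (n + 1)) (b : Fin n → B.space) (x : M),
      a ∈ (O.space (n + 1)).gr p → (∀ y, b y ∈ B.space.gr (k y)) → x ∈ G r →
        act a b x ∈ G (p + ∑ y, k y + r))
    (a : O.space (n + 1)) (b : Fin n → B.space) (x : M) (hx : x ∈ ⨆ i, G i) :
    act a b x ∈ ⨆ i, G i := by
  induction a using DGSpace.proj_induction with
  | h0 => rw [map_zero]; exact Submodule.zero_mem _
  | hadd a a' ha hb => rw [map_add]; exact Submodule.add_mem _ ha hb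
  | hm p a ha =>
    rw [Submodule.iSup_eq_span] at hx
    refine multilinear_apply_mem_of_mem_span (act a) _ _ _ ?_ b
      (fun y => span_homogeneous B.space (b y)) x hx
    intro b hb x hx
    choose k hk using hb
    obtain ⟨r, hr⟩ := Set.mem_iUnion.1 hx
    exact Submodule.mem_iSup_of_mem _ (h p k r a b x ha hk hr)

variable {N : DGSpace.{u}} (s : ModStr B N)

theorem act_d_of_d_eq_zero (hB : B.space.d = 0) {m : ℕ} {p : ℤ} {k : Fin m → ℤ}
    {a : O.space (m + 1)} {b : Fin m → B.space} (x : N) (ha : a ∈ (O.space (m + 1)).gr p)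
    (hb : ∀ y, b y ∈ B.space.gr (k y)) :
    N.d (s.act a b x) = s.act ((O.space (m + 1)).d a) b x +
      (p + ∑ y, k y).negOnePow • s.act a b (N.d x) := by
  rw [s.act_d p k a b x ha hb, Finset.sum_eq_zero, add_zero]
  intro y _
  rw [hB, LinearMap.zero_apply, (s.act a).map_update_zero, LinearMap.zero_apply, smul_zero]

/-- All elements of `B` are cocycles, so in the Leibniz rule only the operation and the module
element can contribute. -/
theorem act_cocycle (hB : B.space.d = 0) {m : ℕ} {p : ℤ} {a : O.space (m + 1)}
    (ha : a ∈ (O.space (m + 1)).gr p) (hd : (O.space (m + 1)).d a = 0) (b : Fin m → B.space) {x : N}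
    (hx : N.d x = 0) : N.d (s.act a b x) = 0 := by
  refine multilinear_apply_mem_of_mem_span (s.act a) _ {x} (LinearMap.ker N.d) ?_ b
    (fun y => span_homogeneous B.space (b y)) x (Submodule.subset_span rfl)
  rintro b hb _ rfl
  choose k hk using hb
  rw [LinearMap.mem_ker, s.act_d_of_d_eq_zero hB _ ha hk, hd, map_zero, hx, map_zero, smul_zero,
    zero_apply, LinearMap.zero_apply, add_zero]

theorem act_exact (hB : B.space.d = 0) {m : ℕ} {p : ℤ} {a : O.space (m + 1)}
    (ha : a ∈ (O.space (m + 1)).gr p) (hd : (O.space (m + 1)).d a = 0) (b : Fin m → B.space)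
    (u : N) : ∃ w, N.d w = s.act a b (N.d u) := by
  refine multilinear_apply_mem_of_mem_span (s.act a) _ {N.d u} (LinearMap.range N.d) ?_ b
    (fun y => span_homogeneous B.space (b y)) _ (Submodule.subset_span rfl)
  rintro b hb _ rfl
  choose k hk using hb
  refine ⟨(p + ∑ y, k y).negOnePow • s.act a b u, ?_⟩
  rw [map_sign, s.act_d_of_d_eq_zero hB _ ha hk, hd, map_zero, zero_apply, LinearMap.zero_apply,
    zero_add, smul_smul, Int.units_mul_self, one_smul]

theorem act_d_exact (hB : B.space.d = 0) {m : ℕ} {p : ℤ} {a : O.space (m + 1)}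
    (ha : a ∈ (O.space (m + 1)).gr p) (b : Fin m → B.space) {x : N}
    (hx : N.d x = 0) : ∃ w, N.d w = s.act ((O.space (m + 1)).d a) b x := by
  refine multilinear_apply_mem_of_mem_span (s.act ((O.space (m + 1)).d a)) _ {x}
    (LinearMap.range N.d) ?_ b
    (fun y => span_homogeneous B.space (b y)) x (Submodule.subset_span rfl)
  rintro b hb x rfl
  choose k hk using hb
  refine ⟨s.act a b x, ?_⟩
  rw [s.act_d_of_d_eq_zero hB _ ha hk, hx, map_zero, smul_zero, add_zero]

/-! ### The induced module structure on cohomology. -/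

/-- The operations on chosen representatives of cohomology classes. -/
def cohAct {m : ℕ} : O.space (m + 1) →ₗ[ℂ]
    MultilinearMap ℂ (fun _ : Fin m => B.space.carrier) (N.HH →ₗ[ℂ] N.HH) :=
  LinearMap.compMultilinearMapₗ ℂ (LinearMap.lcomp ℂ N.HH (N.cocycles.subtype ∘ₗ N.rep) ∘ₗ
    LinearMap.compRight ℂ (N.cls ∘ₗ N.retract)) ∘ₗ s.act

theorem cohAct_cls (hB : B.space.d = 0) {m : ℕ} {p : ℤ} {a : O.space (m + 1)}
    (ha : a ∈ (O.space (m + 1)).gr p) (hd : (O.space (m + 1)).d a = 0) (b : Fin m → B.space)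
    (z w : N.cocycles) (hw : (w : N) = s.act a b z) : s.cohAct a b (N.cls z) = N.cls w := by
  have h0 := s.act_cocycle hB ha hd b (d_cocycle (N.rep (N.cls z)))
  have h1 : s.cohAct a b (N.cls z) = N.cls ⟨_, h0⟩ := congrArg N.cls (retract_apply h0)
  rw [h1, cls_eq_cls]
  obtain ⟨u, hu⟩ := cls_eq_cls.1 (N.cls_rep (N.cls z))
  obtain ⟨v, hv⟩ := s.act_exact hB ha hd b u
  refine ⟨v, hv.trans ?_⟩
  rw [hu, map_sub, hw]

/-- The operations on cohomology: `O` acts through its part of degree zero, on representatives. -/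
def inducedAct {m : ℕ} : O.space (m + 1) →ₗ[ℂ]
    MultilinearMap ℂ (fun _ : Fin m => B.space.carrier) (N.HH →ₗ[ℂ] N.HH) :=
  s.cohAct ∘ₗ (O.space (m + 1)).proj 0

theorem inducedAct_of_zero {m : ℕ} {a : O.space (m + 1)} (ha : a ∈ (O.space (m + 1)).gr 0) :
    s.inducedAct a = s.cohAct a := by
  have h := (O.space (m + 1)).proj_same 0 a ha
  simp only [inducedAct, LinearMap.comp_apply, h]

theorem inducedAct_of_ne_zero {m : ℕ} {p : ℤ} (hp : p ≠ 0) {a : O.space (m + 1)}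
    (ha : a ∈ (O.space (m + 1)).gr p) : s.inducedAct a = 0 := by
  have h := (O.space (m + 1)).proj_ne hp a ha
  simp only [inducedAct, LinearMap.comp_apply, h, map_zero]

theorem inducedAct_apply_of_ne_zero {m : ℕ} {p : ℤ} (hp : p ≠ 0) {a : O.space (m + 1)}
    (ha : a ∈ (O.space (m + 1)).gr p) (b : Fin m → B.space) (x : N.HH) :
    s.inducedAct a b x = 0 := by
  rw [s.inducedAct_of_ne_zero hp ha, zero_apply, LinearMap.zero_apply]

theorem inducedAct_cls (hO : O.IsNonpositive) (hB : B.space.d = 0) {m : ℕ}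
    {a : O.space (m + 1)} (ha : a ∈ (O.space (m + 1)).gr 0) (b : Fin m → B.space)
    (z w : N.cocycles) (hw : (w : N) = s.act a b z) :
    s.inducedAct a b (N.cls z) = N.cls w := by
  rw [s.inducedAct_of_zero ha]
  exact s.cohAct_cls hB ha (gr_zero_d hO ha) b z w hw

theorem inducedAct_mem (hO : O.IsNonpositive) (hB : B.space.d = 0) {m : ℕ} (p : ℤ)
    (k : Fin m → ℤ) (r : ℤ) (a : O.space (m + 1)) (b : Fin m → B.space) (x : N.HH)
    (ha : a ∈ (O.space (m + 1)).gr p) (hb : ∀ y, b y ∈ B.space.gr (k y)) (hx : x ∈ N.hgr r) :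
    s.inducedAct a b x ∈ N.hgr (p + ∑ y, k y + r) := by
  obtain ⟨z, hz, rfl⟩ := hx
  by_cases hp : p = 0
  · subst hp
    have h0 := s.act_cocycle hB ha (gr_zero_d hO ha) b (d_cocycle z)
    rw [s.inducedAct_cls hO hB ha b z ⟨_, h0⟩ rfl]
    exact mem_hgr_cls (s.act_mem 0 k r a b _ ha hb hz)
  · rw [s.inducedAct_apply_of_ne_zero hp ha]
    exact Submodule.zero_mem _

theorem inducedAct_d (hO : O.IsNonpositive) (hB : B.space.d = 0) {m : ℕ} (p : ℤ)
    (k : Fin m → ℤ) (a : O.space (m + 1)) (b : Fin m → B.space) (x : N.HH)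
    (ha : a ∈ (O.space (m + 1)).gr p) :
    (0 : N.HH) = s.inducedAct ((O.space (m + 1)).d a) b x +
      ∑ y, (p + degBefore k y.val).negOnePow •
        s.inducedAct a (Function.update b y (B.space.d (b y))) x +
      (p + ∑ y, k y).negOnePow • s.inducedAct a b 0 := by
  rw [Finset.sum_eq_zero, add_zero, map_zero, smul_zero, add_zero]
  · obtain ⟨z, rfl⟩ := cls_surjective x
    by_cases hp : p + 1 = 0
    · have hda : (O.space (m + 1)).d a ∈ (O.space (m + 1)).gr 0 :=
        hp ▸ (O.space (m + 1)).d_mem p a ha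
      obtain ⟨w, hw⟩ := s.act_d_exact hB ha b (d_cocycle z)
      rw [s.inducedAct_cls hO hB hda b z ⟨N.d w, N.d_d w⟩ hw, eq_comm, cls_eq_zero]
      exact ⟨w, rfl⟩
    · rw [s.inducedAct_apply_of_ne_zero hp ((O.space (m + 1)).d_mem p a ha)]
  · intro y _
    rw [hB, LinearMap.zero_apply, (s.inducedAct a).map_update_zero, LinearMap.zero_apply, smul_zero]

theorem inducedAct_one (hO : O.IsNonpositive) (hB : B.space.d = 0) (b : Fin 0 → B.space)
    (x : N.HH) : s.inducedAct O.one b x = x := by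
  obtain ⟨z, rfl⟩ := cls_surjective x
  exact s.inducedAct_cls hO hB O.one_mem b z z (s.act_one b z).symm

theorem inducedAct_perm (hO : O.IsNonpositive) (hB : B.space.d = 0) {m : ℕ}
    (σ : Equiv.Perm (Fin m)) (k : Fin m → ℤ) (a : O.space (m + 1))
    (b : Fin m → B.space) (x : N.HH) (hb : ∀ y, b y ∈ B.space.gr (k y)) :
    s.inducedAct (O.perm (permLast σ) a) b x = koszul σ k • s.inducedAct a (b ∘ σ.symm) x := by
  obtain ⟨z, rfl⟩ := cls_surjective x
  induction a using DGSpace.proj_induction with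
  | h0 => simp only [map_zero, zero_apply, LinearMap.zero_apply, smul_zero]
  | hadd a a' ha hb => simp only [map_add, add_apply, LinearMap.add_apply, smul_add, ha, hb]
  | hm p a ha =>
    by_cases hp : p = 0
    · subst hp
      have h0 := s.act_cocycle hB ha (gr_zero_d hO ha) (b ∘ σ.symm) (d_cocycle z)
      rw [s.inducedAct_cls hO hB (O.perm_mem _ 0 a ha) b z (koszul σ k • ⟨_, h0⟩), map_sign]
      · congr 1
        exact (s.inducedAct_cls hO hB ha _ z ⟨_, h0⟩ rfl).symm
      · rw [s.act_perm σ k a b _ hb]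
        exact map_sign N.cocycles.subtype _ _
    · rw [s.inducedAct_apply_of_ne_zero hp ha,
        s.inducedAct_apply_of_ne_zero hp (O.perm_mem _ p a ha), smul_zero]

theorem comp_eq_zero (hO : O.IsNonpositive) {l m n : ℕ} (h : n + 1 = l + m) (i : Fin l) {p q : ℤ}
    {a : O.space l} {c : O.space m} (ha : a ∈ (O.space l).gr p) (hc : c ∈ (O.space m).gr q)
    (hpq : ¬(p = 0 ∧ q = 0)) (hs : p + q = 0) : O.comp h i a c = 0 := by
  rcases lt_trichotomy p 0 with hp | hp | hp
  · rw [hO m q (by omega)] at hc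
    rw [(Submodule.mem_bot ℂ).1 hc, map_zero]
  · exact absurd ⟨hp, by omega⟩ hpq
  · rw [hO l p hp] at ha
    rw [(Submodule.mem_bot ℂ).1 ha, map_zero, LinearMap.zero_apply]

theorem inducedAct_comp_eq_zero (hO : O.IsNonpositive) {l m n : ℕ} (h : n + 1 + 1 = l + m)
    (i : Fin l) {p q : ℤ} {a : O.space l} {c : O.space m} (ha : a ∈ (O.space l).gr p)
    (hc : c ∈ (O.space m).gr q) (hpq : ¬(p = 0 ∧ q = 0)) (b : Fin n → B.space) (x : N.HH) :
    s.inducedAct (O.comp h i a c) b x = 0 := by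
  by_cases hs : p + q = 0
  · rw [comp_eq_zero hO h i ha hc hpq hs, map_zero, zero_apply, LinearMap.zero_apply]
  · exact s.inducedAct_apply_of_ne_zero hs (O.comp_mem h i p q a c ha hc) b x

/-- Compared with algebras there is a new case: `B` itself, not a truncated action on it, acts in
the inner slot. Operations on `B` of nonzero degree must therefore already vanish, which is the role
of `hneg`. -/
theorem inducedAct_comp (hO : O.IsNonpositive) (hB : B.space.d = 0)
    (hneg : ∀ (m : ℕ) (q : ℤ) (c : O.space m), q ≠ 0 → c ∈ (O.space m).gr q → B.str.act c = 0)
    {l m n : ℕ} (h : n + 1 = l + m) (h' : n + 1 + 1 = l + 1 + m) (i : Fin l) (q : ℤ)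
    (k : Fin n → ℤ) (a : O.space (l + 1)) (c : O.space m) (b : Fin n → B.space) (x : N.HH)
    (hc : c ∈ (O.space m).gr q) (hb : ∀ y, b y ∈ B.space.gr (k y)) :
    s.inducedAct (O.comp h' i.castSucc a c) b x = (q * degBefore k i.val).negOnePow •
      s.inducedAct a (plug h i b (B.str.act c (b ∘ innerPos h i))) x := by
  obtain ⟨z, rfl⟩ := cls_surjective x
  induction a using DGSpace.proj_induction with
  | h0 => simp only [map_zero, LinearMap.zero_apply, zero_apply, smul_zero]
  | hadd a a' ha hb => simp only [map_add, LinearMap.add_apply, add_apply, smul_add, ha, hb]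
  | hm p a ha =>
    by_cases hpq : p = 0 ∧ q = 0
    · obtain ⟨rfl, rfl⟩ := hpq
      have hac : O.comp h' i.castSucc a c ∈ (O.space (n + 1)).gr 0 := by
        simpa using O.comp_mem h' i.castSucc 0 0 a c ha hc
      have h0 := s.act_cocycle hB ha (gr_zero_d hO ha)
        (plug h i b (B.str.act c (b ∘ innerPos h i))) (d_cocycle z)
      rw [s.inducedAct_cls hO hB hac b z ((0 * degBefore k i.val).negOnePow • ⟨_, h0⟩), map_sign]
      · congr 1
        exact (s.inducedAct_cls hO hB ha _ z ⟨_, h0⟩ rfl).symm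
      · rw [s.act_comp h h' i 0 k a c b _ hc hb]
        exact map_sign N.cocycles.subtype _ _
    · rw [s.inducedAct_comp_eq_zero hO h' _ ha hc hpq]
      by_cases hp : p = 0
      · have hq : q ≠ 0 := fun hq => hpq ⟨hp, hq⟩
        rw [(s.inducedAct a).map_coord_zero i, LinearMap.zero_apply, smul_zero]
        rw [hneg m q c hq hc, zero_apply]
        simp [plug]
      · rw [s.inducedAct_apply_of_ne_zero hp ha, smul_zero]

theorem inducedAct_comp_last (hO : O.IsNonpositive) (hB : B.space.d = 0)
    {l m : ℕ} (h : l + m + 1 + 1 = l + 1 + (m + 1)) (q : ℤ)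
    (k : Fin (l + m) → ℤ) (a : O.space (l + 1)) (c : O.space (m + 1)) (b : Fin (l + m) → B.space)
    (x : N.HH) (hc : c ∈ (O.space (m + 1)).gr q) (hb : ∀ y, b y ∈ B.space.gr (k y)) :
    s.inducedAct (O.comp h (Fin.last l) a c) b x = (q * degBefore k l).negOnePow •
      s.inducedAct a (b ∘ Fin.castAdd m) (s.inducedAct c (b ∘ Fin.natAdd l) x) := by
  obtain ⟨z, rfl⟩ := cls_surjective x
  induction a using DGSpace.proj_induction with
  | h0 => simp only [map_zero, LinearMap.zero_apply, zero_apply, smul_zero]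
  | hadd a a' ha hb => simp only [map_add, LinearMap.add_apply, add_apply, smul_add, ha, hb]
  | hm p a ha =>
    by_cases hpq : p = 0 ∧ q = 0
    · obtain ⟨rfl, rfl⟩ := hpq
      have hac : O.comp h (Fin.last l) a c ∈ (O.space (l + m + 1)).gr 0 := by
        simpa using O.comp_mem h (Fin.last l) 0 0 a c ha hc
      have h0 := s.act_cocycle hB hc (gr_zero_d hO hc) (b ∘ Fin.natAdd l) (d_cocycle z)
      have h1 := s.act_cocycle hB ha (gr_zero_d hO ha) (b ∘ Fin.castAdd m) h0
      rw [s.inducedAct_cls hO hB hac b z ((0 * degBefore k l).negOnePow • ⟨_, h1⟩), map_sign,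
        s.inducedAct_cls hO hB hc _ z ⟨_, h0⟩ rfl]
      · congr 1
        exact (s.inducedAct_cls hO hB ha _ ⟨_, h0⟩ ⟨_, h1⟩ rfl).symm
      · rw [s.act_comp_last h 0 k a c b _ hc hb]
        exact map_sign N.cocycles.subtype _ _
    · rw [s.inducedAct_comp_eq_zero hO h _ ha hc hpq]
      by_cases hp : p = 0
      · have hq : q ≠ 0 := fun hq => hpq ⟨hp, hq⟩
        rw [s.inducedAct_apply_of_ne_zero hq hc, map_zero, smul_zero]
      · rw [s.inducedAct_apply_of_ne_zero hp ha, smul_zero]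

/-- The structure of module on the cohomology in which `O` acts through `H^0(O)`. -/
def induced (hO : O.IsNonpositive) (hB : B.space.d = 0)
    (hneg : ∀ (m : ℕ) (q : ℤ) (c : O.space m), q ≠ 0 → c ∈ (O.space m).gr q → B.str.act c = 0) :
    ModStr B N.cohomology where
  act := s.inducedAct
  act_mem := s.inducedAct_mem hO hB
  act_d p k a b x ha _ := s.inducedAct_d hO hB p k a b x ha
  act_one := s.inducedAct_one hO hB
  act_perm := s.inducedAct_perm hO hB
  act_comp := s.inducedAct_comp hO hB hneg
  act_comp_last := s.inducedAct_comp_last hO hB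

end ModStr

/-! ### Formality of modules with a divisible pure endomorphism -/

namespace DGSpace

variable {V : DGSpace.{u}} {ξ m : ℝ} {f : Hom V V}

/-- With zero differential the map `φ` identifies the cohomology with `V` itself, compatibly with
`f`, so purity decomposes `V` and not merely its cohomology. -/
theorem mem_span_pureGen (hV : V.d = 0) (hp : IsPure ξ m V f) {n : ℤ} {x : V} (hx : x ∈ V.gr n) :
    x ∈ Submodule.span ℂ (pureGen ξ m f n) := by
  have hd : ∀ x, V.d x = 0 := fun x => by rw [hV, LinearMap.zero_apply]
  let φ : V.HH →ₗ[ℂ] V := V.coboundaries.liftQ V.cocycles.subtype (by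
    rintro z ⟨w, hw⟩
    rw [LinearMap.mem_ker, ← hw, hd])
  have hφ : ∀ h, f.lin (φ h) = φ (f.onCohomology h) := fun h => by
    obtain ⟨z, rfl⟩ := cls_surjective h
    rfl
  have hle : (⨆ α ∈ {α : ℂ | ‖α‖ = ξ ^ ((n : ℝ) + m)},
      V.hgr n ⊓ Module.End.maxGenEigenspace f.onCohomology α) ≤
      (Submodule.span ℂ (pureGen ξ m f n)).comap φ := by
    refine iSup₂_le fun α hα h hh => Submodule.subset_span ⟨?_, hd _, α, hα, ?_⟩
    · obtain ⟨z, hz, rfl⟩ := hh.1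
      exact hz
    · have := multilinear_mem_maxGenEigenspace' (ι := Unit)
        (MultilinearMap.ofSubsingleton ℂ V.HH V.carrier () φ) f.onCohomology f.lin
        (fun b => hφ _) (fun _ => α) (fun _ => h) (fun _ => hh.2)
      simpa using this
  exact hle (GradedPure.mem_iSup hp (mem_hgr_cls (x := ⟨x, hd x⟩) hx))

theorem span_pureGen_eq_top (hV : V.d = 0) (hp : IsPure ξ m V f) (x : V) :
    x ∈ Submodule.span ℂ {x | ∃ n, x ∈ pureGen ξ m f n} := by
  induction x using DGSpace.proj_induction with
  | h0 => exact Submodule.zero_mem _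
  | hadd x y hx hy => exact Submodule.add_mem _ hx hy
  | hm k x hx =>
    have hle : pureGen ξ m f k ⊆ {x | ∃ n, x ∈ pureGen ξ m f n} := fun x hx => ⟨k, hx⟩
    exact Submodule.span_mono hle (mem_span_pureGen hV hp hx)

end DGSpace

namespace Alg

open DGSpace

variable {O : DGOperad.{u}} {ξ : ℝ} {B : Alg O} {F : Alg.Hom B B}

/-- Operations of nonzero degree vanish on a pure algebra with zero differential. -/
theorem act_eq_zero (hξ : 0 < ξ) (hξ1 : ξ ≠ 1) (hB : B.space.d = 0)
    (hp : IsPure ξ 0 B.space F.toHom) (n : ℕ) (q : ℤ) (a : O.space n) (hq : q ≠ 0)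
    (ha : a ∈ (O.space n).gr q) : B.str.act a = 0 := by
  ext v
  refine multilinear_mem_of_mem_span (B.str.act a) (fun _ => _) ⊥ ?_ v
    fun y => span_pureGen_eq_top hB hp (v y)
  intro v hv
  choose k hk hd α hα hvα using hv
  have hz : B.space.d (B.str.act a v) = 0 := by rw [hB, LinearMap.zero_apply]
  have h0 : B.space.cls ⟨_, hz⟩ = 0 := by
    rw [← Submodule.mem_bot ℂ, ← GradedPure.inf_maxGenEigenspace_eq_bot hp (n := q + ∑ y, k y)
      (α := ∏ y, α y)]
    · exact ⟨mem_hgr_cls (B.str.act_mem q k a v ha hk),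
        cls_mem_maxGenEigenspace F.toHom (act_mem_maxGenEigenspace F a hvα)⟩
    · rw [norm_prod_eq_rpow hξ hα]
      intro h
      have := weight_injective hξ hξ1 h
      omega
  obtain ⟨w, hw⟩ := cls_eq_zero.1 h0
  rw [hB, LinearMap.zero_apply] at hw
  exact hw.symm

end Alg

namespace Mod

open DGSpace

variable {O : DGOperad.{u}} {ξ m : ℝ} {B : Alg O} {F : Alg.Hom B B}

/-- The endomorphism `S` of the complex `X` is compatible with the action of `B` along the
endomorphism `F` of `B`. -/
def Semilinear (X : Mod B) (F : Alg.Hom B B) (S : DGSpace.Hom X.space X.space) : Prop :=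
  ∀ (l : ℕ) (a : O.space (l + 1)) (b : Fin l → B.space) (x : X.space),
    S.lin (X.str.act a b x) = X.str.act a (fun y => F.lin (b y)) (S.lin x)

variable {X : Mod B} {S : DGSpace.Hom X.space X.space} {n : ℕ} {p r : ℤ} {k : Fin n → ℤ}
  {a : O.space (n + 1)} {b : Fin n → B.space} {x : X.space}

theorem norm_prod_mul_eq_rpow (hξ : 0 < ξ) {β : Fin n → ℂ} {α : ℂ} {j : ℤ}
    (h : ∀ y, ‖β y‖ = ξ ^ ((k y : ℝ) + 0)) (hα : ‖α‖ = ξ ^ ((j : ℝ) + m)) :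
    ‖(∏ y, β y) * α‖ = ξ ^ (((∑ y, k y + j : ℤ) : ℝ) + m) := by
  rw [norm_mul, norm_prod_eq_rpow hξ h, hα, ← Real.rpow_add hξ]
  push_cast
  ring_nf

theorem Semilinear.act_mem_maxGenEigenspace (hS : X.Semilinear F S) (a : O.space (n + 1))
    {β : Fin n → ℂ} {α : ℂ} (hb : ∀ y, b y ∈ Module.End.maxGenEigenspace F.lin (β y))
    (hx : x ∈ Module.End.maxGenEigenspace S.lin α) :
    X.str.act a b x ∈ Module.End.maxGenEigenspace S.lin ((∏ y, β y) * α) :=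
  multilinear_mem_maxGenEigenspace (X.str.act a) F.lin S.lin S.lin (hS n a) β α b x hb hx

/-- Elements of `B` in `pureGen` have excess zero, so the excess of the result is that of `x` minus
`p`. -/
theorem Semilinear.act_mem_posGen (hS : X.Semilinear F S) (hξ : 0 < ξ)
    (ha : a ∈ (O.space (n + 1)).gr p) (hp : p ≤ 0) (hb : ∀ y, b y ∈ pureGen ξ 0 F.toHom (k y))
    (hx : x ∈ pureGen ξ m S r ∪ posGen ξ m S r) (h : p < 0 ∨ x ∈ posGen ξ m S r) :
    X.str.act a b x ∈ posGen ξ m S (p + ∑ y, k y + r) := by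
  choose hk _ β hβ hbβ using hb
  obtain ⟨hn, j, α, hj, hα, hxα, hpos, -⟩ := exists_weight hx
  refine ⟨X.str.act_mem p k r a b x ha hk hn, ∑ y, k y + j, (∏ y, β y) * α, ?_,
    norm_prod_mul_eq_rpow hξ hβ hα, hS.act_mem_maxGenEigenspace a hbβ hxα⟩
  rcases h with h | h
  · omega
  · have := hpos h
    omega

theorem Semilinear.act_mem_pureGen (hS : X.Semilinear F S) (hO : O.IsNonpositive)
    (hB : B.space.d = 0) (hξ : 0 < ξ) (ha : a ∈ (O.space (n + 1)).gr 0)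
    (hb : ∀ y, b y ∈ pureGen ξ 0 F.toHom (k y)) (hx : x ∈ pureGen ξ m S r) :
    X.str.act a b x ∈ pureGen ξ m S (0 + ∑ y, k y + r) := by
  choose hk _ β hβ hbβ using hb
  obtain ⟨hn, hd, α, hα, hxα⟩ := hx
  refine ⟨X.str.act_mem 0 k r a b x ha hk hn, X.str.act_cocycle hB ha (gr_zero_d hO ha) b hd,
    (∏ y, β y) * α, ?_, hS.act_mem_maxGenEigenspace a hbβ hxα⟩
  rw [zero_add]
  exact norm_prod_mul_eq_rpow hξ hβ hα

/-- Because `B` is spanned by pure eigenvectors, the whole of `B` acts on the truncation; no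
truncation of `B` is needed. -/
theorem Semilinear.act_mem_truncGr (hS : X.Semilinear F S) (hO : O.IsNonpositive)
    (hB : B.space.d = 0) (hF : IsPure ξ 0 B.space F.toHom) (hξ : 0 < ξ) (p : ℤ) (k : Fin n → ℤ)
    (r : ℤ) (a : O.space (n + 1)) (b : Fin n → B.space) (x : X.space)
    (ha : a ∈ (O.space (n + 1)).gr p) (hb : ∀ y, b y ∈ B.space.gr (k y))
    (hx : x ∈ truncGr ξ m S r) : X.str.act a b x ∈ truncGr ξ m S (p + ∑ y, k y + r) := by
  refine multilinear_apply_mem_of_mem_span (X.str.act a) _ _ _ ?_ b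
    (fun y => mem_span_pureGen hB hF (hb y)) x hx
  intro b hb x hx
  rcases lt_trichotomy p 0 with hp | rfl | hp
  · exact Submodule.subset_span (Or.inr (hS.act_mem_posGen hξ ha hp.le hb hx (Or.inl hp)))
  · rcases hx with hx | hx
    · exact Submodule.subset_span (Or.inl (hS.act_mem_pureGen hO hB hξ ha hb hx))
    · exact Submodule.subset_span
        (Or.inr (hS.act_mem_posGen hξ ha le_rfl hb (Or.inr hx) (Or.inr hx)))
  · rw [hO (n + 1) p hp] at ha
    rw [(Submodule.mem_bot ℂ).1 ha, map_zero, zero_apply, LinearMap.zero_apply]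
    exact Submodule.zero_mem _

/-- The operations on the weight truncation. -/
def truncAct (hS : X.Semilinear F S) (hO : O.IsNonpositive) (hB : B.space.d = 0)
    (hF : IsPure ξ 0 B.space F.toHom) (hξ : 0 < ξ) (m : ℝ) (n : ℕ) :
    O.space (n + 1) →ₗ[ℂ] MultilinearMap ℂ (fun _ : Fin n => B.space.carrier)
      ((DGSpace.trunc ξ m S).carrier →ₗ[ℂ] (DGSpace.trunc ξ m S).carrier) :=
  ModStr.restrictAct X.str.act (⨆ n, truncGr ξ m S n)
    (ModStr.act_mem_iSup X.str.act _ (hS.act_mem_truncGr hO hB hF hξ))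

/-- The weight truncation as a module. -/
def trunc (hS : X.Semilinear F S) (hO : O.IsNonpositive) (hB : B.space.d = 0)
    (hF : IsPure ξ 0 B.space F.toHom) (hξ : 0 < ξ) (m : ℝ) : Mod B where
  space := DGSpace.trunc ξ m S
  str := ModStr.ofJointlyInjective hB _ (fun _ : Unit => X) (fun _ => (DGSpace.truncIncl ξ m S).lin)
    (fun _ _ h => truncIncl_injective ξ m S (h ())) (truncAct hS hO hB hF hξ m _)
    (fun _ _ _ _ => rfl) (fun p k r a b _ ha hb hx => hS.act_mem_truncGr hO hB hF hξ p k r a b _ ha hb hx)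
    (fun p k a b x ha hb => truncIncl_injective ξ m S (by
      rw [map_add, map_sign]
      exact X.str.act_d_of_d_eq_zero hB _ ha hb))

/-- The inclusion of the weight truncation. -/
def truncIncl (hS : X.Semilinear F S) (hO : O.IsNonpositive) (hB : B.space.d = 0)
    (hF : IsPure ξ 0 B.space F.toHom) (hξ : 0 < ξ) (m : ℝ) :
    Mod.Hom (trunc hS hO hB hF hξ m) X where
  toHom := DGSpace.truncIncl ξ m S
  map_act _ _ _ := rfl

/-- The cohomology of a module, with `O` acting through `H^0(O)`. -/
def cohomology (X : Mod B) (hO : O.IsNonpositive) (hB : B.space.d = 0)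
    (hF : IsPure ξ 0 B.space F.toHom) (hξ : 0 < ξ) (hξ1 : ξ ≠ 1) : Mod B where
  space := X.space.cohomology
  str := X.str.induced hO hB (Alg.act_eq_zero hξ hξ1 hB hF)

theorem truncProjLin_act_of_gen (hS : X.Semilinear F S) (hO : O.IsNonpositive)
    (hB : B.space.d = 0) (hF : IsPure ξ 0 B.space F.toHom) (hξ : 0 < ξ) (hξ1 : ξ ≠ 1)
    (ha : a ∈ (O.space (n + 1)).gr p) (hb : ∀ y, b y ∈ pureGen ξ 0 F.toHom (k y))
    (x : DGSpace.trunc ξ m S)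
    (hx : (DGSpace.truncIncl ξ m S).lin x ∈ pureGen ξ m S r ∪ posGen ξ m S r) :
    truncProjLin m S hξ hξ1 (truncAct hS hO hB hF hξ m n a b x) =
      X.str.inducedAct a b (truncProjLin m S hξ hξ1 x) := by
  rcases lt_or_ge 0 p with hp | hp
  · rw [hO (n + 1) p hp] at ha
    simp only [(Submodule.mem_bot ℂ).1 ha, map_zero, zero_apply, LinearMap.zero_apply]
  by_cases h : p < 0 ∨ (DGSpace.truncIncl ξ m S).lin x ∈ posGen ξ m S r
  · rw [truncProjLin_pos hξ hξ1 (hS.act_mem_posGen hξ ha hp hb hx h)]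
    rcases h with h | hy
    · rw [X.str.inducedAct_apply_of_ne_zero h.ne ha]
    · rw [truncProjLin_pos hξ hξ1 hy, map_zero]
  · push Not at h
    obtain rfl : p = 0 := le_antisymm hp h.1
    have hx' := hx.resolve_right h.2
    rw [truncProjLin_pure hξ hξ1 (hS.act_mem_pureGen hO hB hξ ha hb hx'),
      truncProjLin_pure hξ hξ1 hx']
    exact (X.str.inducedAct_cls hO hB ha b _ _ rfl).symm

theorem truncProjLin_act (hS : X.Semilinear F S) (hO : O.IsNonpositive)
    (hB : B.space.d = 0) (hF : IsPure ξ 0 B.space F.toHom) (hξ : 0 < ξ) (hξ1 : ξ ≠ 1)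
    (a : O.space (n + 1)) (b : Fin n → B.space) (x : DGSpace.trunc ξ m S) :
    truncProjLin m S hξ hξ1 (truncAct hS hO hB hF hξ m n a b x) =
      X.str.inducedAct a b (truncProjLin m S hξ hξ1 x) := by
  induction a using DGSpace.proj_induction with
  | h0 => simp only [map_zero, zero_apply, LinearMap.zero_apply]
  | hadd a a' ha hb => simp only [map_add, add_apply, LinearMap.add_apply, ha, hb]
  | hm p a ha =>
    let f : MultilinearMap ℂ (fun _ : Fin n => B.space.carrier)
        ((DGSpace.trunc ξ m S).carrier →ₗ[ℂ] X.space.HH) :=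
      (LinearMap.compRight ℂ (truncProjLin m S hξ hξ1)).compMultilinearMap
          (truncAct hS hO hB hF hξ m n a) -
        (LinearMap.lcomp ℂ X.space.HH (truncProjLin m S hξ hξ1)).compMultilinearMap
          (X.str.inducedAct a)
    refine sub_eq_zero.1 (multilinear_apply_mem_of_mem_span f (fun _ => _) _ ⊥ ?_ b
      (fun y => span_pureGen_eq_top hB hF (b y)) x (by rw [span_gen]; trivial))
    intro b hb x hx
    choose k hk using hb
    obtain ⟨r, hr⟩ := hx
    exact sub_eq_zero.2 (truncProjLin_act_of_gen hS hO hB hF hξ hξ1 ha hk x hr)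

/-- The projection of the weight truncation to the cohomology. -/
def truncProj (hS : X.Semilinear F S) (hO : O.IsNonpositive) (hB : B.space.d = 0)
    (hF : IsPure ξ 0 B.space F.toHom) (hξ : 0 < ξ) (hξ1 : ξ ≠ 1) (m : ℝ) :
    Mod.Hom (trunc hS hO hB hF hξ m) (X.cohomology hO hB hF hξ hξ1) where
  toHom := DGSpace.truncProj m S hξ hξ1
  map_act := truncProjLin_act hS hO hB hF hξ hξ1

/-- The map induced on cohomology by a morphism of modules. -/
def Hom.cohomologyMap {M N : Mod B} (f : Mod.Hom M N) (hO : O.IsNonpositive) (hB : B.space.d = 0)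
    (hF : IsPure ξ 0 B.space F.toHom) (hξ : 0 < ξ) (hξ1 : ξ ≠ 1) :
    Mod.Hom (M.cohomology hO hB hF hξ hξ1) (N.cohomology hO hB hF hξ hξ1) where
  toHom := f.toHom.cohomologyMap
  map_act {n} a b x := by
    change f.onCohomology (M.str.inducedAct a b x) = N.str.inducedAct a b (f.onCohomology x)
    obtain ⟨z, rfl⟩ := cls_surjective x
    induction a using DGSpace.proj_induction with
    | h0 => simp only [map_zero, zero_apply, LinearMap.zero_apply]
    | hadd a a' ha hb => simp only [map_add, add_apply, LinearMap.add_apply, ha, hb]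
    | hm p a ha =>
      by_cases hp : p = 0
      · subst hp
        have h0 := M.str.act_cocycle hB ha (gr_zero_d hO ha) b (d_cocycle z)
        rw [M.str.inducedAct_cls hO hB ha b z ⟨_, h0⟩ rfl, Hom.onCohomology_cls]
        exact (N.str.inducedAct_cls hO hB ha b (f.onCocycles z) _ (f.map_act a b _)).symm
      · rw [M.str.inducedAct_apply_of_ne_zero hp ha, N.str.inducedAct_apply_of_ne_zero hp ha,
          map_zero]

/-- A quasi-isomorphism becomes an isomorphism in the derived category. -/
def isoOfQuasiIso {M N : Mod B} (f : Mod.Hom M N) (hf : f.toHom.IsQuasiIso) :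
    (toD B).obj M ≅ (toD B).obj N :=
  Localization.isoOfHom (toD B) (quasiIso B) (show M ⟶ N from f) hf

theorem nonempty_iso_cohomology (hO : O.IsNonpositive) (hB : B.space.d = 0)
    (hF : IsPure ξ 0 B.space F.toHom) (hξ : 0 < ξ) (hξ1 : ξ ≠ 1) {N : Mod B}
    (c : Mod.Hom N X) (hc : c.toHom.IsQuasiIso) (hS : X.Semilinear F S) (hSd : S.IsDivisible)
    (hp : IsPure ξ m X.space S) :
    Nonempty ((toD B).obj N ≅ (toD B).obj (N.cohomology hO hB hF hξ hξ1)) :=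
  ⟨isoOfQuasiIso c hc ≪≫
    (isoOfQuasiIso (truncIncl hS hO hB hF hξ m) (truncIncl_isQuasiIso hξ hξ1 hSd hp)).symm ≪≫
    isoOfQuasiIso (truncProj hS hO hB hF hξ hξ1 m) (truncProj_isQuasiIso hξ hξ1 hSd hp) ≪≫
    (isoOfQuasiIso (c.cohomologyMap hO hB hF hξ hξ1)
      (DGSpace.Hom.isQuasiIso_of_bijective _ hc rfl)).symm⟩

theorem Semilinear.cohAct_onCohomology (hS : X.Semilinear F S) (hB : B.space.d = 0)
    (ha : a ∈ (O.space (n + 1)).gr p) (hd : (O.space (n + 1)).d a = 0) (b : Fin n → B.space)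
    (h : X.space.HH) : S.onCohomology (X.str.cohAct a b h) =
      X.str.cohAct a (fun y => F.lin (b y)) (S.onCohomology h) := by
  obtain ⟨z, rfl⟩ := cls_surjective h
  have h0 := X.str.act_cocycle hB ha hd b (d_cocycle z)
  rw [X.str.cohAct_cls hB ha hd b z ⟨_, h0⟩ rfl, Hom.onCohomology_cls, Hom.onCohomology_cls]
  exact (X.str.cohAct_cls hB ha hd _ (S.onCocycles z) _ (hS n a b z)).symm

/-- Cocycles of nonzero degree act trivially on pure cohomology. -/
theorem Semilinear.cohAct_eq_zero (hS : X.Semilinear F S) (hB : B.space.d = 0)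
    (hF : IsPure ξ 0 B.space F.toHom) (hξ : 0 < ξ) (hξ1 : ξ ≠ 1) (hp : IsPure ξ m X.space S)
    (hp0 : p ≠ 0) (ha : a ∈ (O.space (n + 1)).gr p) (hd : (O.space (n + 1)).d a = 0) :
    X.str.cohAct a = 0 := by
  refine MultilinearMap.ext fun b => LinearMap.ext fun h => ?_
  refine multilinear_apply_mem_of_mem_span (X.str.cohAct a) (fun _ => _) _ ⊥ ?_ b
    (fun y => span_pureGen_eq_top hB hF (b y)) h (by rw [Alg.span_eigenclasses hp]; trivial)
  rintro b hb h ⟨r, α, hr, hα, hhα⟩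
  choose k hk _ β hβ hbβ using hb
  have h1 : X.str.cohAct a b h ∈ X.space.hgr (p + ∑ y, k y + r) := by
    obtain ⟨z, hz, rfl⟩ := hr
    have h0 := X.str.act_cocycle hB ha hd b (d_cocycle z)
    rw [X.str.cohAct_cls hB ha hd b z ⟨_, h0⟩ rfl]
    exact mem_hgr_cls (X.str.act_mem p k r a b _ ha hk hz)
  have h2 := multilinear_mem_maxGenEigenspace (X.str.cohAct a) F.lin S.onCohomology S.onCohomology
    (hS.cohAct_onCohomology hB ha hd) β α b h hbβ hhα
  -- The weight index of the result is `∑ k + r`, while its degree is `p + ∑ k + r`; purity excludes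
  -- this for `p ≠ 0`.
  rw [← GradedPure.inf_maxGenEigenspace_eq_bot hp (n := p + ∑ y, k y + r) (α := (∏ y, β y) * α)]
  · exact ⟨h1, h2⟩
  · rw [norm_prod_mul_eq_rpow hξ hβ hα]
    intro h
    have := weight_injective hξ hξ1 h
    omega

theorem isInduced_of_isPure (hO : O.IsNonpositive) (hB : B.space.d = 0)
    (hF : IsPure ξ 0 B.space F.toHom) (hξ : 0 < ξ) (hξ1 : ξ ≠ 1) (hS : X.Semilinear F S)
    (hp : IsPure ξ m X.space S) :
    X.IsInduced (X.str.induced hO hB (Alg.act_eq_zero hξ hξ1 hB hF)) where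
  act_cls {n} a had b x w _ hw := by
    have had : (O.space (n + 1)).d a = 0 := had
    change X.str.inducedAct a b (X.space.cls x) = X.space.cls w
    obtain ⟨s, hs⟩ := (O.space (n + 1)).proj_sum a
    have hpd : ∀ i, (O.space (n + 1)).d ((O.space (n + 1)).proj i a) = 0 := fun i => by
      rw [← (O.space (n + 1)).proj_d, had, map_zero]
    have hc : ∀ i, X.space.d (X.str.act ((O.space (n + 1)).proj i a) b x) = 0 :=
      fun i => X.str.act_cocycle hB ((O.space (n + 1)).proj_mem i a) (hpd i) _ (d_cocycle x)
    have hwz : w = ∑ i ∈ s, ⟨_, hc i⟩ := by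
      refine Subtype.ext ?_
      rw [hw, AddSubmonoidClass.coe_finsetSum]
      conv_lhs => rw [hs, map_sum, sum_apply, LinearMap.sum_apply]
    rw [hwz, map_sum]
    conv_lhs => rw [hs, map_sum, sum_apply, LinearMap.sum_apply]
    refine Finset.sum_congr rfl fun i _ => ?_
    rw [← X.str.cohAct_cls hB ((O.space (n + 1)).proj_mem i a) (hpd i) b x ⟨_, hc i⟩ rfl]
    by_cases hi : i = 0
    · subst hi
      rw [X.str.inducedAct_of_zero ((O.space (n + 1)).proj_mem 0 a)]
    · rw [X.str.inducedAct_of_ne_zero hi ((O.space (n + 1)).proj_mem i a),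
        hS.cohAct_eq_zero hB hF hξ hξ1 hp hi ((O.space (n + 1)).proj_mem i a) (hpd i)]
  act_neg {n} p a hp ha := X.str.inducedAct_of_ne_zero hp.ne ha

end Mod

/-! ### The mapping telescope of an endomorphism -/

namespace DGSpace

variable {V : DGSpace.{u}} (f : Hom V V)

variable (V) in
/-- The sequences of elements of `V_i ⊕ V_{i - 1}`. -/
def telGr (i : ℤ) : Submodule ℂ (ℕ → V.carrier × V.carrier) where
  carrier := {γ | ∀ n, (γ n).1 ∈ V.gr i ∧ (γ n).2 ∈ V.gr (i - 1)}
  add_mem' hx hy n := ⟨Submodule.add_mem _ (hx n).1 (hy n).1, Submodule.add_mem _ (hx n).2 (hy n).2⟩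
  zero_mem' _ := ⟨Submodule.zero_mem _, Submodule.zero_mem _⟩
  smul_mem' c _ hx n := ⟨Submodule.smul_mem _ c (hx n).1, Submodule.smul_mem _ c (hx n).2⟩

/-- The differential of the telescope. -/
def telD : (ℕ → V.carrier × V.carrier) →ₗ[ℂ] (ℕ → V.carrier × V.carrier) :=
  LinearMap.pi fun n => (V.d ∘ₗ LinearMap.fst ℂ _ _ ∘ₗ LinearMap.proj n).prod
    (V.d ∘ₗ LinearMap.snd ℂ _ _ ∘ₗ LinearMap.proj n + V.parity ∘ₗ
      (LinearMap.fst ℂ _ _ ∘ₗ LinearMap.proj (n + 1) -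
        f.lin ∘ₗ LinearMap.fst ℂ _ _ ∘ₗ LinearMap.proj n))

theorem telD_apply (γ : ℕ → V.carrier × V.carrier) (n : ℕ) : telD f γ n =
    (V.d (γ n).1, V.d (γ n).2 + V.parity ((γ (n + 1)).1 - f.lin (γ n).1)) := rfl

variable (V) in
theorem telGr_iSupIndep : iSupIndep V.telGr := by
  refine iSupIndep_of_proj _
    (fun i => ((V.proj i).prodMap (V.proj (i - 1))).compLeft ℕ) ?_ ?_
  · intro i x hx
    exact funext fun n => Prod.ext (V.proj_same i _ (hx n).1) (V.proj_same _ _ (hx n).2)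
  · intro i j h x hx
    exact funext fun n => Prod.ext (V.proj_ne h _ (hx n).1) (V.proj_ne (by omega) _ (hx n).2)

theorem telD_mem (i : ℤ) (γ : ℕ → V.carrier × V.carrier) (h : γ ∈ V.telGr i) :
    telD f γ ∈ V.telGr (i + 1) := fun n => by
  refine ⟨V.d_mem _ _ (h n).1, Submodule.add_mem _ ?_ ?_⟩
  · have := V.d_mem _ _ (h n).2
    rwa [show i - 1 + 1 = i + 1 - 1 by ring] at this
  · rw [add_sub_cancel_right]
    exact parity_mem (Submodule.sub_mem _ (h (n + 1)).1 (f.map_mem _ _ (h n).1))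

/-- The mapping telescope of the endomorphism `f`: the cocycles are the sequences in which each term
is identified, up to a chosen homotopy, with the image under `f` of the preceding one. -/
def tel : DGSpace.{u} :=
  ofFamily (telD f) V.telGr V.telGr_iSupIndep (telD_mem f) fun γ => funext fun n => by
    rw [telD_apply, telD_apply, telD_apply]
    refine Prod.ext (V.d_d _) ?_
    change V.d (V.d _ + V.parity _) + V.parity (V.d _ - f.lin (V.d _)) = 0
    rw [map_add, V.d_d, d_parity, map_sub V.d, f.map_d, zero_add, neg_add_cancel]

/-- The `n`-th term of an element of the telescope. -/
def telTerm (n : ℕ) : (tel f).carrier →ₗ[ℂ] V.carrier :=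
  LinearMap.fst ℂ _ _ ∘ₗ LinearMap.proj n ∘ₗ (⨆ i, V.telGr i).subtype

/-- The `n`-th homotopy of an element of the telescope. -/
def telHtpy (n : ℕ) : (tel f).carrier →ₗ[ℂ] V.carrier :=
  LinearMap.snd ℂ _ _ ∘ₗ LinearMap.proj n ∘ₗ (⨆ i, V.telGr i).subtype

variable {f}

theorem tel_ext {x y : tel f} (h : ∀ n, telTerm f n x = telTerm f n y)
    (h' : ∀ n, telHtpy f n x = telHtpy f n y) : x = y :=
  Subtype.ext (funext fun n => Prod.ext (h n) (h' n))

theorem telTerm_d (n : ℕ) (x : tel f) : telTerm f n ((tel f).d x) = V.d (telTerm f n x) := rfl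

theorem telHtpy_d (n : ℕ) (x : tel f) : telHtpy f n ((tel f).d x) =
    V.d (telHtpy f n x) + V.parity (telTerm f (n + 1) x - f.lin (telTerm f n x)) := rfl

theorem exists_telTerm_eq {i : ℤ} {γ η : ℕ → V} (h : ∀ n, γ n ∈ V.gr i)
    (h' : ∀ n, η n ∈ V.gr (i - 1)) : ∃ x ∈ (tel f).gr i,
      (∀ n, telTerm f n x = γ n) ∧ ∀ n, telHtpy f n x = η n :=
  ⟨⟨fun n => (γ n, η n), Submodule.mem_iSup_of_mem i fun n => ⟨h n, h' n⟩⟩, fun n => ⟨h n, h' n⟩,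
    fun _ => rfl, fun _ => rfl⟩

variable (f)

/-- The shift of the telescope. -/
def telShift : Hom (tel f) (tel f) where
  lin := (LinearMap.funLeft ℂ (V.carrier × V.carrier) Nat.succ).restrict
      (p := ⨆ i, V.telGr i) (q := ⨆ i, V.telGr i) fun x hx => by
    have hle : (⨆ i, V.telGr i) ≤ (⨆ i, V.telGr i).comap
        (LinearMap.funLeft ℂ (V.carrier × V.carrier) Nat.succ) :=
      iSup_le fun i x hx => Submodule.mem_iSup_of_mem i fun n => hx (n + 1)
    exact hle hx
  map_mem _ _ hx n := hx (n + 1)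
  map_d _ := rfl

/-- The orbits, as elements of the telescope. -/
def telConst : Hom V (tel f) where
  lin := (LinearMap.pi fun n => LinearMap.inl ℂ V.carrier V.carrier ∘ₗ (f.iter n).lin).codRestrict
      (⨆ i, V.telGr i) fun x => by
    induction x using proj_induction with
    | h0 => rw [map_zero]; exact Submodule.zero_mem _
    | hadd x y hx hy => rw [map_add]; exact Submodule.add_mem _ hx hy
    | hm i x hx =>
      exact Submodule.mem_iSup_of_mem i fun n => ⟨(f.iter n).map_mem i x hx, Submodule.zero_mem _⟩
  map_mem i x hx n := ⟨(f.iter n).map_mem i x hx, Submodule.zero_mem _⟩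
  map_d x := tel_ext (fun n => (f.iter n).map_d x) fun n => by
    rw [telHtpy_d]
    change 0 = V.d 0 + V.parity ((f.iter (n + 1)).lin x - f.lin ((f.iter n).lin x))
    rw [Hom.iter_succ, sub_self, map_zero, map_zero, add_zero]

variable {f}

theorem telTerm_telConst (n : ℕ) (x : V) :
    telTerm f n ((telConst f).lin x) = (f.iter n).lin x := rfl

theorem telHtpy_telConst (n : ℕ) (x : V) : telHtpy f n ((telConst f).lin x) = 0 := rfl

theorem telConst_shift (x : V) : (telConst f).lin (f.lin x) = (telShift f).lin ((telConst f).lin x) :=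
  tel_ext (fun n => (Hom.iter_succ' (F := f) n x).symm) fun _ => rfl

/-- Terms and homotopies of the telescope are subject to no matching condition, so the recursion `y
(n + 1) = α y n + x n` may start at zero. -/
theorem telShift_isDivisible : (telShift f).IsDivisible := by
  intro α _ i x hx
  let γ : ℕ → V := fun n => Nat.rec 0 (fun n y => α • y + telTerm f n x) n
  let η : ℕ → V := fun n => Nat.rec 0 (fun n y => α • y + telHtpy f n x) n
  obtain ⟨y, hy, hyγ, hyη⟩ := exists_telTerm_eq (f := f) (i := i) (γ := γ) (η := η)
    (fun n => by
      induction n with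
      | zero => exact Submodule.zero_mem _
      | succ n ih => exact Submodule.add_mem _ (Submodule.smul_mem _ _ ih) (hx n).1)
    (fun n => by
      induction n with
      | zero => exact Submodule.zero_mem _
      | succ n ih => exact Submodule.add_mem _ (Submodule.smul_mem _ _ ih) (hx n).2)
  refine ⟨y, hy, tel_ext (fun n => ?_) fun n => ?_⟩
  · rw [map_sub, map_smul]
    change telTerm f (n + 1) y - _ = _
    rw [hyγ, hyγ]
    exact add_sub_cancel_left _ _
  · rw [map_sub, map_smul]
    change telHtpy f (n + 1) y - _ = _
    rw [hyη, hyη]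
    exact add_sub_cancel_left _ _

theorem parity_parity (x : V) : V.parity (V.parity x) = x := by
  induction x using V.proj_induction with
  | h0 => simp only [map_zero]
  | hadd x y hx hy => simp only [map_add, hx, hy]
  | hm i x hx =>
    rw [parity_apply hx, map_sign, parity_apply hx, smul_smul, Int.units_mul_self, one_smul]

/-- A closed element records that each term differs from the image under `f` of the preceding one by
an explicit coboundary. Summing these along `f` shows that the `n`-th term differs from `f^n` of the
initial term by a coboundary `d (z n)`. -/
theorem telConst_isQuasiIso : (telConst f).IsQuasiIso := by
  refine Hom.isQuasiIso_of_homogeneous _ ?_ ?_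
  · rintro n x - - ⟨η, hη⟩
    exact ⟨telTerm f 0 η, by rw [← telTerm_d, hη]; rfl⟩
  · intro i x hx hd
    have hd1 : ∀ n, V.d (telTerm f n x) = 0 := fun n => by rw [← telTerm_d, hd, map_zero]
    have hd2 : ∀ n, V.d (telHtpy f n x) =
        -V.parity (telTerm f (n + 1) x - f.lin (telTerm f n x)) := fun n =>
      eq_neg_of_add_eq_zero_left (by rw [← telHtpy_d, hd, map_zero])
    let z : ℕ → V := fun n => Nat.rec 0 (fun n y => f.lin y + V.parity (telHtpy f n x)) n
    have hz : ∀ n, z (n + 1) = f.lin (z n) + V.parity (telHtpy f n x) := fun n => rfl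
    have hzd : ∀ n, V.d (z n) = telTerm f n x - (f.iter n).lin (telTerm f 0 x) := fun n => by
      induction n with
      | zero => exact (map_zero _).trans (sub_self _).symm
      | succ n ih =>
        rw [hz, map_add, ← f.map_d, ih, d_parity, hd2, map_neg, neg_neg, parity_parity, map_sub,
          Hom.iter_succ]
        abel
    -- The primitive has zero homotopies: the recursion for `z` makes `parity (z (n + 1) - f (z n))`
    -- equal to the given homotopy, as `parity` is an involution.
    obtain ⟨y, -, hyz, hy0⟩ := exists_telTerm_eq (f := f) (i := i - 1) (γ := z) (η := 0)
      (fun n => by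
        induction n with
        | zero => exact Submodule.zero_mem _
        | succ n ih => exact Submodule.add_mem _ (f.map_mem _ _ ih) (parity_mem (hx n).2))
      (fun n => Submodule.zero_mem _)
    refine ⟨telTerm f 0 x, hd1 0, -y, tel_ext (fun n => ?_) fun n => ?_⟩
    · rw [map_neg, map_neg, telTerm_d, hyz, hzd, map_sub, telTerm_telConst, neg_sub]
    · rw [map_neg, map_neg, telHtpy_d, hy0, hyz, hyz, hz, add_sub_cancel_left, parity_parity,
        map_sub, telHtpy_telConst, zero_sub, Pi.zero_apply, map_zero, zero_add]

end DGSpace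

/-! ### The telescope as a module. -/

namespace Mod

open DGSpace

variable {O : DGOperad.{u}} {B : Alg O}

/-- The restriction of a module along an endomorphism of the algebra. -/
def pull (N : Mod B) (G : Alg.Hom B B) : Mod B where
  space := N.space
  str :=
    { act := MultilinearMap.compLinearMapₗ (fun _ => G.lin) ∘ₗ N.str.act
      act_mem := fun p k r a b x ha hb hx =>
        N.str.act_mem p k r a _ x ha (fun y => G.map_mem _ _ (hb y)) hx
      act_d := fun p k a b x ha hb => by
        refine (N.str.act_d p k a _ x ha fun y => G.map_mem _ _ (hb y)).trans ?_
        congr 2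
        refine Finset.sum_congr rfl fun y _ => ?_
        congr 1
        refine congrArg (fun v => N.str.act a v x) (funext fun z => ?_)
        by_cases hz : z = y
        · subst hz
          rw [Function.update_self, Function.update_self, G.map_d]
        · rw [Function.update_of_ne hz, Function.update_of_ne hz]
      act_one := fun b x => N.str.act_one _ x
      act_perm := fun σ k a b x hb => N.str.act_perm σ k a _ x fun y => G.map_mem _ _ (hb y)
      act_comp := fun h h' i q k a c b x hc hb => by
        refine (N.str.act_comp h h' i q k a c _ x hc fun y => G.map_mem _ _ (hb y)).trans ?_
        congr 1
        refine congrArg (fun v => N.str.act a v x) ?_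
        refine Eq.trans ?_ (map_plug h i G.lin b _).symm
        exact congrArg _ (G.map_act c _).symm
      act_comp_last := fun h q k a c b x hc hb =>
        N.str.act_comp_last h q k a c _ x hc fun y => G.map_mem _ _ (hb y) }

variable (N : Mod B) (F : Alg.Hom B B)

/-- The powers of an endomorphism of an algebra. -/
def _root_.OperadicFormality.Alg.Hom.iter (n : ℕ) : Alg.Hom B B where
  toHom := F.toHom.iter n
  map_act := F.iter_act n

/-- The action of `B` on sequences: `b` acts through `F^n` on the `n`-th term and through `F^(n + 1)`
on the `n`-th homotopy. -/
def telAct (l : ℕ) : O.space (l + 1) →ₗ[ℂ] MultilinearMap ℂ (fun _ : Fin l => B.space.carrier)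
    ((ℕ → N.space.carrier × N.space.carrier) →ₗ[ℂ] (ℕ → N.space.carrier × N.space.carrier)) where
  toFun a :=
    { toFun := fun b => LinearMap.pi fun n =>
        LinearMap.prodMap ((N.pull (F.iter n)).str.act a b)
          ((N.pull (F.iter (n + 1))).str.act a b) ∘ₗ LinearMap.proj n
      map_update_add' := fun b i x y => LinearMap.ext fun _ => funext fun n => Prod.ext
        (LinearMap.congr_fun (((N.pull (F.iter n)).str.act a).map_update_add b i x y) _)
        (LinearMap.congr_fun (((N.pull (F.iter (n + 1))).str.act a).map_update_add b i x y) _)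
      map_update_smul' := fun b i c x => LinearMap.ext fun _ => funext fun n => Prod.ext
        (LinearMap.congr_fun (((N.pull (F.iter n)).str.act a).map_update_smul b i c x) _)
        (LinearMap.congr_fun (((N.pull (F.iter (n + 1))).str.act a).map_update_smul b i c x) _) }
  map_add' a a' := MultilinearMap.ext fun b => LinearMap.ext fun _ => funext fun n => Prod.ext
    (LinearMap.congr_fun (DFunLike.congr_fun (map_add (N.pull (F.iter n)).str.act a a') b) _)
    (LinearMap.congr_fun (DFunLike.congr_fun (map_add (N.pull (F.iter (n + 1))).str.act a a') b) _)
  map_smul' c a := MultilinearMap.ext fun b => LinearMap.ext fun _ => funext fun n => Prod.ext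
    (LinearMap.congr_fun (DFunLike.congr_fun (map_smul (N.pull (F.iter n)).str.act c a) b) _)
    (LinearMap.congr_fun (DFunLike.congr_fun (map_smul (N.pull (F.iter (n + 1))).str.act c a) b) _)

theorem telAct_mem {l : ℕ} (p : ℤ) (k : Fin l → ℤ) (r : ℤ) (a : O.space (l + 1))
    (b : Fin l → B.space) (γ : ℕ → N.space.carrier × N.space.carrier)
    (ha : a ∈ (O.space (l + 1)).gr p) (hb : ∀ y, b y ∈ B.space.gr (k y))
    (hγ : γ ∈ N.space.telGr r) : N.telAct F l a b γ ∈ N.space.telGr (p + ∑ y, k y + r) := fun n => by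
  refine ⟨(N.pull (F.iter n)).str.act_mem p k r a b _ ha hb (hγ n).1, ?_⟩
  have := (N.pull (F.iter (n + 1))).str.act_mem p k (r - 1) a b _ ha hb (hγ n).2
  rwa [← add_sub_assoc] at this

theorem parity_act {N : DGSpace.{u}} (s : ModStr B N) {l : ℕ} {p : ℤ} {k : Fin l → ℤ}
    {a : O.space (l + 1)} {b : Fin l → B.space}
    (ha : a ∈ (O.space (l + 1)).gr p) (hb : ∀ y, b y ∈ B.space.gr (k y)) (x : N) :
    N.parity (s.act a b x) = (p + ∑ y, k y).negOnePow • s.act a b (N.parity x) := by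
  induction x using DGSpace.proj_induction with
  | h0 => simp only [map_zero, smul_zero]
  | hadd x y hx hy => simp only [map_add, smul_add, hx, hy]
  | hm r x hx =>
    rw [parity_apply hx, parity_apply (s.act_mem p k r a b x ha hb hx), map_sign, smul_smul,
      ← Int.negOnePow_add]

variable {N F} {f : DGSpace.Hom N.space N.space}

theorem Semilinear.iter_act (hf : N.Semilinear F f) (n : ℕ) {l : ℕ} (a : O.space (l + 1))
    (b : Fin l → B.space) (x : N.space) : (f.iter n).lin (N.str.act a b x) =
      N.str.act a (fun y => (F.iter n).lin (b y)) ((f.iter n).lin x) := by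
  induction n with
  | zero => rfl
  | succ n ih => exact (congrArg f.lin ih).trans (hf l a _ _)

/-- The homotopy component of the differential compares the next term with `f` of the present one.
Semilinearity turns the action through `F^n` under `f` into the action through `F^(n+1)`, so that
the homotopy, the next term and the image of the present term are all acted on in the same way. -/
theorem Semilinear.d_add_parity_act (hf : N.Semilinear F f) (hB : B.space.d = 0) {l : ℕ} (n : ℕ)
    {p : ℤ} {k : Fin l → ℤ} {a : O.space (l + 1)} {b : Fin l → B.space}
    (ha : a ∈ (O.space (l + 1)).gr p) (hb : ∀ y, b y ∈ B.space.gr (k y)) (h x' x : N.space) :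
    N.space.d (N.str.act a (fun y => (F.iter (n + 1)).lin (b y)) h) +
        N.space.parity (N.str.act a (fun y => (F.iter (n + 1)).lin (b y)) x' -
          f.lin (N.str.act a (fun y => (F.iter n).lin (b y)) x)) =
      N.str.act ((O.space (l + 1)).d a) (fun y => (F.iter (n + 1)).lin (b y)) h +
        (p + ∑ y, k y).negOnePow • N.str.act a (fun y => (F.iter (n + 1)).lin (b y))
          (N.space.d h + N.space.parity (x' - f.lin x)) := by
  have hb' := fun y => (F.iter (n + 1)).map_mem _ _ (hb y)
  have hfx : f.lin (N.str.act a (fun y => (F.iter n).lin (b y)) x) =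
      N.str.act a (fun y => (F.iter (n + 1)).lin (b y)) (f.lin x) := hf l a _ x
  rw [hfx, ← map_sub, parity_act N.str ha hb', N.str.act_d_of_d_eq_zero hB h ha hb', map_add,
    smul_add, add_assoc]

/-- The telescope of a semilinear endomorphism as a module. -/
def tel (hB : B.space.d = 0) (hf : N.Semilinear F f) : Mod B where
  space := DGSpace.tel f
  str := ModStr.ofJointlyInjective hB _
    -- The axioms other than the Leibniz rule are tested on terms and homotopies separately. The
    -- homotopy coordinates are not chain maps, so the Leibniz rule is supplied on its own.
    (fun t : ℕ ⊕ ℕ => t.elim (fun n => N.pull (F.iter n)) fun n => N.pull (F.iter (n + 1)))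
    (fun t => match t with
      | Sum.inl n => telTerm f n
      | Sum.inr n => telHtpy f n)
    (fun x y h => tel_ext (fun n => h (Sum.inl n)) fun n => h (Sum.inr n))
    (ModStr.restrictAct (N.telAct F _) (⨆ i, N.space.telGr i)
      (ModStr.act_mem_iSup (N.telAct F _) _ (N.telAct_mem F)))
    (fun t a b x => match t with
      | Sum.inl n => rfl
      | Sum.inr n => rfl)
    (fun p k r a b x ha hb hx => N.telAct_mem F p k r a b _ ha hb hx)
    fun p k a b x ha hb => tel_ext
      (fun n => by
        rw [map_add, map_sign]
        exact (N.pull (F.iter n)).str.act_d_of_d_eq_zero hB _ ha hb)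
      fun n => by
        rw [map_add, map_sign]
        exact hf.d_add_parity_act hB n ha hb (telHtpy f n x) (telTerm f (n + 1) x) (telTerm f n x)

/-- The shift of the telescope is semilinear. -/
theorem tel_semilinear (hB : B.space.d = 0) (hf : N.Semilinear F f) :
    (tel hB hf).Semilinear F (telShift f) := fun l a b x => by
  refine tel_ext (fun n => ?_) fun n => ?_
  · change N.str.act a (fun y => (F.toHom.iter (n + 1)).lin (b y)) _ =
      N.str.act a (fun y => (F.toHom.iter n).lin (F.lin (b y))) _
    simp only [DGSpace.Hom.iter_succ']
    rfl
  · change N.str.act a (fun y => (F.toHom.iter (n + 1 + 1)).lin (b y)) _ =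
      N.str.act a (fun y => (F.toHom.iter (n + 1)).lin (F.lin (b y))) _
    simp only [DGSpace.Hom.iter_succ']
    rfl

/-- The orbits, as a morphism of modules. -/
def telConst (hB : B.space.d = 0) (hf : N.Semilinear F f) : Mod.Hom N (tel hB hf) where
  toHom := DGSpace.telConst f
  map_act a b x := tel_ext (fun n => hf.iter_act n a b x) fun n =>
    (map_zero (N.str.act a fun y => (F.iter (n + 1)).lin (b y))).symm

/-- A module with a pure semilinear endomorphism over a pure algebra with zero differential is
formal. -/
theorem isFormal_of_isPure (hO : O.IsNonpositive) (hB : B.space.d = 0) {ξ m : ℝ}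
    (hF : IsPure ξ 0 B.space F.toHom) (hξ : 0 < ξ) (hξ1 : ξ ≠ 1) (hf : N.Semilinear F f)
    (hp : IsPure ξ m N.space f) : N.IsFormal :=
  ⟨_, isInduced_of_isPure hO hB hF hξ hξ1 hf hp,
    nonempty_iso_cohomology hO hB hF hξ hξ1 (telConst hB hf) telConst_isQuasiIso
      (tel_semilinear hB hf) telShift_isDivisible
      (IsPure.of_isQuasiIso _ telConst_isQuasiIso telConst_shift hp)⟩

end Mod

end OperadicFormality

end

theorem mainTheorem5 (ξ : ℝ) (hξ : 0 < ξ) (hξ1 : ξ ≠ 1)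
    (O : OperadicFormality.DGOperad.{u})
    (hO : ∀ (n : ℕ) (p : ℤ), 0 < p → (O.space n).gr p = ⊥)
    (B : OperadicFormality.Alg O) (F : OperadicFormality.Alg.Hom B B)
    (hF : F.toHom.IsQuasiIso)
    (hpure : OperadicFormality.IsPure ξ 0 B.space F.toHom) :
    B.IsFormal ∧
    (B.space.d = 0 →
      ∀ (N : OperadicFormality.Mod B) (f : OperadicFormality.DGSpace.Hom N.space N.space) (m : ℝ),
        (∀ (l : ℕ) (a : O.space (l + 1)) (b : Fin l → B.space) (x : N.space),
          f.lin (N.str.act a b x) = N.str.act a (fun y => F.lin (b y)) (f.lin x)) →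
        OperadicFormality.IsPure ξ m N.space f →
        N.IsFormal) := by
  exact ⟨OperadicFormality.Alg.isFormal_of_isPure F hO hξ hξ1 hpure, fun hB N f m hf hp =>
    OperadicFormality.Mod.isFormal_of_isPure hO hB hpure hξ hξ1 hf hp⟩
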